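/- **Setting.** Let $M=(\mathcal S,\mathcal A,\mathcal W,H,\mathbb P,r)$ be a finite-horizon contextual MDP with measurable state and context spaces $\mathcal S,\mathcal W$, a finite nonempty action set $\mathcal A$, horizon $H$, transition kernels $\mathbb P_h(\cdot\mid s,a)$ that do not depend on the context, and known rewards $r_h(s,a,w)\in[0,1]$. For a measurable policy $\pi=(\pi_h)$, $\pi_h:\mathcal S\times\mathcal W\to\mathcal A$, let $V_h^\pi(s,w)=\mathbb E[\sum_{h'=h}^H r_{h'}(s_{h'},\pi_{h'}(s_{h'},w),w)\mid s_h=s]$ and $V_h^*(s,w)=\sup_\pi V_h^\pi(s,w)$. Write $\|x\|_{A}=\sqrt{x^\top A x}$, $\{x\}^+=\max\{x,0\}$ and $\mathbb P_h[f](s,a)=\mathbb E_{s'\sim\mathbb P_h(\cdot\mid s,a)}f(s')$. Let $d,m\ge1$, $d'=md$, and let $\phi:\mathcal S\times\mathcal A\to\mathbb R^d$, $\psi:\mathcal S\times\mathcal A\times\mathcal W\to\mathbb R^{d'}$ be measurable. **Assumptions.** (1) *Linear MDP*: for every $h\in[H]$ there are $\eta_h\in\mathbb R^{d'}$ and finite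 measures $\mu_h=(\mu_h^{(1)},\dots,\mu_h^{(d)})$ on $\mathcal S$ with $\mathbb P_h(\cdot\mid s,a)=\langle\mu_h(\cdot),\phi(s,a)\rangle$ and $r_h(s,a,w)=\langle\eta_h,\psi(s,a,w)\rangle$ for all $(s,a,w)$. (2) *Boundedness*: $\|\phi(s,a)\|_2\le1$, $\|\psi(s,a,w)\|_2\le1$, $\|\mu_h(\mathcal S)\|_2\le\sqrt d$, $\|\eta_h\|_2\le\sqrt{d'}$. (3) *Completeness*: for every $f(s,w)=\min\{\max_a\{\langle\nu,\psi(s,a,w)\rangle+b\|\phi(s,a)\|_{\Lambda^{-1}}\}^+,H\}$ with $\nu\in\mathbb R^{d'}$, $\Lambda\in\mathbb R^{d\times d}$ positive definite and $b\in\mathbb R$, and every $h\in[H]$, there is $\xi\in\mathbb R^{d'}$ with $\|\xi\|_2\le H\sqrt{d'}$ and $\mathbb P_h[f(\cdot,w)](s,a)=\langle\xi,\psi(s,a,w)\rangle$ for all $(s,a,w)$. (4) *Mappings*: $\psi(s,a,w)=\phi(s,a)\otimes\rho(w)$ for some $\rho:\mathcal W\to\mathbb R^m$, and there are known contexts $w^{(1)},\dots,w^{(n)}$,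 $n\le m$, and $L<\infty$ such that every $\rho(w)$ equals $\sum_j c_j(w)\rho(w^{(j)})$ for some coefficients with $\sum_j|c_j(w)|\le L$. **Protocol and algorithm (UCBlvd).** In episode $k=1,\dots,K$ an adversary picks the context $w^k$ and the initial state $s_1^k$, possibly at random and depending on the past; at step $h$ the agent plays $a_h^k=\pi_h^k(s_h^k,w^k)$, and $s_{h+1}^k$ has, given the past, the law $\mathbb P_h(\cdot\mid s_h^k,a_h^k)$. The regret is $R_K=\sum_{k=1}^K\big(V_1^*(s_1^k,w^k)-V_1^{\pi^k}(s_1^k,w^k)\big)$. Fix a finite set $D\subset\mathcal S\times\mathcal A$ whose features $\phi(s,a)$, $(s,a)\in D$, are linearly independent and span all features ($d$ linearly independent vectors when the features span $\mathbb R^d$). With inputs $\lambda>0$ and $\beta$, put $\phi_h^\tau=\phi(s_h^\tau,a_h^\tau)$, $\Lambda_h^k=\lambda I+\sum_{\tau<k}\phi_h^\tau(\phi_h^\tau)^\top$, $Q_{H+1}^k=0$, and for $h\le H$ $$Q_h^k(s,a,w)=\{r_h(s,a,w)+\langle\hat\xi_h^k,\psi(s,a,w)\rangle+2L\beta\|\phi(s,a)\|_{(\Lambda_h^k)^{-1}}\}^+,\qquad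 V_h^k(s,w)=\min\{\max_aQ_h^k(s,a,w),H\},$$ $\tilde\theta_h^k(w)=(\Lambda_h^k)^{-1}\sum_{\tau<k}\phi_h^\tau V_{h+1}^k(s_{h+1}^\tau,w)$, where $\hat\xi_h^k$ is the $\xi$-part of a minimizer of $\sum_{j\le n}\sum_{(s,a)\in D}(\langle\theta^{(j)},\phi(s,a)\rangle-\langle\xi,\psi(s,a,w^{(j)})\rangle)^2$ subject to $\|\theta^{(j)}-\tilde\theta_h^k(w^{(j)})\|_{\Lambda_h^k}\le\beta$ for all $j$ and $\|\xi\|_2\le H\sqrt{md}$. Start with $\tilde k=1$. At the start of episode $k$, if $\log\det\Lambda_h^k-\log\det\Lambda_h^{\tilde k}>1$ for some $h\in[H]$, set $\tilde k=k$ and compute the new $\hat\xi_h^{\tilde k}$ (a *planning call*). In episode $k$ the policy is $\pi_h^k(s,w)\in\arg\max_aQ_h^{\tilde k}(s,a,w)$. Minimizers and maximizers may be chosen by any measurable rule. **Theorem.** Let $T=KH$. Under assumptions (1)–(4): (a) For all $\lambda>0$ and $\beta$, the number of planning calls is always at most $dH\log\left(1+\frac{K}{d\lambda}\right)$. (b)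 There are absolute constants $c,C>0$ such that for every $\delta\in(0,0.5)$, if $\lambda=1$ and $\beta=cH(d+\sqrt{md})\sqrt{\log(mdT/\delta)}$, then with probability at least $1-2\delta$ $$R_K\le B:=2H\sqrt{T\log(dT/\delta)}+8HL\beta\sqrt{2dK\log K}\quad\text{and}\quad R_K\le E:=C\,L\sqrt{(d^3+md^2)H^3T}\,\log(mdT/\delta).$$ Moreover $B\le E$ whenever $L\ge1$ (which is automatic unless $\rho\equiv0$). In particular $R_K\le\tilde O\big(L\sqrt{(d^3+md^2)H^3T}\big)$. -/

import Mathlib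

open MeasureTheory ProbabilityTheory
open scoped Matrix

namespace LifelongRL

noncomputable section

/-! ### Finite-horizon contextual Markov decision processes

Episodes `k` run over `1, …, K`, time-steps `h` over `1, …, H`. Families indexed by `h : ℕ` are only
ever used at `1 ≤ h ≤ H` (states also at `H + 1`). -/

/-- A finite-horizon contextual MDP: the context changes the rewards but not the dynamics. -/
structure ContextualMDP (S A W : Type*) [MeasurableSpace S] [MeasurableSpace A]
    [MeasurableSpace W] where
  /-- the horizon -/
  H : ℕ
  /-- the transition probabilities -/
  P : ℕ → Kernel (S × A) S
  markov : ∀ h, IsMarkovKernel (P h)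
  /-- the reward functions -/
  r : ℕ → S → A → W → ℝ
  r_measurable : ∀ h ∈ Finset.Icc 1 H, Measurable fun x : S × A × W => r h x.1 x.2.1 x.2.2
  r_mem : ∀ h ∈ Finset.Icc 1 H, ∀ s a w, r h s a w ∈ Set.Icc (0 : ℝ) 1

/-- A (deterministic, context-dependent, measurable) policy. -/
structure Policy (S A W : Type*) [MeasurableSpace S] [MeasurableSpace A]
    [MeasurableSpace W] where
  act : ℕ → S → W → A
  measurable : ∀ h, Measurable fun x : S × W => act h x.1 x.2

section MDP

variable {S A W : Type*} [MeasurableSpace S] [MeasurableSpace A] [MeasurableSpace W]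

/-- The transition kernel from `s_h` to `s_{h+1}` when `π` is followed with context `w`. -/
def ContextualMDP.step (M : ContextualMDP S A W) (π : Policy S A W) (w : W) (h : ℕ) :
    Kernel S S :=
  (M.P h).comap (fun s => (s, π.act h s w))
    (measurable_id.prodMk ((π.measurable h).comp (measurable_id.prodMk measurable_const)))

/-- The conditional law of `s_{h+i}` given `s_h` when `π` is followed with context `w`. -/
def ContextualMDP.stateLaw (M : ContextualMDP S A W) (π : Policy S A W) (w : W) :
    (h i : ℕ) → Kernel S S
  | _, 0 => Kernel.id
  | h, i + 1 => Kernel.comp (M.stateLaw π w (h + 1) i) (M.step π w h)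

/-- The state value function `V_h^π(s, w)`: the sum over the steps `h, …, H` of the expected reward
obtained when `π` is followed from `s_h = s` with context `w`. -/
def ContextualMDP.value (M : ContextualMDP S A W) (π : Policy S A W) (h : ℕ) (s : S) (w : W) : ℝ :=
  ∑ i ∈ Finset.range (M.H + 1 - h),
    ∫ s', M.r (h + i) s' (π.act (h + i) s' w) w ∂(M.stateLaw π w h i s)

/-- The optimal value function `V_h^*(s, w) = sup_π V_h^π(s, w)`. -/
def ContextualMDP.optValue (M : ContextualMDP S A W) (h : ℕ) (s : S) (w : W) : ℝ :=
  ⨆ π : Policy S A W, M.value π h s w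

end MDP

/-! ### Assumptions -/

/-- The weighted norm `‖x‖_A = √(xᵀ A x)`. -/
def weightedNorm {ι : Type*} [Fintype ι] (A : Matrix ι ι ℝ) (x : EuclideanSpace ℝ ι) : ℝ :=
  Real.sqrt (x.ofLp ⬝ᵥ (A *ᵥ x.ofLp))

/-- The Kronecker product of two vectors. -/
def kron {d m : ℕ} (x : EuclideanSpace ℝ (Fin d)) (y : EuclideanSpace ℝ (Fin m)) :
    EuclideanSpace ℝ (Fin d × Fin m) :=
  WithLp.toLp 2 fun p => x p.1 * y p.2

section Assumptions

variable {S A W : Type*} [MeasurableSpace S] [MeasurableSpace A] [MeasurableSpace W]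

/-- `M` is a linear MDP with features `φ`, `ψ`, and the features, the measures `μ_h` and the reward
parameters `η_h` satisfy the usual norm bounds (`d' = Fintype.card κ`). -/
def IsBoundedLinearMDP {d : ℕ} {κ : Type*} [Fintype κ] (M : ContextualMDP S A W)
    (φ : S → A → EuclideanSpace ℝ (Fin d)) (ψ : S → A → W → EuclideanSpace ℝ κ) : Prop :=
  (∀ s a, ‖φ s a‖ ≤ 1) ∧ (∀ s a w, ‖ψ s a w‖ ≤ 1) ∧
  ∀ h ∈ Finset.Icc 1 M.H,
    ∃ (η : EuclideanSpace ℝ κ) (μ : Fin d → Measure S),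
      (∀ i, IsFiniteMeasure (μ i)) ∧
      (∀ s a (B : Set S), MeasurableSet B →
        (M.P h (s, a)).real B = ∑ i, (μ i).real B * φ s a i) ∧
      (∀ s a w, M.r h s a w = inner ℝ η (ψ s a w)) ∧
      ‖(WithLp.toLp 2 fun i => (μ i).real Set.univ : EuclideanSpace ℝ (Fin d))‖ ≤ Real.sqrt d ∧
      ‖η‖ ≤ Real.sqrt (Fintype.card κ)

/-- The function `(s, w) ↦ min {max_a {⟨ν, ψ(s,a,w)⟩ + b ‖φ(s,a)‖_{Λ⁻¹}}⁺, H}`. -/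
def classFun {d : ℕ} {κ : Type*} [Fintype κ] (H : ℕ)
    (φ : S → A → EuclideanSpace ℝ (Fin d)) (ψ : S → A → W → EuclideanSpace ℝ κ)
    (ν : EuclideanSpace ℝ κ) (Λ : Matrix (Fin d) (Fin d) ℝ) (b : ℝ) (s : S) (w : W) : ℝ :=
  min (⨆ a : A, max (inner ℝ ν (ψ s a w) + b * weightedNorm Λ⁻¹ (φ s a)) 0) (H : ℝ)

/-- Completeness: the backup of every function of the class is linear in `ψ`, with a parameter of
norm at most `H √d'`. -/
def IsBackupComplete {d : ℕ} {κ : Type*} [Fintype κ] (M : ContextualMDP S A W)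
    (φ : S → A → EuclideanSpace ℝ (Fin d)) (ψ : S → A → W → EuclideanSpace ℝ κ) : Prop :=
  ∀ (ν : EuclideanSpace ℝ κ) (Λ : Matrix (Fin d) (Fin d) ℝ) (b : ℝ), Λ.PosDef →
    ∀ h ∈ Finset.Icc 1 M.H, ∃ ξ : EuclideanSpace ℝ κ,
      ‖ξ‖ ≤ M.H * Real.sqrt (Fintype.card κ) ∧
      ∀ s a w, ∫ s', classFun M.H φ ψ ν Λ b s' w ∂(M.P h (s, a)) = inner ℝ ξ (ψ s a w)

/-- Mappings: `ψ = φ ⊗ ρ`, and the `n ≤ m` reference contexts span all `ρ(w)` with coefficients of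
`ℓ¹`-norm at most `L`. -/
def IsMapping {d m n : ℕ} (φ : S → A → EuclideanSpace ℝ (Fin d))
    (ψ : S → A → W → EuclideanSpace ℝ (Fin d × Fin m)) (ρ : W → EuclideanSpace ℝ (Fin m))
    (wref : Fin n → W) (L : ℝ) : Prop :=
  (∀ s a w, ψ s a w = kron (φ s a) (ρ w)) ∧ n ≤ m ∧
  ∀ w, ∃ c : Fin n → ℝ, ρ w = ∑ j, c j • ρ (wref j) ∧ ∑ j, |c j| ≤ L

/-- `D` is a finite set of state-action pairs whose features are linearly independent and span all
features (so `D` has `d` elements when the features span `ℝ^d`). -/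
def IsFeatureBasis {d : ℕ} (φ : S → A → EuclideanSpace ℝ (Fin d)) (D : Finset (S × A)) : Prop :=
  LinearIndepOn ℝ (fun x : S × A => φ x.1 x.2) (D : Set (S × A)) ∧
  ∀ s a, φ s a ∈ Submodule.span ℝ ((fun x : S × A => φ x.1 x.2) '' (D : Set (S × A)))

end Assumptions

/-! ### The algorithm UCBlvd -/

/-- What the algorithm is given, besides the rewards and the horizon. -/
structure Params (S A W : Type*) (d m n : ℕ) where
  φ : S → A → EuclideanSpace ℝ (Fin d)
  ψ : S → A → W → EuclideanSpace ℝ (Fin d × Fin m)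
  /-- the reference contexts `w^{(1)}, …, w^{(n)}` -/
  wref : Fin n → W
  /-- the state-action pairs used in the planning program -/
  D : Finset (S × A)
  L : ℝ
  lam : ℝ
  β : ℝ

section Algorithm

variable {S A W : Type*} [MeasurableSpace S] [MeasurableSpace A] [MeasurableSpace W]
  {d m n : ℕ} (M : ContextualMDP S A W) (I : Params S A W d m n)
  -- the observed states `s_h^k`, the actions `a_h^k` and the parameters `ξ̂_h^k`
  (st : ℕ → ℕ → S) (act : ℕ → ℕ → A) (ξ : ℕ → ℕ → EuclideanSpace ℝ (Fin d × Fin m))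

/-- `Λ_h^k = λ I + ∑_{τ=1}^{k-1} φ_h^τ (φ_h^τ)ᵀ`. -/
def gram (k h : ℕ) : Matrix (Fin d) (Fin d) ℝ :=
  I.lam • (1 : Matrix (Fin d) (Fin d) ℝ) +
    ∑ τ ∈ Finset.Ico 1 k,
      Matrix.vecMulVec (I.φ (st τ h) (act τ h)).ofLp (I.φ (st τ h) (act τ h)).ofLp

/-- `Q_h^k(s, a, w) = {r_h(s,a,w) + ⟨ξ̂_h^k, ψ(s,a,w)⟩ + 2 L β ‖φ(s,a)‖_{(Λ_h^k)⁻¹}}⁺` for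
`h ≤ H`, and `Q_{H+1}^k = 0`. -/
def qFun (k h : ℕ) (s : S) (a : A) (w : W) : ℝ :=
  if h ≤ M.H then
    max (M.r h s a w + inner ℝ (ξ k h) (I.ψ s a w)
      + 2 * I.L * I.β * weightedNorm (gram I st act k h)⁻¹ (I.φ s a)) 0
  else 0

/-- `V_h^k(s, w) = min {max_a Q_h^k(s, a, w), H}`. -/
def vFun (k h : ℕ) (s : S) (w : W) : ℝ :=
  min (⨆ a : A, qFun M I st act ξ k h s a w) (M.H : ℝ)

/-- The regularized least-squares estimator
`θ̃_h^k(w) = (Λ_h^k)⁻¹ ∑_{τ=1}^{k-1} V_{h+1}^k(s_{h+1}^τ, w) φ_h^τ`. -/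
def thetaTilde (k h : ℕ) (w : W) : EuclideanSpace ℝ (Fin d) :=
  WithLp.toLp 2 ((gram I st act k h)⁻¹ *ᵥ
    (∑ τ ∈ Finset.Ico 1 k,
      vFun M I st act ξ k (h + 1) (st τ (h + 1)) w • I.φ (st τ h) (act τ h)).ofLp)

/-- The constraints of the planning program, for `(ξ, (θ^{(j)})_j)`. -/
def planFeasible (k h : ℕ) :
    Set (EuclideanSpace ℝ (Fin d × Fin m) × (Fin n → EuclideanSpace ℝ (Fin d))) :=
  {p | (∀ j, weightedNorm (gram I st act k h)
          (p.2 j - thetaTilde M I st act ξ k h (I.wref j)) ≤ I.β) ∧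
        ‖p.1‖ ≤ M.H * Real.sqrt (m * d)}

/-- The objective of the planning program. -/
def planObjective
    (p : EuclideanSpace ℝ (Fin d × Fin m) × (Fin n → EuclideanSpace ℝ (Fin d))) : ℝ :=
  ∑ j, ∑ x ∈ I.D,
    (inner ℝ (p.2 j) (I.φ x.1 x.2) - inner ℝ p.1 (I.ψ x.1 x.2 (I.wref j))) ^ 2

/-- `ξ̂_h^k` is the `ξ`-part of a solution of the planning program (whose data at step `h` depend on
`ξ̂_{h+1}^k` through `V_{h+1}^k`). -/
def IsPlanned (k h : ℕ) : Prop :=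
  ∃ θ : Fin n → EuclideanSpace ℝ (Fin d),
    (ξ k h, θ) ∈ planFeasible M I st act ξ k h ∧
    IsMinOn (planObjective I) (planFeasible M I st act ξ k h) (ξ k h, θ)

/-- The criterion for replanning in episode `k` when the last planning was for episode `k'`. -/
def Replan (k k' : ℕ) : Prop :=
  ∃ h ∈ Finset.Icc 1 M.H,
    1 < Real.log (gram I st act k h).det - Real.log (gram I st act k' h).det

open Classical in
/-- The value of `k̃` that is used in episode `k`; `kTilde 0 = 1` is its initial value. -/
def kTilde : ℕ → ℕ
  | 0 => 1
  | k + 1 => if Replan M I st act (k + 1) (kTilde k) then k + 1 else kTilde k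

open Classical in
/-- The number of episodes `k ≤ K` in which the algorithm enters its planning branch. -/
def planningCalls (K : ℕ) : ℕ :=
  ((Finset.Icc 1 K).filter fun k => Replan M I st act k (kTilde M I st act (k - 1))).card

end Algorithm

/-- A run of UCBlvd for `K` episodes on the contextual MDP `M`, as a stochastic process on the
probability space `(Ω, μ)`. The σ-algebra `ℱ (k, h)` is the information available when the action
`a_h^k` is played (pairs are ordered lexicographically). It may be larger than the one generated by
the past, so that the initial states and contexts can be chosen by a randomized adaptive adversary,
and minimizers and maximizers by any measurable rule. -/
structure Run {S A W : Type*} [MeasurableSpace S] [MeasurableSpace A] [MeasurableSpace W]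
    {d m n : ℕ} (M : ContextualMDP S A W) (I : Params S A W d m n) (K : ℕ)
    {Ω : Type*} [mΩ : MeasurableSpace Ω] (μ : Measure Ω) where
  ℱ : Filtration (ℕ ×ₗ ℕ) mΩ
  /-- the contexts `w^k` -/
  ctx : ℕ → Ω → W
  /-- the states `s_h^k` -/
  st : ℕ → ℕ → Ω → S
  /-- the actions `a_h^k` -/
  act : ℕ → ℕ → Ω → A
  /-- the parameters `ξ̂_h^k` -/
  ξ : ℕ → ℕ → Ω → EuclideanSpace ℝ (Fin d × Fin m)
  /-- the policies `π^k` -/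
  pol : ℕ → Ω → Policy S A W
  ctx_measurable : ∀ k ∈ Finset.Icc 1 K, Measurable[ℱ (toLex (k, 1))] (ctx k)
  st_measurable : ∀ k ∈ Finset.Icc 1 K, ∀ h ∈ Finset.Icc 1 (M.H + 1),
    Measurable[ℱ (toLex (k, h))] (st k h)
  ξ_measurable : ∀ k ∈ Finset.Icc 1 K, ∀ h ∈ Finset.Icc 1 M.H,
    Measurable[ℱ (toLex (k, 1))] (ξ k h)
  pol_measurable : ∀ k ∈ Finset.Icc 1 K, ∀ h ∈ Finset.Icc 1 M.H,
    Measurable[(ℱ (toLex (k, 1))).prod (inferInstance : MeasurableSpace (S × W))]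
      fun x : Ω × S × W => (pol k x.1).act h x.2.1 x.2.2
  /-- the actions are those of the policy -/
  act_eq : ∀ k ∈ Finset.Icc 1 K, ∀ h ∈ Finset.Icc 1 M.H, ∀ ω,
    act k h ω = (pol k ω).act h (st k h ω) (ctx k ω)
  /-- given the past, `s_{h+1}^k` has the law `P_h(· | s_h^k, a_h^k)` -/
  transition : ∀ k ∈ Finset.Icc 1 K, ∀ h ∈ Finset.Icc 1 M.H, ∀ B : Set S, MeasurableSet B →
    μ⟦st k (h + 1) ⁻¹' B | ℱ (toLex (k, h))⟧
      =ᵐ[μ] fun ω => (M.P h (st k h ω, act k h ω)).real B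
  /-- the parameters in force in episode `k` solve the planning programs of episode `k̃` -/
  planned : ∀ k ∈ Finset.Icc 1 K, ∀ h ∈ Finset.Icc 1 M.H, ∀ ω,
    IsPlanned M I (fun k h => st k h ω) (fun k h => act k h ω) (fun k h => ξ k h ω)
      (kTilde M I (fun k h => st k h ω) (fun k h => act k h ω) k) h
  /-- in episode `k` the policy maximizes `Q_h^{k̃}` over the actions -/
  greedy : ∀ k ∈ Finset.Icc 1 K, ∀ h ∈ Finset.Icc 1 M.H, ∀ ω s w a,
    qFun M I (fun k h => st k h ω) (fun k h => act k h ω) (fun k h => ξ k h ω)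
        (kTilde M I (fun k h => st k h ω) (fun k h => act k h ω) k) h s a w
      ≤ qFun M I (fun k h => st k h ω) (fun k h => act k h ω) (fun k h => ξ k h ω)
        (kTilde M I (fun k h => st k h ω) (fun k h => act k h ω) k) h s ((pol k ω).act h s w) w

section RunQuantities

variable {S A W : Type*} [MeasurableSpace S] [MeasurableSpace A] [MeasurableSpace W]
  {d m n : ℕ} {M : ContextualMDP S A W} {I : Params S A W d m n} {K : ℕ}
  {Ω : Type*} [MeasurableSpace Ω] {μ : Measure Ω}

/-- The number of planning calls of the run. -/
def Run.planningCalls (R : Run M I K μ) (ω : Ω) : ℕ :=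
  LifelongRL.planningCalls M I (fun k h => R.st k h ω) (fun k h => R.act k h ω) K

/-- The regret `R_K = ∑_{k ≤ K} (V_1^*(s_1^k, w^k) - V_1^{π^k}(s_1^k, w^k))`. -/
def Run.regret (R : Run M I K μ) (ω : Ω) : ℝ :=
  ∑ k ∈ Finset.Icc 1 K,
    (M.optValue 1 (R.st k 1 ω) (R.ctx k ω) - M.value (R.pol k ω) 1 (R.st k 1 ω) (R.ctx k ω))

end RunQuantities

end

end LifelongRL

open LifelongRL

/-! Planning calls are counted by a potential. Each call raises the sum over `h` of `log det Λ_h` by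
more than 1, because some summand jumps by more than 1 and none decreases. Each summand grows by at
most `d log (1 + K / (dλ))`, by the inequality of arithmetic and geometric means for the eigenvalues
(`planningCalls_le_sum`, `log_det_seqGram_le`).

For the regret, the heart is `abs_inner_sub_backup_le`. Completeness provides an exact backup
parameter, and the linear MDP provides exact transition parameters at the reference contexts. When
the ridge estimators are within `β` of the latter, this exact pair is feasible for the planning
program and has objective zero, so the computed solution has objective zero too. Its equalities on
`D` extend to all state-action pairs by linearity in `φ`. Expanding `ρ(w)` in the reference contexts
then gives accuracy at every context, at the price of a factor `L`. Accuracy yields optimism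
(`value_le_vFun`), and unrolling the Bellman equation bounds the regret by exploration widths plus
martingale noise (`Run.regret_le_width_add_noise`). A plan that has not been renewed has widths at
most `√e` times the current ones, so the elliptical potential controls their sum
(`Run.sum_width_le`). The noise obeys an Azuma–Hoeffding bound.

It remains to control the ridge estimators, whose targets are value functions built from the same
data. For a fixed direction and a fixed target, Hoeffding's lemma makes an exponential weight a
supermartingale (`Run.measure_logWeight_ge_le`). A union bound covers a grid of directions and of
value-function parameters. Only afterwards is the direction taken proportional to the actual error
`u`: the bound becomes an inequality quadratic in `u`, which is solved for its `Λ`-norm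
(`ridge_error_le`). The grid has `d + dm + d²` coordinates, and its range and its inverse mesh are
powers of `Z = mdT/δ`, so the union bound costs a multiple of `(d² + md) log Z`, and `β²` absorbs
`H²` times this.

The remaining regimes are elementary. If `K ≤ 2` or `K ≤ L`, the trivial bound `KH` suffices. If `L
< 1`, then `ρ` vanishes, hence so do all rewards. -/

namespace LifelongRL

set_option linter.unusedSectionVars false

/-! ### Regularized Gram matrices, determinants and the elliptical potential -/

section LinearAlgebra

set_option linter.unusedDecidableInType false

variable {ι : Type*} [Fintype ι] [DecidableEq ι]

lemma dotProduct_mulVec_comm {A : Matrix ι ι ℝ} (hA : Aᵀ = A) (x y : ι → ℝ) :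
    x ⬝ᵥ A *ᵥ y = y ⬝ᵥ A *ᵥ x := by
  rw [Matrix.dotProduct_mulVec, ← Matrix.mulVec_transpose, hA, dotProduct_comm]

/-- Cauchy–Schwarz for a semidefinite form: the quadratic polynomial `t ↦ (x + t y)ᵀ A (x + t y)` is
nonnegative, so its discriminant is not positive. -/
lemma dotProduct_mulVec_sq_le {A : Matrix ι ι ℝ} (hA : A.PosSemidef) (x y : ι → ℝ) :
    (x ⬝ᵥ A *ᵥ y) ^ 2 ≤ (x ⬝ᵥ A *ᵥ x) * (y ⬝ᵥ A *ᵥ y) := by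
  have hsymm : Aᵀ = A := by simpa [Matrix.IsHermitian] using hA.1
  have key : ∀ t : ℝ, 0 ≤ (y ⬝ᵥ A *ᵥ y) * (t * t) + (2 * (x ⬝ᵥ A *ᵥ y)) * t + x ⬝ᵥ A *ᵥ x := by
    intro t
    have h := hA.dotProduct_mulVec_nonneg (x + t • y)
    have h2 := dotProduct_mulVec_comm hsymm x y
    simp only [star_trivial, Matrix.mulVec_add, Matrix.mulVec_smul, dotProduct_add,
      add_dotProduct, smul_dotProduct, dotProduct_smul, smul_eq_mul] at h
    linear_combination h - t * h2
  have := discrim_le_zero key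
  rw [discrim] at this
  nlinarith

lemma dotProduct_sq_le {A : Matrix ι ι ℝ} (hA : A.PosDef) (x y : ι → ℝ) :
    (x ⬝ᵥ y) ^ 2 ≤ (x ⬝ᵥ A *ᵥ x) * (y ⬝ᵥ A⁻¹ *ᵥ y) := by
  have h := dotProduct_mulVec_sq_le hA.posSemidef x (A⁻¹ *ᵥ y)
  rwa [Matrix.mulVec_mulVec, Matrix.mul_nonsing_inv _ hA.det_pos.ne'.isUnit, Matrix.one_mulVec,
    dotProduct_comm (A⁻¹ *ᵥ y) y] at h

lemma abs_inner_le_weightedNorm_mul {A : Matrix ι ι ℝ} (hA : A.PosDef) (x y : EuclideanSpace ℝ ι) :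
    |inner ℝ x y| ≤ weightedNorm A x * weightedNorm A⁻¹ y := by
  have h := dotProduct_sq_le hA x.ofLp y.ofLp
  have h0 : 0 ≤ x.ofLp ⬝ᵥ A *ᵥ x.ofLp := by
    simpa using hA.posSemidef.dotProduct_mulVec_nonneg x.ofLp
  rw [weightedNorm, weightedNorm, ← Real.sqrt_mul h0]
  apply Real.abs_le_sqrt
  convert h using 2
  simp [PiLp.inner_apply, dotProduct, mul_comm]

lemma det_add_vecMulVec_self {A : Matrix ι ι ℝ} (hA : A.PosDef) (u : ι → ℝ) :
    (A + Matrix.vecMulVec u u).det = A.det * (1 + u ⬝ᵥ A⁻¹ *ᵥ u) := by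
  rw [Matrix.vecMulVec_eq Unit, Matrix.det_add_replicateCol_mul_replicateRow hA.det_pos.ne'.isUnit]
  congr 2
  rw [Matrix.dotProduct_mulVec]
  simp [Matrix.mul_apply, dotProduct, Matrix.vecMul]

lemma posSemidef_vecMulVec_self (u : ι → ℝ) : (Matrix.vecMulVec u u).PosSemidef := by
  simpa using Matrix.posSemidef_vecMulVec_self_star u

/-- With `x = B y` for the updated matrix `B`, both sides become polynomials in `yᵀAy`, `u·y` and
`uᵀA⁻¹u`, and the claim reduces to `(u·y)² ≤ (yᵀAy)(uᵀA⁻¹u)`. The factor is exactly the one by which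
the determinant grows, which is what makes the log-determinant the right replanning criterion. -/
lemma dotProduct_inv_mulVec_le_of_rankOne {A : Matrix ι ι ℝ} (hA : A.PosDef) (u x : ι → ℝ) :
    x ⬝ᵥ A⁻¹ *ᵥ x
      ≤ (1 + u ⬝ᵥ A⁻¹ *ᵥ u) * (x ⬝ᵥ (A + Matrix.vecMulVec u u)⁻¹ *ᵥ x) := by
  have hB : (A + Matrix.vecMulVec u u).PosDef := hA.add_posSemidef (posSemidef_vecMulVec_self u)
  set B := A + Matrix.vecMulVec u u with hBdef
  obtain ⟨y, rfl⟩ : ∃ y, x = B *ᵥ y := ⟨B⁻¹ *ᵥ x, by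
    rw [Matrix.mulVec_mulVec, Matrix.mul_nonsing_inv _ hB.det_pos.ne'.isUnit, Matrix.one_mulVec]⟩
  have hBy : B *ᵥ y = A *ᵥ y + (u ⬝ᵥ y) • u := by
    rw [hBdef, Matrix.add_mulVec, Matrix.vecMulVec_mulVec]
    ext i; simp
  have hsymm : Aᵀ = A := by simpa [Matrix.IsHermitian] using hA.1
  have hsymmi : A⁻¹ᵀ = A⁻¹ := by rw [Matrix.transpose_nonsing_inv, hsymm]
  have hinv : A⁻¹ *ᵥ (A *ᵥ y) = y := by
    rw [Matrix.mulVec_mulVec, Matrix.nonsing_inv_mul _ hA.det_pos.ne'.isUnit, Matrix.one_mulVec]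
  have h1 : (A *ᵥ y) ⬝ᵥ A⁻¹ *ᵥ u = u ⬝ᵥ y := by
    rw [dotProduct_mulVec_comm hsymmi, hinv]
  have h2 : B⁻¹ *ᵥ (B *ᵥ y) = y := by
    rw [Matrix.mulVec_mulVec, Matrix.nonsing_inv_mul _ hB.det_pos.ne'.isUnit, Matrix.one_mulVec]
  have hcs := dotProduct_sq_le hA y u
  rw [h2, hBy]
  simp only [Matrix.mulVec_add, Matrix.mulVec_smul, dotProduct_add, add_dotProduct,
    smul_dotProduct, dotProduct_smul, smul_eq_mul, hinv, h1]
  rw [dotProduct_comm y u] at hcs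
  rw [dotProduct_comm (A *ᵥ y) y]
  nlinarith

/-- `lam • 1 + ∑_{1 ≤ τ < k} v_τ v_τᵀ`. -/
noncomputable def seqGram (lam : ℝ) (v : ℕ → ι → ℝ) (k : ℕ) : Matrix ι ι ℝ :=
  lam • (1 : Matrix ι ι ℝ) + ∑ τ ∈ Finset.Ico 1 k, Matrix.vecMulVec (v τ) (v τ)

variable {lam : ℝ} {v : ℕ → ι → ℝ}

lemma seqGram_posDef (hlam : 0 < lam) (v : ℕ → ι → ℝ) (k : ℕ) : (seqGram lam v k).PosDef := by
  refine Matrix.PosDef.add_posSemidef (Matrix.PosDef.one.smul hlam) ?_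
  exact Matrix.posSemidef_sum _ fun τ _ => posSemidef_vecMulVec_self (v τ)

lemma seqGram_succ {k : ℕ} (hk : 1 ≤ k) :
    seqGram lam v (k + 1) = seqGram lam v k + Matrix.vecMulVec (v k) (v k) := by
  rw [seqGram, seqGram, Finset.sum_Ico_succ_top hk, add_assoc]

lemma seqGram_one : seqGram lam v 1 = lam • (1 : Matrix ι ι ℝ) := by simp [seqGram]

lemma dotProduct_inv_mulVec_nonneg {A : Matrix ι ι ℝ} (hA : A.PosDef) (x : ι → ℝ) :
    0 ≤ x ⬝ᵥ A⁻¹ *ᵥ x := by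
  simpa using hA.inv.posSemidef.dotProduct_mulVec_nonneg x

lemma log_det_seqGram_succ (hlam : 0 < lam) {k : ℕ} (hk : 1 ≤ k) :
    Real.log (seqGram lam v (k + 1)).det
      = Real.log (seqGram lam v k).det + Real.log (1 + v k ⬝ᵥ (seqGram lam v k)⁻¹ *ᵥ v k) := by
  have hA := seqGram_posDef hlam v k
  have := dotProduct_inv_mulVec_nonneg hA (v k)
  rw [seqGram_succ hk, det_add_vecMulVec_self hA, Real.log_mul hA.det_pos.ne' (by positivity)]

lemma log_det_seqGram_mono (hlam : 0 < lam) {j k : ℕ} (hj : 1 ≤ j) (hjk : j ≤ k) :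
    Real.log (seqGram lam v j).det ≤ Real.log (seqGram lam v k).det := by
  induction k, hjk using Nat.le_induction with
  | base => exact le_rfl
  | succ k hk ih =>
    rw [log_det_seqGram_succ hlam (hj.trans hk)]
    have := dotProduct_inv_mulVec_nonneg (seqGram_posDef hlam v k) (v k)
    have := Real.log_nonneg (x := 1 + v k ⬝ᵥ (seqGram lam v k)⁻¹ *ᵥ v k) (by linarith)
    linarith

/-- Each rank-one update shrinks the inverse form by at most the factor it puts on the determinant;
the factors multiply along the updates. This compares an outdated Gram matrix with the current one.
-/
lemma dotProduct_inv_seqGram_le (hlam : 0 < lam) {j k : ℕ} (hj : 1 ≤ j) (hjk : j ≤ k)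
    (x : ι → ℝ) :
    x ⬝ᵥ (seqGram lam v j)⁻¹ *ᵥ x ≤
      Real.exp (Real.log (seqGram lam v k).det - Real.log (seqGram lam v j).det)
        * (x ⬝ᵥ (seqGram lam v k)⁻¹ *ᵥ x) := by
  induction k, hjk using Nat.le_induction with
  | base => simp
  | succ k hk ih =>
    have hA := seqGram_posDef hlam v k
    have hq := dotProduct_inv_mulVec_nonneg hA (v k)
    refine ih.trans ?_
    rw [log_det_seqGram_succ hlam (hj.trans hk), add_sub_right_comm, Real.exp_add,
      Real.exp_log (by positivity), mul_assoc, seqGram_succ (hj.trans hk)]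
    gcongr
    exact dotProduct_inv_mulVec_le_of_rankOne hA _ _

lemma dotProduct_seqGram_mulVec_self (v : ℕ → ι → ℝ) (k : ℕ) (x : ι → ℝ) :
    x ⬝ᵥ seqGram lam v k *ᵥ x
      = lam * (x ⬝ᵥ x) + ∑ τ ∈ Finset.Ico 1 k, (x ⬝ᵥ v τ) ^ 2 := by
  rw [seqGram, Matrix.add_mulVec, dotProduct_add, Matrix.sum_mulVec, dotProduct_sum,
    Matrix.smul_mulVec, Matrix.one_mulVec, dotProduct_smul, smul_eq_mul]
  congr 1
  refine Finset.sum_congr rfl fun τ _ => ?_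
  rw [Matrix.vecMulVec_mulVec]
  simp [sq, dotProduct_comm x (v τ)]

/-- The Gram matrix `A` dominates `lam • 1`. Writing `x = A y`, this and Cauchy–Schwarz give `lam q²
≤ (x·x) q` for `q = x·y`, and a positive `q` can be cancelled. -/
lemma dotProduct_inv_seqGram_le_div (hlam : 0 < lam) (k : ℕ) (x : ι → ℝ) :
    x ⬝ᵥ (seqGram lam v k)⁻¹ *ᵥ x ≤ (x ⬝ᵥ x) / lam := by
  have hA := seqGram_posDef hlam v k
  set A := seqGram lam v k with hAdef
  obtain ⟨y, rfl⟩ : ∃ y, x = A *ᵥ y := ⟨A⁻¹ *ᵥ x, by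
    rw [Matrix.mulVec_mulVec, Matrix.mul_nonsing_inv _ hA.det_pos.ne'.isUnit, Matrix.one_mulVec]⟩
  rw [Matrix.mulVec_mulVec, Matrix.nonsing_inv_mul _ hA.det_pos.ne'.isUnit, Matrix.one_mulVec]
  have h1 : lam * (y ⬝ᵥ y) ≤ y ⬝ᵥ A *ᵥ y := by
    rw [hAdef, dotProduct_seqGram_mulVec_self]
    have : 0 ≤ ∑ τ ∈ Finset.Ico 1 k, (y ⬝ᵥ v τ) ^ 2 := by positivity
    linarith
  have h2 := dotProduct_mulVec_sq_le (Matrix.PosSemidef.one (n := ι) (R := ℝ)) (A *ᵥ y) y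
  simp only [Matrix.one_mulVec] at h2
  rw [le_div_iff₀ hlam]
  rw [dotProduct_comm y (A *ᵥ y)] at h1
  have h3 : 0 ≤ (A *ᵥ y) ⬝ᵥ (A *ᵥ y) := Finset.sum_nonneg fun i _ => mul_self_nonneg _
  have h4 : 0 ≤ y ⬝ᵥ y := Finset.sum_nonneg fun i _ => mul_self_nonneg _
  by_contra! hcon
  set q := A *ᵥ y ⬝ᵥ y
  set p := A *ᵥ y ⬝ᵥ A *ᵥ y
  have hq : 0 < q := by
    by_contra! hq
    nlinarith
  have h5 : lam * q ^ 2 ≤ p * q := by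
    nlinarith [mul_le_mul_of_nonneg_left h1 h3]
  nlinarith

/-- The elliptical potential lemma. Since `lam ≥ 1`, every summand `q` lies in `[0, 1]`, where `q ≤
2 log (1 + q)`; the logarithms are the increments of the log-determinant and telescope. -/
lemma sum_dotProduct_inv_seqGram_le (hlam : 1 ≤ lam) (hv : ∀ τ, v τ ⬝ᵥ v τ ≤ 1) (K : ℕ) :
    ∑ k ∈ Finset.Icc 1 K, v k ⬝ᵥ (seqGram lam v k)⁻¹ *ᵥ v k
      ≤ 2 * (Real.log (seqGram lam v (K + 1)).det - Real.log (seqGram lam v 1).det) := by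
  have hlam0 : 0 < lam := by linarith
  induction K with
  | zero => simp
  | succ K ih =>
    rw [Finset.sum_Icc_succ_top (by omega), log_det_seqGram_succ hlam0 (k := K + 1) (by omega)]
    have hq := dotProduct_inv_mulVec_nonneg (seqGram_posDef hlam0 v (K + 1)) (v (K + 1))
    have hq1 : v (K + 1) ⬝ᵥ (seqGram lam v (K + 1))⁻¹ *ᵥ v (K + 1) ≤ 1 := by
      refine (dotProduct_inv_seqGram_le_div hlam0 _ _).trans ?_
      rw [div_le_one hlam0]
      exact (hv _).trans hlam
    set q := v (K + 1) ⬝ᵥ (seqGram lam v (K + 1))⁻¹ *ᵥ v (K + 1)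
    have : q ≤ 2 * Real.log (1 + q) := by
      have := Real.one_sub_inv_le_log_of_pos (x := 1 + q) (by linarith)
      have h2 : 1 - (1 + q)⁻¹ = q / (1 + q) := by field_simp; ring
      have h3 : q / 2 ≤ q / (1 + q) := div_le_div_of_nonneg_left hq (by linarith) (by linarith)
      linarith
    linarith

/-- The geometric mean of the eigenvalues is at most their arithmetic mean. -/
lemma log_det_le_card_mul_log_trace [Nonempty ι] {A : Matrix ι ι ℝ} (hA : A.PosDef) :
    Real.log A.det ≤ Fintype.card ι * Real.log (A.trace / Fintype.card ι) := by
  have hd : (0 : ℝ) < Fintype.card ι := by exact_mod_cast Fintype.card_pos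
  have hpos := hA.eigenvalues_pos
  have hdet : A.det = ∏ i, hA.1.eigenvalues i := by
    simpa using hA.1.det_eq_prod_eigenvalues
  have htr : A.trace = ∑ i, hA.1.eigenvalues i := by
    simpa using hA.1.trace_eq_sum_eigenvalues
  have hgm := Real.geom_mean_le_arith_mean_weighted Finset.univ
    (fun _ : ι => 1 / (Fintype.card ι : ℝ)) hA.1.eigenvalues (fun _ _ => by positivity)
    (by simp [hd.ne']) (fun i _ => (hpos i).le)
  have h2 := Real.log_le_log
    (Finset.prod_pos fun i _ => Real.rpow_pos_of_pos (hpos i) _) hgm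
  rw [Real.log_prod (fun i _ => (Real.rpow_pos_of_pos (hpos i) _).ne')] at h2
  simp only [Real.log_rpow (hpos _), ← Finset.mul_sum] at h2
  rw [hdet, htr, Real.log_prod (fun i _ => (hpos i).ne')]
  rw [one_div_mul_eq_div, one_div_mul_eq_div, div_le_iff₀ hd] at h2
  linarith

lemma log_det_seqGram_le [Nonempty ι] (hlam : 0 < lam) (hv : ∀ τ, v τ ⬝ᵥ v τ ≤ 1) (k : ℕ) :
    Real.log (seqGram lam v (k + 1)).det - Real.log (seqGram lam v 1).det
      ≤ Fintype.card ι * Real.log (1 + k / (Fintype.card ι * lam)) := by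
  have hd : (0 : ℝ) < Fintype.card ι := by exact_mod_cast Fintype.card_pos
  have h1 := log_det_le_card_mul_log_trace (seqGram_posDef hlam v (k + 1))
  have htr : (seqGram lam v (k + 1)).trace ≤ Fintype.card ι * lam + k := by
    rw [seqGram, Matrix.trace_add, Matrix.trace_smul, Matrix.trace_one, Matrix.trace_sum,
      smul_eq_mul, mul_comm]
    gcongr
    calc ∑ τ ∈ Finset.Ico 1 (k + 1), (Matrix.vecMulVec (v τ) (v τ)).trace
        ≤ ∑ τ ∈ Finset.Ico 1 (k + 1), (1 : ℝ) := by
          refine Finset.sum_le_sum fun τ _ => ?_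
          rw [Matrix.trace_vecMulVec]; exact hv τ
      _ = k := by simp
  have htr0 : 0 < (seqGram lam v (k + 1)).trace := (seqGram_posDef hlam v (k + 1)).trace_pos
  have h2 : Real.log ((seqGram lam v (k + 1)).trace / Fintype.card ι)
      ≤ Real.log lam + Real.log (1 + k / (Fintype.card ι * lam)) := by
    rw [← Real.log_mul hlam.ne' (by positivity)]
    apply Real.log_le_log (by positivity)
    rw [div_le_iff₀ hd]
    calc _ ≤ _ := htr
      _ = _ := by field_simp
  have h3 : Real.log (seqGram lam v 1).det = Fintype.card ι * Real.log lam := by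
    rw [seqGram_one, Matrix.det_smul, Matrix.det_one, mul_one, Real.log_pow]
  rw [h3]
  nlinarith

end LinearAlgebra

/-! ### Integrals against the transition kernels, the Bellman equation and measurability of values
-/

section Values

variable {S A W : Type*} [MeasurableSpace S] [MeasurableSpace A] [MeasurableSpace W]

lemma integrable_of_abs_le {α : Type*} [MeasurableSpace α] {μ : Measure α} [IsFiniteMeasure μ]
    {f : α → ℝ} (hf : Measurable f) {C : ℝ} (hC : ∀ x, |f x| ≤ C) : Integrable f μ :=
  Integrable.of_bound hf.aestronglyMeasurable C (Filter.Eventually.of_forall hC)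

lemma integral_mem_Icc {α : Type*} [MeasurableSpace α] {μ : Measure α} [IsProbabilityMeasure μ]
    {f : α → ℝ} (hf : Measurable f) {a b : ℝ} (h : ∀ x, f x ∈ Set.Icc a b) :
    ∫ x, f x ∂μ ∈ Set.Icc a b := by
  have hint : Integrable f μ := integrable_of_abs_le (C := max |a| |b|) hf
    fun x => abs_le_max_abs_abs (h x).1 (h x).2
  constructor
  · simpa using integral_mono (integrable_const (μ := μ) a) hint fun x => (h x).1
  · simpa using integral_mono hint (integrable_const (μ := μ) b) fun x => (h x).2

/-- The coefficients `x i` may be negative, so the right side is not an integral against a measure.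
Moving the negative parts to the left turns the hypothesis into an identity between finite measures,
which can be integrated. -/
lemma integral_eq_sum_of_real_eq {d : ℕ} {ν : Measure S} [IsFiniteMeasure ν]
    {μ : Fin d → Measure S} (hμ : ∀ i, IsFiniteMeasure (μ i)) {x : Fin d → ℝ}
    (h : ∀ B, MeasurableSet B → ν.real B = ∑ i, (μ i).real B * x i)
    {f : S → ℝ} (hf : Measurable f) {C : ℝ} (hC : ∀ s, |f s| ≤ C) :
    ∫ s, f s ∂ν = ∑ i, (∫ s, f s ∂(μ i)) * x i := by
  have hfin : ∀ y : Fin d → ℝ, IsFiniteMeasure (∑ i, ENNReal.ofReal (y i) • μ i) := fun y => ⟨by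
    rw [Measure.finsetSum_apply]
    exact ENNReal.sum_lt_top.2 fun i _ =>
      ENNReal.mul_lt_top ENNReal.ofReal_lt_top (measure_lt_top _ _)⟩
  have := hfin x
  have := hfin fun i => -x i
  have hfin' : ∀ (y : ℝ) (i : Fin d), IsFiniteMeasure (ENNReal.ofReal y • μ i) := fun y i => ⟨
    ENNReal.mul_lt_top ENNReal.ofReal_lt_top (measure_lt_top _ _)⟩
  have key : ν + ∑ i, ENNReal.ofReal (-x i) • μ i = ∑ i, ENNReal.ofReal (x i) • μ i := by
    ext B hB
    rw [← ENNReal.toReal_eq_toReal_iff' (measure_ne_top _ _) (measure_ne_top _ _)]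
    rw [Measure.add_apply, ENNReal.toReal_add (measure_ne_top _ _) (measure_ne_top _ _)]
    simp only [Measure.finsetSum_apply, Measure.smul_apply, smul_eq_mul]
    rw [ENNReal.toReal_sum fun i _ => ENNReal.mul_ne_top ENNReal.ofReal_ne_top (measure_ne_top _ _),
      ENNReal.toReal_sum fun i _ => ENNReal.mul_ne_top ENNReal.ofReal_ne_top (measure_ne_top _ _)]
    simp only [ENNReal.toReal_mul, ENNReal.toReal_ofReal']
    have := h B hB
    simp only [Measure.real] at this
    rw [this, ← Finset.sum_add_distrib]
    refine Finset.sum_congr rfl fun i _ => ?_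
    rcases le_total 0 (x i) with hx | hx
    · rw [max_eq_right (by linarith), max_eq_left hx]; ring
    · rw [max_eq_left (by linarith), max_eq_right hx]; ring
  have hint : ∀ (ρ : Measure S) [IsFiniteMeasure ρ], Integrable f ρ := fun ρ _ =>
    integrable_of_abs_le hf hC
  have h2 := congrArg (fun ρ => ∫ s, f s ∂ρ) key
  rw [integral_add_measure (hint _) (hint _), integral_finsetSum_measure fun i _ => hint _,
    integral_finsetSum_measure fun i _ => hint _] at h2
  simp only [integral_smul_measure, ENNReal.toReal_ofReal', smul_eq_mul] at h2
  rw [eq_sub_of_add_eq h2, ← Finset.sum_sub_distrib]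
  refine Finset.sum_congr rfl fun i _ => ?_
  rcases le_total 0 (x i) with hx | hx
  · rw [max_eq_right (by linarith : -x i ≤ 0), max_eq_left hx]; ring
  · rw [max_eq_left (by linarith : 0 ≤ -x i), max_eq_right hx]; ring

variable (M : ContextualMDP S A W)

instance (h : ℕ) : IsMarkovKernel (M.P h) := M.markov h

instance (π : Policy S A W) (w : W) (h : ℕ) : IsMarkovKernel (M.step π w h) := by
  unfold ContextualMDP.step; infer_instance

instance (π : Policy S A W) (w : W) (h i : ℕ) : IsMarkovKernel (M.stateLaw π w h i) := by
  induction i generalizing h with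
  | zero => unfold ContextualMDP.stateLaw; infer_instance
  | succ i ih => unfold ContextualMDP.stateLaw; infer_instance

lemma reward_policy_measurable (π : Policy S A W) {h : ℕ} (hh : h ∈ Finset.Icc 1 M.H) (w : W) :
    Measurable fun s => M.r h s (π.act h s w) w :=
  (M.r_measurable h hh).comp (measurable_id.prodMk
    (((π.measurable h).comp (measurable_id.prodMk measurable_const)).prodMk measurable_const))

lemma value_eq_zero (π : Policy S A W) (s : S) (w : W) : M.value π (M.H + 1) s w = 0 := by
  simp [ContextualMDP.value]

lemma value_mem (π : Policy S A W) {h : ℕ} (hh : 1 ≤ h) (s : S) (w : W) :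
    M.value π h s w ∈ Set.Icc (0 : ℝ) M.H := by
  have hterm : ∀ i ∈ Finset.range (M.H + 1 - h),
      ∫ s', M.r (h + i) s' (π.act (h + i) s' w) w ∂(M.stateLaw π w h i s) ∈ Set.Icc (0 : ℝ) 1 := by
    intro i hi
    have hmem : h + i ∈ Finset.Icc 1 M.H := by
      simp only [Finset.mem_range, Finset.mem_Icc] at hi ⊢; omega
    exact integral_mem_Icc (reward_policy_measurable M π hmem w) fun s' => M.r_mem _ hmem _ _ _
  constructor
  · exact Finset.sum_nonneg fun i hi => (hterm i hi).1
  · refine (Finset.sum_le_sum fun i hi => (hterm i hi).2).trans ?_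
    simp only [Finset.sum_const, Finset.card_range, nsmul_eq_mul, mul_one, Nat.cast_le]
    omega

/-- The Bellman equation for the value of a policy. -/
lemma value_eq (π : Policy S A W) {h : ℕ} (hh : h ∈ Finset.Icc 1 M.H) (s : S) (w : W) :
    M.value π h s w = M.r h s (π.act h s w) w
      + ∫ s', M.value π (h + 1) s' w ∂(M.P h (s, π.act h s w)) := by
  rw [Finset.mem_Icc] at hh
  have hmeas : ∀ i ∈ Finset.range (M.H - h),
      Measurable fun s' => M.r (h + 1 + i) s' (π.act (h + 1 + i) s' w) w := by
    intro i hi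
    rw [Finset.mem_range] at hi
    exact reward_policy_measurable M π (Finset.mem_Icc.2 (by omega)) w
  have hbd : ∀ i ∈ Finset.range (M.H - h), ∀ s',
      M.r (h + 1 + i) s' (π.act (h + 1 + i) s' w) w ∈ Set.Icc (0 : ℝ) 1 := by
    intro i hi s'
    rw [Finset.mem_range] at hi
    exact M.r_mem _ (Finset.mem_Icc.2 (by omega)) _ _ _
  have hcomp : ∀ i ∈ Finset.range (M.H - h),
      ∫ s', M.r (h + (i + 1)) s' (π.act (h + (i + 1)) s' w) w ∂(M.stateLaw π w h (i + 1) s)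
        = ∫ s₁, ∫ s', M.r (h + 1 + i) s' (π.act (h + 1 + i) s' w) w
            ∂(M.stateLaw π w (h + 1) i s₁) ∂(M.P h (s, π.act h s w)) := by
    intro i hi
    rw [show h + (i + 1) = h + 1 + i by ring]
    change ∫ s', _ ∂((M.stateLaw π w (h + 1) i ∘ₖ M.step π w h) s) = _
    rw [Kernel.integral_comp]
    · rfl
    · exact integrable_of_abs_le (C := 1) (hmeas i hi) fun s' =>
        abs_le.2 ⟨by linarith [(hbd i hi s').1], (hbd i hi s').2⟩
  rw [ContextualMDP.value, show M.H + 1 - h = (M.H - h) + 1 by omega, Finset.sum_range_succ',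
    Finset.sum_congr rfl hcomp, add_comm]
  congr 1
  · simp only [add_zero, ContextualMDP.stateLaw, Kernel.id_apply]
    exact integral_dirac' _ _
      (reward_policy_measurable M π (Finset.mem_Icc.2 hh) w).stronglyMeasurable
  · simp only [ContextualMDP.value, show M.H + 1 - (h + 1) = M.H - h by omega]
    rw [integral_finsetSum]
    intro i hi
    refine integrable_of_abs_le (C := 1)
      (StronglyMeasurable.integral_kernel (hmeas i hi).stronglyMeasurable).measurable fun s₁ => ?_
    have := integral_mem_Icc (μ := M.stateLaw π w (h + 1) i s₁) (hmeas i hi) (hbd i hi)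
    exact abs_le.2 ⟨by linarith [this.1], this.2⟩

/-- Integrating a jointly measurable function of a parameter and of the next state. -/
lemma measurable_integral_transition {Ω : Type*} [MeasurableSpace Ω] (h : ℕ) {q : Ω → S × A}
    (hq : Measurable q) {f : Ω → S → ℝ} (hf : Measurable fun x : Ω × S => f x.1 x.2) :
    Measurable fun ω => ∫ s', f ω s' ∂(M.P h (q ω)) := by
  have := (hf.stronglyMeasurable.integral_kernel_prod_right'
    (κ := (M.P h).comap q hq)).measurable
  exact this

/-- Joint measurability for a random policy and context, by backward induction along the Bellman
equation. The noise in the regret involves the value of the policy of the episode, which is itself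
random. -/
lemma value_measurable {Ω : Type*} [MeasurableSpace Ω] {pol : Ω → Policy S A W} {ctx : Ω → W}
    (hctx : Measurable ctx)
    (hpol : ∀ h ∈ Finset.Icc 1 M.H,
      Measurable fun x : Ω × S × W => (pol x.1).act h x.2.1 x.2.2)
    {h : ℕ} (hh : h ∈ Finset.Icc 1 (M.H + 1)) :
    Measurable fun x : Ω × S => M.value (pol x.1) h x.2 (ctx x.1) := by
  rw [Finset.mem_Icc] at hh
  obtain ⟨h1, h2⟩ := hh
  induction h2 using Nat.decreasingInduction with
  | self => simp [value_eq_zero]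
  | of_succ h hle ih =>
    have hmem : h ∈ Finset.Icc 1 M.H := Finset.mem_Icc.2 ⟨h1, by omega⟩
    have ih := ih (by omega)
    have hact : Measurable fun x : Ω × S => (pol x.1).act h x.2 (ctx x.1) :=
      (hpol h hmem).comp (measurable_fst.prodMk (measurable_snd.prodMk (hctx.comp measurable_fst)))
    simp only [value_eq M _ hmem]
    refine Measurable.add ?_ ?_
    · exact (M.r_measurable h hmem).comp
        (measurable_snd.prodMk (hact.prodMk (hctx.comp measurable_fst)))
    · exact measurable_integral_transition M h (measurable_snd.prodMk hact)
        (f := fun (x : Ω × S) s' => M.value (pol x.1) (h + 1) s' (ctx x.1))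
        (ih.comp ((measurable_fst.comp measurable_fst).prodMk measurable_snd))

lemma value_measurable_state (π : Policy S A W) (w : W) {h : ℕ}
    (hh : h ∈ Finset.Icc 1 (M.H + 1)) : Measurable fun s => M.value π h s w := by
  have := value_measurable M (Ω := Unit) (pol := fun _ => π) (ctx := fun _ => w) measurable_const
    (fun h _ => (π.measurable h).comp measurable_snd) hh
  exact this.comp (measurable_const.prodMk measurable_id : Measurable fun s : S => ((), s))

instance [Nonempty A] : Nonempty (Policy S A W) :=
  ⟨⟨fun _ _ _ => Classical.arbitrary A, fun _ => measurable_const⟩⟩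

lemma optValue_mem [Nonempty A] {h : ℕ} (hh : 1 ≤ h) (s : S) (w : W) :
    M.optValue h s w ∈ Set.Icc (0 : ℝ) M.H := by
  constructor
  · exact Real.iSup_nonneg fun π => (value_mem M π hh s w).1
  · exact ciSup_le fun π => (value_mem M π hh s w).2

end Values

/-! ### Exponential supermartingales for successive transitions -/

section Probability

open scoped ENNReal

variable {Ω S A : Type*} [mΩ : MeasurableSpace Ω] [mS : MeasurableSpace S] [MeasurableSpace A]

/-- The joint law of `(q, X)` is the composition product of the law of `q` with `κ`: the two agree
on rectangles. -/
lemma lintegral_comp_of_transition {Ω' : Type*} [MeasurableSpace Ω'] {μ : Measure Ω}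
    [IsFiniteMeasure μ] {q : Ω → Ω'} (hq : Measurable q) {X : Ω → S} (hX : Measurable X)
    {κ : Kernel Ω' S} [IsMarkovKernel κ]
    (h : ∀ A B, MeasurableSet A → MeasurableSet B →
      μ (q ⁻¹' A ∩ X ⁻¹' B) = ∫⁻ ω in q ⁻¹' A, κ (q ω) B ∂μ)
    {F : Ω' × S → ℝ≥0∞} (hF : Measurable F) :
    ∫⁻ ω, F (q ω, X ω) ∂μ = ∫⁻ ω, ∫⁻ s', F (q ω, s') ∂(κ (q ω)) ∂μ := by
  have key : μ.map (fun ω => (q ω, X ω)) = (μ.map q) ⊗ₘ κ := by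
    refine Measure.ext_prod fun {A B} hA hB => ?_
    rw [Measure.map_apply (hq.prodMk hX) (hA.prod hB), Measure.compProd_apply_prod hA hB,
      setLIntegral_map hA (Kernel.measurable_coe κ hB) hq, ← h A B hA hB]
    rfl
  rw [← lintegral_map hF (hq.prodMk hX), key, Measure.lintegral_compProd hF,
    lintegral_map (hF.lintegral_kernel_prod_right') hq]

lemma lintegral_transition {Ω : Type*} {m mΩ : MeasurableSpace Ω} (hm : m ≤ mΩ) {μ : Measure Ω}
    [IsFiniteMeasure μ] {q : Ω → S × A} (hq : Measurable[m] q) {X : Ω → S} (hX : Measurable X)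
    {P : Kernel (S × A) S} [IsMarkovKernel P]
    (htr : ∀ B : Set S, MeasurableSet B →
      μ⟦X ⁻¹' B | m⟧ =ᵐ[μ] fun ω => (P (q ω)).real B)
    {F : Ω → S → ℝ≥0∞} (hF : Measurable[m.prod mS] fun x : Ω × S => F x.1 x.2) :
    ∫⁻ ω, F ω (X ω) ∂μ = ∫⁻ ω, ∫⁻ s', F ω s' ∂(P (q ω)) ∂μ := by
  have hq' : Measurable q := hq.mono hm le_rfl
  -- The conditioning variable is the identity from `Ω` to `Ω` equipped with the smaller σ-algebra
  -- `m`. This lets `F` depend on everything known at the time, not only on the current state and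
  -- action.
  refine @lintegral_comp_of_transition Ω S mΩ mS Ω m μ _ id (measurable_id'' hm) X hX
    (P.comap q hq) (Kernel.IsMarkovKernel.comap P hq)
    (fun A B hA hB => ?_) (fun x => F x.1 x.2) hF
  have h1 : ∫ ω in A, (P (q ω)).real B ∂μ = μ.real (A ∩ X ⁻¹' B) := by
    have h2 := setIntegral_condExp (μ := μ) (f := (X ⁻¹' B).indicator fun _ => (1 : ℝ)) hm
      ((integrable_const _).indicator (hX hB)) hA
    rw [setIntegral_congr_ae (g := fun ω => (P (q ω)).real B) (hm _ hA)
      ((htr B hB).mono fun ω h _ => h)] at h2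
    rw [h2, setIntegral_indicator (hX hB)]
    simp
  change μ (A ∩ X ⁻¹' B) = ∫⁻ ω in A, P (q ω) B ∂μ
  rw [← ofReal_measureReal, ← h1, ofReal_integral_eq_lintegral_ofReal]
  · simp [measureReal_def]
  · refine (integrable_of_abs_le (C := 1) ?_ fun ω => ?_)
    · exact ((Kernel.measurable_coe P hB).comp hq').ennreal_toReal
    · rw [abs_of_nonneg measureReal_nonneg]
      exact measureReal_le_one
  · exact Filter.Eventually.of_forall fun ω => measureReal_nonneg

/-- A form of Hoeffding's lemma. -/
lemma lintegral_exp_hoeffding_le_one {ν : Measure S} [IsProbabilityMeasure ν] {f : S → ℝ}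
    (hf : Measurable f) {lo hi : ℝ} (hbd : ∀ s, f s ∈ Set.Icc lo hi) (t : ℝ) :
    ∫⁻ s, ENNReal.ofReal
      (Real.exp (t * (f s - ∫ s', f s' ∂ν) - t ^ 2 * (hi - lo) ^ 2 / 8)) ∂ν ≤ 1 := by
  have h := hasSubgaussianMGF_of_mem_Icc (μ := ν) hf.aemeasurable
    (Filter.Eventually.of_forall hbd)
  have h1 := h.mgf_le t
  have h2 := h.integrable_exp_mul t
  rw [mgf] at h1
  simp only [sub_eq_add_neg, Real.exp_add] at h1 h2 ⊢
  rw [← ofReal_integral_eq_lintegral_ofReal, ← ENNReal.ofReal_one]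
  · apply ENNReal.ofReal_le_ofReal
    rw [integral_mul_const, Real.exp_neg, ← div_eq_mul_inv, div_le_one (Real.exp_pos _)]
    refine h1.trans (Real.exp_le_exp.2 (le_of_eq ?_))
    simp only [NNReal.coe_pow, NNReal.coe_div, coe_nnnorm, Real.norm_eq_abs, NNReal.coe_ofNat,
      div_pow, sq_abs]
    ring
  · exact h2.mul_const _
  · exact Filter.Eventually.of_forall fun ω => by positivity

/-- The supermartingale property in product form. Removing the factor with the largest index does
not decrease the integral, because the other factors are known by then and can play the role of `G`.
-/
lemma lintegral_prod_le_one {ι : Type*} [LinearOrder ι] {μ : Measure Ω} [IsProbabilityMeasure μ]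
    (ℱ : Filtration ι mΩ) {Y : ι → Ω → ℝ≥0∞} (s : Finset ι)
    (hmeas : ∀ i ∈ s, ∀ j ∈ s, i < j → Measurable[ℱ j] (Y i))
    (hstep : ∀ i ∈ s, ∀ G : Ω → ℝ≥0∞, Measurable[ℱ i] G → ∫⁻ ω, G ω * Y i ω ∂μ ≤ ∫⁻ ω, G ω ∂μ) :
    ∫⁻ ω, ∏ i ∈ s, Y i ω ∂μ ≤ 1 := by
  induction s using Finset.induction_on_max with
  | empty => simp
  | insert a s ha ih =>
    have hnot : a ∉ s := fun h => lt_irrefl _ (ha a h)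
    have h1 := hstep a (by simp) (fun ω => ∏ i ∈ s, Y i ω)
      (Finset.measurable_prod _ fun i hi => hmeas i (by simp [hi]) a (by simp) (ha i hi))
    simp only [Finset.prod_insert hnot, mul_comm (Y a _)]
    exact h1.trans (ih (fun i hi j hj => hmeas i (by simp [hi]) j (by simp [hj]))
      fun i hi => hstep i (by simp [hi]))

/-- An exponential tail bound for sums of centred bounded functions of successive transitions. -/
lemma measure_sum_transition_ge_le {ι : Type*} [LinearOrder ι] {μ : Measure Ω}
    [IsProbabilityMeasure μ] (ℱ : Filtration ι mΩ) (s : Finset ι) {X : ι → Ω → S}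
    (hX : ∀ i ∈ s, Measurable (X i))
    (hXℱ : ∀ i ∈ s, ∀ j ∈ s, i < j → Measurable[ℱ j] (X i))
    {q : ι → Ω → S × A} (hq : ∀ i ∈ s, Measurable[ℱ i] (q i))
    {P : ι → Kernel (S × A) S} (hP : ∀ i, IsMarkovKernel (P i))
    (htr : ∀ i ∈ s, ∀ B : Set S, MeasurableSet B →
      μ⟦X i ⁻¹' B | ℱ i⟧ =ᵐ[μ] fun ω => (P i (q i ω)).real B)
    {f : ι → Ω → S → ℝ}
    (hf : ∀ i ∈ s, Measurable[(ℱ i).prod mS] fun x : Ω × S => f i x.1 x.2)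
    {lo hi : ℝ} (hbd : ∀ i ∈ s, ∀ ω x, f i ω x ∈ Set.Icc lo hi)
    {a : ι → Ω → ℝ} (ha : ∀ i ∈ s, Measurable[ℱ i] (a i)) (r : ℝ) :
    μ {ω | r ≤ ∑ i ∈ s, (a i ω * (f i ω (X i ω) - ∫ x, f i ω x ∂(P i (q i ω)))
        - a i ω ^ 2 * (hi - lo) ^ 2 / 8)} ≤ ENNReal.ofReal (Real.exp (-r)) := by
  let F : ι → Ω → S → ℝ := fun i ω x =>
    a i ω * (f i ω x - ∫ x, f i ω x ∂(P i (q i ω))) - a i ω ^ 2 * (hi - lo) ^ 2 / 8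
  have hF : ∀ i ∈ s, Measurable[(ℱ i).prod mS] fun x : Ω × S => F i x.1 x.2 := by
    intro i hi
    have := hP i
    let _ := ℱ i
    have hint : Measurable fun ω => ∫ x, f i ω x ∂(P i (q i ω)) :=
      ((hf i hi).stronglyMeasurable.integral_kernel_prod_right'
        (κ := (P i).comap (q i) (hq i hi))).measurable
    have ha' := ha i hi
    have hf' := hf i hi
    exact (((ha'.comp measurable_fst).mul (hf'.sub (hint.comp measurable_fst))).sub
      ((((ha'.comp measurable_fst).pow_const 2).mul_const _).div_const _))
  have hFX : ∀ i ∈ s, ∀ m : MeasurableSpace Ω, ℱ i ≤ m → Measurable[m] (X i) →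
      Measurable[m] fun ω => F i ω (X i ω) := by
    intro i hi m hm hXm
    have h1 : Measurable[m, (ℱ i).prod mS] fun ω => (ω, X i ω) :=
      (measurable_id'' hm).prodMk hXm
    exact (hF i hi).comp h1
  have key : ∫⁻ ω, ∏ i ∈ s, ENNReal.ofReal (Real.exp (F i ω (X i ω))) ∂μ ≤ 1 := by
    refine lintegral_prod_le_one ℱ s (fun i hi j hj hij => ?_) fun i hi G hG => ?_
    · exact (Real.measurable_exp.comp
        (hFX i hi _ (ℱ.mono hij.le) (hXℱ i hi j hj hij))).ennreal_ofReal
    · have := hP i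
      have hmeas : Measurable[(ℱ i).prod mS]
          fun x : Ω × S => G x.1 * ENNReal.ofReal (Real.exp (F i x.1 x.2)) := by
        let _ := ℱ i
        exact (hG.comp measurable_fst).mul (Real.measurable_exp.comp (hF i hi)).ennreal_ofReal
      rw [lintegral_transition (ℱ.le i) (hq i hi) (hX i hi) (htr i hi)
        (F := fun ω x => G ω * ENNReal.ofReal (Real.exp (F i ω x))) hmeas]
      refine lintegral_mono fun ω => ?_
      have hfω : Measurable (f i ω) := by
        let _ := ℱ i
        exact (hf i hi).comp measurable_prodMk_left
      have hFω : Measurable (F i ω) := by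
        let _ := ℱ i
        exact (hF i hi).comp measurable_prodMk_left
      dsimp only
      rw [lintegral_const_mul _ hFω.exp.ennreal_ofReal]
      exact mul_le_of_le_one_right' (lintegral_exp_hoeffding_le_one hfω (hbd i hi ω) (a i ω))
  have hmeasX : Measurable fun ω => ∏ i ∈ s, ENNReal.ofReal (Real.exp (F i ω (X i ω))) :=
    Finset.measurable_prod _ fun i hi =>
      (Real.measurable_exp.comp (hFX i hi _ (ℱ.le i) (hX i hi))).ennreal_ofReal
  -- Exponentiation turns the sum into the product controlled by `key`, to which Markov's inequality
  -- applies.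
  have hset : {ω | r ≤ ∑ i ∈ s, F i ω (X i ω)}
      = {ω | ENNReal.ofReal (Real.exp r) ≤ ∏ i ∈ s, ENNReal.ofReal (Real.exp (F i ω (X i ω)))} := by
    ext ω
    rw [Set.mem_ofPred_eq, Set.mem_ofPred_eq,
      ← ENNReal.ofReal_prod_of_nonneg fun i _ => (Real.exp_pos _).le, ← Real.exp_sum,
      ENNReal.ofReal_le_ofReal_iff (Real.exp_pos _).le, Real.exp_le_exp]
  change μ {ω | r ≤ ∑ i ∈ s, F i ω (X i ω)} ≤ _
  rw [hset, Real.exp_neg, ENNReal.ofReal_inv_of_pos (Real.exp_pos _)]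
  have h1 := (mul_meas_ge_le_lintegral hmeasX (ENNReal.ofReal (Real.exp r))).trans key
  rw [mul_comm] at h1
  exact ENNReal.le_inv_iff_mul_le.2 h1

end Probability

/-! ### Measurability along a run and the weight of a fixed direction and target -/

section RunMeasurability

variable {S A W : Type*} [MeasurableSpace S] [MeasurableSpace A] [MeasurableSpace W]
  {d m n : ℕ} {M : ContextualMDP S A W} {I : Params S A W d m n} {K : ℕ}
  {Ω : Type*} [mΩ : MeasurableSpace Ω] {μ : Measure Ω} (R : Run M I K μ)

lemma Run.ctx_measurable_step {k h : ℕ} (hk : k ∈ Finset.Icc 1 K) (hh : 1 ≤ h) :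
    Measurable[R.ℱ (toLex (k, h))] (R.ctx k) :=
  (R.ctx_measurable k hk).mono
    (R.ℱ.mono (Prod.Lex.toLex_le_toLex.2 (Or.inr ⟨rfl, hh⟩))) le_rfl

lemma Run.act_measurable {k h : ℕ} (hk : k ∈ Finset.Icc 1 K) (hh : h ∈ Finset.Icc 1 M.H) :
    Measurable[R.ℱ (toLex (k, h))] (R.act k h) := by
  have hh' := Finset.mem_Icc.1 hh
  have hle : R.ℱ (toLex (k, 1)) ≤ R.ℱ (toLex (k, h)) :=
    R.ℱ.mono (Prod.Lex.toLex_le_toLex.2 (Or.inr ⟨rfl, hh'.1⟩))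
  have h1 : Measurable[R.ℱ (toLex (k, h)), (R.ℱ (toLex (k, 1))).prod inferInstance]
      fun ω => (ω, R.st k h ω, R.ctx k ω) :=
    (measurable_id'' hle).prodMk
      ((R.st_measurable k hk h (Finset.mem_Icc.2 (by omega))).prodMk
        (R.ctx_measurable_step hk hh'.1))
  rw [show R.act k h = _ from funext fun ω => R.act_eq k hk h hh ω]
  exact (R.pol_measurable k hk h hh).comp h1

lemma Run.stateAction_measurable {k h : ℕ} (hk : k ∈ Finset.Icc 1 K)
    (hh : h ∈ Finset.Icc 1 M.H) :
    Measurable[R.ℱ (toLex (k, h))] fun ω => (R.st k h ω, R.act k h ω) := by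
  have hh' := Finset.mem_Icc.1 hh
  exact (R.st_measurable k hk h (Finset.mem_Icc.2 (by omega))).prodMk (R.act_measurable hk hh)

/-- The exponent of the supermartingale that controls the estimation of `P_h f` in direction `x`
from the first `k - 1` episodes. -/
noncomputable def Run.logWeight (k h : ℕ) (x : EuclideanSpace ℝ (Fin d)) (f : S → ℝ) (ω : Ω) : ℝ :=
  ∑ τ ∈ Finset.Ico 1 k,
    (inner ℝ x (I.φ (R.st τ h ω) (R.act τ h ω))
        * (f (R.st τ (h + 1) ω) - ∫ s', f s' ∂(M.P h (R.st τ h ω, R.act τ h ω)))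
      - inner ℝ x (I.φ (R.st τ h ω) (R.act τ h ω)) ^ 2 * (M.H : ℝ) ^ 2 / 8)

lemma Run.measure_logWeight_ge_le [IsProbabilityMeasure μ]
    (hφ : Measurable fun x : S × A => I.φ x.1 x.2) {k h : ℕ} (hk : k ∈ Finset.Icc 1 K)
    (hh : h ∈ Finset.Icc 1 M.H) (x : EuclideanSpace ℝ (Fin d)) {f : S → ℝ} (hf : Measurable f)
    (hbd : ∀ s, f s ∈ Set.Icc (0 : ℝ) M.H) (r : ℝ) :
    μ {ω | r ≤ R.logWeight k h x f ω} ≤ ENNReal.ofReal (Real.exp (-r)) := by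
  have hk' := Finset.mem_Icc.1 hk
  have hh' := Finset.mem_Icc.1 hh
  have hτ : ∀ i ∈ (Finset.Ico 1 k).image (fun τ => toLex (τ, h)),
      (ofLex i).1 ∈ Finset.Icc 1 K ∧ (ofLex i).2 = h := by
    intro i hi
    obtain ⟨τ, hτ, rfl⟩ := Finset.mem_image.1 hi
    simp only [Finset.mem_Ico] at hτ
    exact ⟨Finset.mem_Icc.2 ⟨hτ.1, by simp; omega⟩, rfl⟩
  have hstm : ∀ i ∈ (Finset.Ico 1 k).image (fun τ => toLex (τ, h)),
      Measurable[R.ℱ (toLex ((ofLex i).1, h + 1))] (R.st (ofLex i).1 (h + 1)) := fun i hi =>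
    R.st_measurable _ (hτ i hi).1 _ (Finset.mem_Icc.2 (by omega))
  have hq : ∀ i ∈ (Finset.Ico 1 k).image (fun τ => toLex (τ, h)),
      Measurable[R.ℱ i] fun ω => (R.st (ofLex i).1 h ω, R.act (ofLex i).1 h ω) := by
    intro i hi
    have := R.stateAction_measurable (hτ i hi).1 hh
    rwa [show toLex ((ofLex i).1, h) = i by rw [← (hτ i hi).2]; rfl] at this
  have key := measure_sum_transition_ge_le (μ := μ) R.ℱ
    ((Finset.Ico 1 k).image (fun τ => toLex (τ, h)))
    (X := fun i => R.st (ofLex i).1 (h + 1))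
    (fun i hi => (hstm i hi).mono (R.ℱ.le _) le_rfl)
    (fun i hi j hj hij => (hstm i hi).mono (R.ℱ.mono ?_) le_rfl)
    (q := fun i ω => (R.st (ofLex i).1 h ω, R.act (ofLex i).1 h ω)) hq
    (P := fun i => M.P h) (fun _ => M.markov h)
    (fun i hi B hB => ?_)
    (f := fun _ _ s => f s) (fun i hi => hf.comp measurable_snd)
    (lo := 0) (hi := M.H) (fun _ _ _ s => hbd s)
    (a := fun i ω => inner ℝ x (I.φ (R.st (ofLex i).1 h ω) (R.act (ofLex i).1 h ω)))
    (fun i hi => ?_) r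
  · simp only [sub_zero] at key
    convert key using 5 with ω
    rw [Finset.sum_image fun a _ b _ hab => by simpa using hab]
    rfl
  -- All indices share the step `h`, so `i < j` means an earlier episode, and the state at step `h +
  -- 1` of that episode is already known at `j`.
  · have h1 := (hτ i hi).2
    have h2 := (hτ j hj).2
    rw [show j = toLex ((ofLex j).1, (ofLex j).2) from rfl, Prod.Lex.toLex_le_toLex]
    rw [Prod.Lex.lt_iff] at hij
    omega
  · have := R.transition _ (hτ i hi).1 h hh B hB
    rwa [show toLex ((ofLex i).1, h) = i by rw [← (hτ i hi).2]; rfl] at this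
  · exact (hφ.comp (hq i hi)).const_inner

end RunMeasurability

/-! ### Finite grids -/

section Grid

variable {κ : Type*} [Fintype κ] [DecidableEq κ]

/-- The vectors with entries in `{-N, -N + 1/N, …, N}`. -/
noncomputable def grid (κ : Type*) [Fintype κ] [DecidableEq κ] (N : ℕ) : Finset (κ → ℝ) :=
  (Fintype.piFinset fun _ : κ => Finset.Icc (-(N ^ 2 : ℤ)) (N ^ 2)).image
    fun z i => (z i : ℝ) / N

lemma card_grid_le (N : ℕ) : (grid κ N).card ≤ (2 * N ^ 2 + 1) ^ Fintype.card κ := by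
  refine Finset.card_image_le.trans (le_of_eq ?_)
  rw [Fintype.card_piFinset, Finset.prod_const, Finset.card_univ, Int.card_Icc]
  congr 1
  rw [show (N : ℤ) ^ 2 = ((N ^ 2 : ℕ) : ℤ) by push_cast; rfl]
  omega

lemma exists_mem_grid {N : ℕ} (hN : 0 < N) {v : κ → ℝ} (hv : ∀ i, |v i| ≤ N) :
    ∃ g ∈ grid κ N, ∀ i, |v i - g i| ≤ 1 / N := by
  have hN' : (0 : ℝ) < N := by exact_mod_cast hN
  refine ⟨fun i => (⌊v i * N⌋ : ℝ) / N, Finset.mem_image.2 ⟨fun i => ⌊v i * N⌋, ?_, rfl⟩, ?_⟩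
  · refine Fintype.mem_piFinset.2 fun i => Finset.mem_Icc.2 ⟨?_, ?_⟩
    · rw [Int.le_floor]
      push_cast
      nlinarith [(abs_le.1 (hv i)).1]
    · have : (⌊v i * N⌋ : ℝ) ≤ N ^ 2 :=
        (Int.floor_le _).trans (by nlinarith [(abs_le.1 (hv i)).2])
      exact_mod_cast this
  · intro i
    have h1 := Int.floor_le (v i * N)
    have h2 := Int.lt_floor_add_one (v i * N)
    rw [show v i - (⌊v i * N⌋ : ℝ) / N = (v i * N - ⌊v i * N⌋) / N by field_simp, abs_div,
      abs_of_pos hN', abs_of_nonneg (by linarith)]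
    gcongr
    linarith

end Grid

/-! ### A finite-dimensional parametrization of the value functions -/

section ValueClass

variable {S A W : Type*} [MeasurableSpace S] [MeasurableSpace A] [MeasurableSpace W]

/-- The function `s ↦ min {max_a {⟨ν, ψ(s,a,w)⟩ + √(∑ᵢⱼ Xᵢⱼ φᵢ(s,a) φⱼ(s,a))}⁺, H}`, for an
arbitrary array `X`. -/
noncomputable def quadFun {d : ℕ} {κ : Type*} [Fintype κ] (H : ℕ)
    (φ : S → A → EuclideanSpace ℝ (Fin d)) (ψ : S → A → W → EuclideanSpace ℝ κ) (w : W)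
    (ν : κ → ℝ) (X : Fin d × Fin d → ℝ) (s : S) : ℝ :=
  min (⨆ a : A, max (∑ p, ν p * ψ s a w p + √(∑ q, X q * (φ s a q.1 * φ s a q.2))) 0) (H : ℝ)

variable {d : ℕ} {κ : Type*} [Fintype κ] {H : ℕ} {φ : S → A → EuclideanSpace ℝ (Fin d)}
  {ψ : S → A → W → EuclideanSpace ℝ κ}

lemma min_iSup_max_mem_Icc [Nonempty A] [Finite A] (g : A → ℝ) (H : ℕ) :
    min (⨆ a : A, max (g a) 0) (H : ℝ) ∈ Set.Icc (0 : ℝ) H :=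
  ⟨le_min (Real.iSup_nonneg fun _ => le_max_right _ _) (Nat.cast_nonneg _), min_le_right _ _⟩

/-- Truncating at 0, maximizing over actions and capping at `H` are all nonexpansive for the uniform
distance. -/
lemma abs_min_iSup_max_sub_le [Nonempty A] [Finite A] {g g' : A → ℝ} {ε H : ℝ}
    (h : ∀ a, |g a - g' a| ≤ ε) :
    |min (⨆ a : A, max (g a) 0) H - min (⨆ a : A, max (g' a) 0) H| ≤ ε := by
  have aux : ∀ u v : A → ℝ, (∀ a, |u a - v a| ≤ ε) →
      (⨆ a : A, max (u a) 0) ≤ (⨆ a : A, max (v a) 0) + ε := by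
    intro u v huv
    refine ciSup_le fun a => ?_
    have h1 : max (v a) 0 ≤ ⨆ a : A, max (v a) 0 :=
      le_ciSup (f := fun a => max (v a) 0) (Set.finite_range _).bddAbove a
    have h2 := abs_le.1 (huv a)
    refine le_trans (max_le ?_ ?_) (add_le_add_left h1 ε)
    · linarith [le_max_left (v a) 0]
    · linarith [le_max_right (v a) 0]
  have h1 := aux g g' h
  have h2 := aux g' g fun a => by rw [abs_sub_comm]; exact h a
  refine (abs_min_sub_min_le_max _ _ _ _).trans (max_le ?_ ?_)
  · exact abs_le.2 ⟨by linarith, by linarith⟩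
  · simpa using (abs_nonneg _).trans (h (Classical.arbitrary A))

lemma quadFun_mem_Icc [Nonempty A] [Finite A] (w : W) (ν : κ → ℝ) (X : Fin d × Fin d → ℝ) (s : S) :
    quadFun H φ ψ w ν X s ∈ Set.Icc (0 : ℝ) H := min_iSup_max_mem_Icc _ _

lemma quadFun_measurable [Finite A] [Nonempty A]
    (hφ : Measurable fun x : S × A => φ x.1 x.2)
    (hψ : Measurable fun x : S × A × W => ψ x.1 x.2.1 x.2.2) (w : W) (ν : κ → ℝ)
    (X : Fin d × Fin d → ℝ) : Measurable (quadFun H φ ψ w ν X) := by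
  have h1 : ∀ a, Measurable fun s => φ s a := fun a =>
    hφ.comp (measurable_id.prodMk measurable_const)
  have h2 : ∀ a, Measurable fun s => ψ s a w := fun a =>
    hψ.comp (measurable_id.prodMk (measurable_const.prodMk measurable_const))
  unfold quadFun
  refine Measurable.min (Measurable.iSup fun a => ?_) measurable_const
  have h3 : ∀ i, Measurable fun s => φ s a i := fun i => by
    have := h1 a; fun_prop
  have h4 : ∀ i, Measurable fun s => ψ s a w i := fun i => by
    have := h2 a; fun_prop
  fun_prop

/-- No sign condition is needed, since the real square root vanishes on negative numbers. Hence the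
arrays of the grid need not be positive semidefinite. -/
lemma abs_sqrt_sub_sqrt_le (x y : ℝ) : |√x - √y| ≤ √|x - y| := by
  have aux : ∀ x y : ℝ, √x ≤ √y + √|x - y| := by
    intro x y
    rcases le_total 0 y with hy | hy
    · refine Real.sqrt_le_iff.2 ⟨by positivity, ?_⟩
      have h1 := Real.sq_sqrt hy
      have h2 := Real.sq_sqrt (abs_nonneg (x - y))
      have h3 := le_abs_self (x - y)
      have : 0 ≤ √y * √|x - y| := by positivity
      nlinarith
    · rw [Real.sqrt_eq_zero_of_nonpos hy, zero_add]
      exact Real.sqrt_le_sqrt (by linarith [le_abs_self (x - y)])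
  have h1 := aux x y
  have h2 := aux y x
  rw [abs_sub_comm y x] at h2
  exact abs_le.2 ⟨by linarith, by linarith⟩

/-- The value depends on `ν` in a Lipschitz way but on `X` only through a square root, whence the
term `√(d² ε)`. It is the reason for a mesh that is a high power of `1/Z`. -/
lemma abs_quadFun_sub_le [Nonempty A] [Finite A] (hφ : ∀ s a, ‖φ s a‖ ≤ 1)
    (hψ : ∀ s a w, ‖ψ s a w‖ ≤ 1) (w : W) {ν ν' : κ → ℝ} {X X' : Fin d × Fin d → ℝ} {ε : ℝ}
    (hν : ∀ p, |ν p - ν' p| ≤ ε) (hX : ∀ q, |X q - X' q| ≤ ε) (s : S) :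
    |quadFun H φ ψ w ν X s - quadFun H φ ψ w ν' X' s|
      ≤ Fintype.card κ * ε + √(d ^ 2 * ε) := by
  refine abs_min_iSup_max_sub_le fun a => ?_
  have hφ1 : ∀ i, |φ s a i| ≤ 1 := fun i => (PiLp.norm_apply_le (φ s a) i).trans (hφ s a)
  have hψ1 : ∀ p, |ψ s a w p| ≤ 1 := fun p => (PiLp.norm_apply_le (ψ s a w) p).trans (hψ s a w)
  have h1 : |∑ p, ν p * ψ s a w p - ∑ p, ν' p * ψ s a w p| ≤ Fintype.card κ * ε := by
    rw [← Finset.sum_sub_distrib]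
    refine (Finset.abs_sum_le_sum_abs _ _).trans ?_
    refine (Finset.sum_le_sum (g := fun _ => ε) fun p _ => ?_).trans (by simp)
    rw [← sub_mul, abs_mul]
    exact (mul_le_of_le_one_right (abs_nonneg _) (hψ1 p)).trans (hν p)
  have h2 : |∑ q, X q * (φ s a q.1 * φ s a q.2) - ∑ q, X' q * (φ s a q.1 * φ s a q.2)|
      ≤ d ^ 2 * ε := by
    rw [← Finset.sum_sub_distrib]
    refine (Finset.abs_sum_le_sum_abs _ _).trans ?_
    refine (Finset.sum_le_sum (g := fun _ => ε) fun q _ => ?_).trans (by simp [sq])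
    rw [← sub_mul, abs_mul, abs_mul]
    exact (mul_le_of_le_one_right (abs_nonneg _)
      (mul_le_one₀ (hφ1 _) (abs_nonneg _) (hφ1 _))).trans (hX q)
  have h3 := (abs_sqrt_sub_sqrt_le _ _).trans (Real.sqrt_le_sqrt h2)
  rw [add_sub_add_comm]
  exact (abs_add_le _ _).trans (add_le_add h1 h3)

end ValueClass

/-! ### Deterministic analysis of the ridge estimator -/

section Ridge

variable {ι : Type*} [Fintype ι] [DecidableEq ι]

lemma inner_eq_dotProduct (x y : EuclideanSpace ℝ ι) : inner ℝ x y = x.ofLp ⬝ᵥ y.ofLp := by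
  simp [PiLp.inner_apply, dotProduct, mul_comm]

lemma dotProduct_seqGram_mulVec (lam : ℝ) (v : ℕ → ι → ℝ) (k : ℕ) (x z : ι → ℝ) :
    x ⬝ᵥ seqGram lam v k *ᵥ z
      = lam * (x ⬝ᵥ z) + ∑ τ ∈ Finset.Ico 1 k, (x ⬝ᵥ v τ) * (z ⬝ᵥ v τ) := by
  rw [seqGram, Matrix.add_mulVec, dotProduct_add, Matrix.sum_mulVec, dotProduct_sum,
    Matrix.smul_mulVec, Matrix.one_mulVec, dotProduct_smul, smul_eq_mul]
  congr 1
  refine Finset.sum_congr rfl fun τ _ => ?_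
  rw [Matrix.vecMulVec_mulVec]
  simp [dotProduct_comm z (v τ), mul_comm]

/-- The Gram matrix maps `u` to `∑ (y τ - θ·v τ) v τ - θ`, where the last term is the regularization
bias; pairing this with `u` gives the identity. -/
lemma ridge_error_identity (v : ℕ → ι → ℝ) (k : ℕ) (y : ℕ → ℝ) (θ u : ι → ℝ)
    (hu : u = (seqGram 1 v k)⁻¹ *ᵥ (∑ τ ∈ Finset.Ico 1 k, y τ • v τ) - θ) :
    u ⬝ᵥ seqGram 1 v k *ᵥ u
      = ∑ τ ∈ Finset.Ico 1 k, (u ⬝ᵥ v τ) * (y τ - θ ⬝ᵥ v τ) - u ⬝ᵥ θ := by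
  have hG := seqGram_posDef one_pos v k
  have h1 : seqGram 1 v k *ᵥ u = (∑ τ ∈ Finset.Ico 1 k, y τ • v τ) - seqGram 1 v k *ᵥ θ := by
    rw [hu, Matrix.mulVec_sub, Matrix.mulVec_mulVec,
      Matrix.mul_nonsing_inv _ hG.det_pos.ne'.isUnit, Matrix.one_mulVec]
  rw [h1, dotProduct_sub, dotProduct_seqGram_mulVec, dotProduct_sum]
  simp only [dotProduct_smul, smul_eq_mul, mul_sub, Finset.sum_sub_distrib]
  rw [Finset.sum_congr rfl fun τ _ => mul_comm (y τ) (u ⬝ᵥ v τ)]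
  ring

/-- The error `u` of the ridge estimator is bounded in terms of the weight in the direction of
`u`. -/
lemma ridge_error_le {d : ℕ} {v : ℕ → EuclideanSpace ℝ (Fin d)} {k : ℕ} {y : ℕ → ℝ}
    {θ u : EuclideanSpace ℝ (Fin d)} {H r : ℝ} (hH : 0 < H) (hθ : ‖θ‖ ≤ H * √d)
    (hu : u.ofLp = (seqGram 1 (fun τ => (v τ).ofLp) k)⁻¹ *ᵥ
      (∑ τ ∈ Finset.Ico 1 k, y τ • (v τ).ofLp) - θ.ofLp)
    (hr : ∑ τ ∈ Finset.Ico 1 k, (inner ℝ ((4 / H ^ 2) • u) (v τ) * (y τ - inner ℝ θ (v τ))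
      - inner ℝ ((4 / H ^ 2) • u) (v τ) ^ 2 * H ^ 2 / 8) ≤ r) :
    weightedNorm (seqGram 1 (fun τ => (v τ).ofLp) k) u ^ 2 ≤ 4 * H ^ 2 * d + H ^ 2 * r := by
  have hid := ridge_error_identity _ _ _ _ _ hu
  have hG := seqGram_posDef one_pos (fun τ => (v τ).ofLp) k
  have hq := dotProduct_seqGram_mulVec 1 (fun τ => (v τ).ofLp) k u.ofLp u.ofLp
  simp only [← inner_eq_dotProduct] at hid hq
  rw [weightedNorm, Real.sq_sqrt (by simpa using hG.posSemidef.dotProduct_mulVec_nonneg u.ofLp)]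
  set Q := u.ofLp ⬝ᵥ seqGram 1 (fun τ => (v τ).ofLp) k *ᵥ u.ofLp
  simp only [inner_smul_left, conj_trivial] at hr
  have h1 : ∑ τ ∈ Finset.Ico 1 k, (4 / H ^ 2 * inner ℝ u (v τ) * (y τ - inner ℝ θ (v τ))
      - (4 / H ^ 2 * inner ℝ u (v τ)) ^ 2 * H ^ 2 / 8)
      = 4 / H ^ 2 * ∑ τ ∈ Finset.Ico 1 k, inner ℝ u (v τ) * (y τ - inner ℝ θ (v τ))
        - 2 / H ^ 2 * ∑ τ ∈ Finset.Ico 1 k, inner ℝ u (v τ) * inner ℝ u (v τ) := by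
    rw [Finset.mul_sum, Finset.mul_sum, ← Finset.sum_sub_distrib]
    refine Finset.sum_congr rfl fun τ _ => ?_
    field_simp
    ring
  rw [h1] at hr
  have huu : inner ℝ u u = ‖u‖ ^ 2 := real_inner_self_eq_norm_sq u
  have hcs := abs_real_inner_le_norm u θ
  set P := ∑ τ ∈ Finset.Ico 1 k, inner ℝ u (v τ) * (y τ - inner ℝ θ (v τ))
  set T := ∑ τ ∈ Finset.Ico 1 k, inner ℝ u (v τ) * inner ℝ u (v τ)
  -- The scale `4 / H²` of the direction makes the compensator `2T`, while `4Q = 4P - 4⟨u, θ⟩` and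
  -- `Q = ‖u‖² + T`. Half of `4Q` thus survives, with `2‖u‖²` to spare for the bias term.
  have hr' : 4 * P - 2 * T ≤ H ^ 2 * r := by
    have := mul_le_mul_of_nonneg_left hr (sq_nonneg H)
    calc 4 * P - 2 * T = H ^ 2 * (4 / H ^ 2 * P - 2 / H ^ 2 * T) := by field_simp
      _ ≤ _ := this
  have hsq : √(d : ℝ) ^ 2 = d := Real.sq_sqrt (Nat.cast_nonneg d)
  have h2 : -(‖u‖ * (H * √d)) ≤ inner ℝ u θ := by
    have := mul_le_mul_of_nonneg_left hθ (norm_nonneg u)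
    linarith [(abs_le.1 hcs).1]
  have h3 := sq_nonneg (‖u‖ - H * √d)
  have hT : 0 ≤ T := Finset.sum_nonneg fun _ _ => mul_self_nonneg _
  have h4 : (H * √(d : ℝ)) ^ 2 = H ^ 2 * d := by rw [mul_pow, hsq]
  nlinarith

/-- A crude bound valid for all outcomes: dropping the sum of squares from the error identity leaves
`‖u‖²` at most `‖u‖` times the stated quantity. Its purpose is to keep the random direction within
the range of the grid. -/
lemma ridge_error_norm_le {d : ℕ} {v : ℕ → EuclideanSpace ℝ (Fin d)} (hv : ∀ τ, ‖v τ‖ ≤ 1)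
    {k : ℕ} {y : ℕ → ℝ} {θ u : EuclideanSpace ℝ (Fin d)} {H : ℝ} (hθ : ‖θ‖ ≤ H * √d)
    (hu : u.ofLp = (seqGram 1 (fun τ => (v τ).ofLp) k)⁻¹ *ᵥ
      (∑ τ ∈ Finset.Ico 1 k, y τ • (v τ).ofLp) - θ.ofLp)
    (hy : ∀ τ ∈ Finset.Ico 1 k, |y τ - inner ℝ θ (v τ)| ≤ H) :
    ‖u‖ ≤ H * (k - 1 : ℕ) + H * √d := by
  have hid := ridge_error_identity _ _ _ _ _ hu
  have hq := dotProduct_seqGram_mulVec 1 (fun τ => (v τ).ofLp) k u.ofLp u.ofLp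
  simp only [← inner_eq_dotProduct] at hid hq
  have huu : inner ℝ u u = ‖u‖ ^ 2 := real_inner_self_eq_norm_sq u
  have hcs := abs_real_inner_le_norm u θ
  have h1 : ∑ τ ∈ Finset.Ico 1 k, inner ℝ u (v τ) * (y τ - inner ℝ θ (v τ))
      ≤ ‖u‖ * (H * (k - 1 : ℕ)) := by
    refine (Finset.sum_le_sum (g := fun _ => ‖u‖ * H) fun τ hτ => ?_).trans (le_of_eq ?_)
    · refine (le_abs_self _).trans ?_
      rw [abs_mul]
      refine mul_le_mul ?_ (hy τ hτ) (abs_nonneg _) (norm_nonneg _)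
      exact (abs_real_inner_le_norm _ _).trans (mul_le_of_le_one_right (norm_nonneg _) (hv τ))
    · simp only [Finset.sum_const, Nat.card_Ico, nsmul_eq_mul]; ring
  have h2 : 0 ≤ ∑ τ ∈ Finset.Ico 1 k, inner ℝ u (v τ) * inner ℝ u (v τ) :=
    Finset.sum_nonneg fun _ _ => mul_self_nonneg _
  have h3 := mul_le_mul_of_nonneg_left hθ (norm_nonneg u)
  have h4 : ‖u‖ * ‖u‖ ≤ ‖u‖ * (H * (k - 1 : ℕ) + H * √d) := by
    nlinarith [(abs_le.1 hcs).1]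
  -- If `u = 0` there is nothing to cancel. The sign of `H` is then read off from `hy` when the sum
  -- has a term, and the first summand vanishes when it has none.
  rcases (norm_nonneg u).eq_or_lt with h0 | h0
  · rw [← h0] at h3 ⊢
    have : 0 ≤ H * √d := (norm_nonneg θ).trans hθ
    rcases Nat.eq_zero_or_pos (k - 1) with hk | hk
    · simpa [hk] using this
    · have : 0 ≤ H := (abs_nonneg _).trans (hy 1 (Finset.mem_Ico.2 (by omega)))
      positivity
  · exact le_of_mul_le_mul_left h4 h0

end Ridge

/-! ### Stability of the logarithmic weight under discretization -/

section Concentration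

variable {S A W : Type*} [MeasurableSpace S] [MeasurableSpace A] [MeasurableSpace W]
  {d m n : ℕ} {M : ContextualMDP S A W} {I : Params S A W d m n} {K : ℕ}
  {Ω : Type*} [mΩ : MeasurableSpace Ω] {μ : Measure Ω} (R : Run M I K μ)

lemma abs_inner_sub_le {d : ℕ} {x g z : EuclideanSpace ℝ (Fin d)} (hz : ‖z‖ ≤ 1) {ε : ℝ}
    (h : ∀ i, |x i - g i| ≤ ε) : |inner ℝ x z - inner ℝ g z| ≤ d * ε := by
  rw [inner_eq_dotProduct, inner_eq_dotProduct, ← sub_dotProduct, dotProduct]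
  refine (Finset.abs_sum_le_sum_abs _ _).trans ?_
  refine (Finset.sum_le_sum (g := fun _ => ε) fun i _ => ?_).trans (by simp)
  rw [abs_mul]
  exact (mul_le_of_le_one_right (abs_nonneg _)
    ((PiLp.norm_apply_le z i).trans hz)).trans (h i)

lemma centred_term_le {a a' e e' b η H A : ℝ} (ha : |a| ≤ A)
    (haa : |a - a'| ≤ η) (hee : |e - e'| ≤ b) (he : |e'| ≤ H) :
    a * e - a ^ 2 * H ^ 2 / 8 ≤ a' * e' - a' ^ 2 * H ^ 2 / 8
      + (A * b + η * H + H ^ 2 / 8 * (η * (2 * A + η))) := by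
  have h1 : a * (e - e') ≤ A * b := (le_abs_self _).trans (by
    rw [abs_mul]; exact mul_le_mul ha hee (abs_nonneg _) ((abs_nonneg _).trans ha))
  have h2 : (a - a') * e' ≤ η * H := (le_abs_self _).trans (by
    rw [abs_mul]; exact mul_le_mul haa he (abs_nonneg _) ((abs_nonneg _).trans haa))
  have h3 : (a' - a) * (a' + a) ≤ η * (2 * A + η) := (le_abs_self _).trans (by
    rw [abs_mul, abs_sub_comm]
    refine mul_le_mul haa ?_ (abs_nonneg _) ((abs_nonneg _).trans haa)
    rw [show a' + a = 2 * a + -(a - a') by ring]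
    refine (abs_add_le _ _).trans (add_le_add ?_ ?_)
    · rw [abs_mul, abs_two]; linarith
    · rwa [abs_neg])
  have h4 := mul_le_mul_of_nonneg_left h3 (show 0 ≤ H ^ 2 / 8 by positivity)
  nlinarith

/-- This transfers the bound from a grid point to the actual error direction and the actual value
function, neither of which is fixed in advance. The factor 2 before `b` occurs because `f` is
perturbed both at the sampled state and inside the expectation. -/
lemma Run.logWeight_le_add (hφ : ∀ s a, ‖I.φ s a‖ ≤ 1) {k h : ℕ} (hk : k ≤ K + 1)
    {x g : EuclideanSpace ℝ (Fin d)} {f f' : S → ℝ} (hf : Measurable f) (hf' : Measurable f')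
    (hbd : ∀ s, f s ∈ Set.Icc (0 : ℝ) M.H) (hbd' : ∀ s, f' s ∈ Set.Icc (0 : ℝ) M.H)
    {B ε b : ℝ} (hx : ‖x‖ ≤ B) (hxg : ∀ i, |x i - g i| ≤ ε) (hff : ∀ s, |f s - f' s| ≤ b)
    (ω : Ω) :
    R.logWeight k h x f ω ≤ R.logWeight k h g f' ω
      + K * (B * (2 * b) + d * ε * M.H + (M.H : ℝ) ^ 2 / 8 * (d * ε * (2 * B + d * ε))) := by
  have hint : ∀ {f : S → ℝ}, Measurable f → (∀ s, f s ∈ Set.Icc (0 : ℝ) M.H) → ∀ q,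
      Integrable f (M.P h q) := fun hf hbd q =>
    integrable_of_abs_le (C := M.H) hf fun s => abs_le.2 ⟨by linarith [(hbd s).1,
      (Nat.cast_nonneg M.H : (0 : ℝ) ≤ M.H)], (hbd s).2⟩
  set c := B * (2 * b) + d * ε * M.H + (M.H : ℝ) ^ 2 / 8 * (d * ε * (2 * B + d * ε)) with hc
  have hterm : ∀ τ ∈ Finset.Ico 1 k,
      inner ℝ x (I.φ (R.st τ h ω) (R.act τ h ω))
        * (f (R.st τ (h + 1) ω) - ∫ s', f s' ∂(M.P h (R.st τ h ω, R.act τ h ω)))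
      - inner ℝ x (I.φ (R.st τ h ω) (R.act τ h ω)) ^ 2 * (M.H : ℝ) ^ 2 / 8
      ≤ inner ℝ g (I.φ (R.st τ h ω) (R.act τ h ω))
        * (f' (R.st τ (h + 1) ω) - ∫ s', f' s' ∂(M.P h (R.st τ h ω, R.act τ h ω)))
      - inner ℝ g (I.φ (R.st τ h ω) (R.act τ h ω)) ^ 2 * (M.H : ℝ) ^ 2 / 8 + c := by
    intro τ _
    refine centred_term_le ?_ (abs_inner_sub_le (hφ _ _) hxg) ?_ ?_
    · exact (abs_real_inner_le_norm _ _).trans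
        ((mul_le_of_le_one_right (norm_nonneg _) (hφ _ _)).trans hx)
    · have h1 : |∫ s', f s' ∂(M.P h (R.st τ h ω, R.act τ h ω))
          - ∫ s', f' s' ∂(M.P h (R.st τ h ω, R.act τ h ω))| ≤ b := by
        rw [← integral_sub (hint hf hbd _) (hint hf' hbd' _)]
        have := integral_mem_Icc (μ := M.P h (R.st τ h ω, R.act τ h ω)) (hf.sub hf')
          (fun s => abs_le.1 (hff s))
        exact abs_le.2 this
      rw [sub_sub_sub_comm]
      exact (abs_sub _ _).trans (by linarith [hff (R.st τ (h + 1) ω)])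
    · have h1 := integral_mem_Icc (μ := M.P h (R.st τ h ω, R.act τ h ω)) hf' hbd'
      have h2 := hbd' (R.st τ (h + 1) ω)
      exact abs_le.2 ⟨by linarith [h1.1, h1.2, h2.1, h2.2], by linarith [h1.1, h1.2, h2.1, h2.2]⟩
  -- The sign of `c` is needed because the true number `k - 1` of terms is replaced by `K`.
  have hc0 : 0 ≤ c := by
    have h1 : 0 ≤ b := (abs_nonneg _).trans (hff (R.st 0 0 ω))
    have h2 : 0 ≤ B := (norm_nonneg _).trans hx
    have h3 : 0 ≤ (d : ℝ) * ε := by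
      rcases Nat.eq_zero_or_pos d with rfl | hd
      · simp
      · exact mul_nonneg (Nat.cast_nonneg _) ((abs_nonneg _).trans (hxg ⟨0, hd⟩))
    have h4 := mul_nonneg h3 (Nat.cast_nonneg M.H : (0 : ℝ) ≤ M.H)
    have h5 : 0 ≤ (d : ℝ) * ε * (2 * B + d * ε) := mul_nonneg h3 (by linarith)
    positivity
  refine (Finset.sum_le_sum hterm).trans ?_
  rw [Finset.sum_add_distrib, Finset.sum_const, Nat.card_Ico, nsmul_eq_mul]
  refine add_le_add le_rfl (mul_le_mul_of_nonneg_right ?_ hc0)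
  exact_mod_cast (by omega : k - 1 ≤ K)

end Concentration

/-! ### From accurate ridge estimators to accurate planned parameters -/

section Estimation

lemma weightedNorm_sub_comm {ι : Type*} [Fintype ι] (A : Matrix ι ι ℝ) (x y : EuclideanSpace ℝ ι) :
    weightedNorm A (x - y) = weightedNorm A (y - x) := by
  rw [← neg_sub, weightedNorm, weightedNorm]
  simp only [WithLp.ofLp_neg, Matrix.mulVec_neg, neg_dotProduct, dotProduct_neg, neg_neg]

lemma weightedNorm_nonneg {ι : Type*} [Fintype ι] (A : Matrix ι ι ℝ) (x : EuclideanSpace ℝ ι) :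
    0 ≤ weightedNorm A x := Real.sqrt_nonneg _

lemma inner_kron {d m : ℕ} (ξ : EuclideanSpace ℝ (Fin d × Fin m)) (x : EuclideanSpace ℝ (Fin d))
    (y : EuclideanSpace ℝ (Fin m)) :
    inner ℝ ξ (kron x y) = ∑ i, (∑ j, ξ (i, j) * y j) * x i := by
  rw [inner_eq_dotProduct, dotProduct, Fintype.sum_prod_type]
  refine Finset.sum_congr rfl fun i _ => ?_
  rw [Finset.sum_mul]
  refine Finset.sum_congr rfl fun j _ => ?_
  simp only [kron]
  ring

lemma kron_sum {d m n : ℕ} (x : EuclideanSpace ℝ (Fin d)) (c : Fin n → ℝ)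
    (y : Fin n → EuclideanSpace ℝ (Fin m)) :
    kron x (∑ j, c j • y j) = ∑ j, c j • kron x (y j) := by
  ext p
  simp only [kron, WithLp.ofLp_sum, WithLp.ofLp_smul, Finset.sum_apply, Pi.smul_apply, smul_eq_mul,
    Finset.mul_sum]
  exact Finset.sum_congr rfl fun j _ => by ring

variable {S A W : Type*} [MeasurableSpace S] [MeasurableSpace A] [MeasurableSpace W]
  {d m n : ℕ} {M : ContextualMDP S A W} {I : Params S A W d m n}

/-- The parameter is the vector of integrals of `f` against the measures `μ i`. -/
lemma exists_transition_parameter {κ : Type*} [Fintype κ]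
    {φ : S → A → EuclideanSpace ℝ (Fin d)} {ψ : S → A → W → EuclideanSpace ℝ κ}
    (hb : IsBoundedLinearMDP M φ ψ) {h : ℕ} (hh : h ∈ Finset.Icc 1 M.H) {f : S → ℝ}
    (hf : Measurable f) (hbd : ∀ s, f s ∈ Set.Icc (0 : ℝ) M.H) :
    ∃ θ : EuclideanSpace ℝ (Fin d), ‖θ‖ ≤ M.H * √d ∧
      ∀ s a, ∫ s', f s' ∂(M.P h (s, a)) = inner ℝ θ (φ s a) := by
  obtain ⟨-, -, hlin⟩ := hb
  obtain ⟨η, μ, hfin, hP, -, hμ, -⟩ := hlin h hh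
  have habs : ∀ s, |f s| ≤ M.H := fun s => abs_le.2 ⟨by linarith [(hbd s).1,
      (Nat.cast_nonneg M.H : (0 : ℝ) ≤ M.H)], (hbd s).2⟩
  refine ⟨WithLp.toLp 2 fun i => ∫ s', f s' ∂(μ i), ?_, fun s a => ?_⟩
  · calc ‖(WithLp.toLp 2 fun i => ∫ s', f s' ∂(μ i) : EuclideanSpace ℝ (Fin d))‖
        ≤ ‖(M.H : ℝ) • (WithLp.toLp 2 fun i => (μ i).real Set.univ :
            EuclideanSpace ℝ (Fin d))‖ := by
          rw [EuclideanSpace.norm_eq, EuclideanSpace.norm_eq]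
          refine Real.sqrt_le_sqrt (Finset.sum_le_sum fun i _ => ?_)
          have : ‖∫ s', f s' ∂(μ i)‖ ≤ M.H * (μ i).real Set.univ :=
            norm_integral_le_of_norm_le_const (Filter.Eventually.of_forall habs)
          refine pow_le_pow_left₀ (norm_nonneg _) (this.trans (le_abs_self _)) 2
      _ ≤ M.H * √d := by
          rw [norm_smul, Real.norm_of_nonneg (Nat.cast_nonneg _)]
          gcongr
  · rw [integral_eq_sum_of_real_eq hfin (hP s a) hf habs, inner_eq_dotProduct]
    rfl

variable {st : ℕ → ℕ → S} {act : ℕ → ℕ → A} {ξ : ℕ → ℕ → EuclideanSpace ℝ (Fin d × Fin m)}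

/-- The features of the state-action pairs visited at step `h`. -/
def visited (I : Params S A W d m n) (st : ℕ → ℕ → S) (act : ℕ → ℕ → A) (h τ : ℕ) : Fin d → ℝ :=
  (I.φ (st τ h) (act τ h)).ofLp

lemma gram_eq_seqGram (k h : ℕ) :
    gram I st act k h = seqGram I.lam (visited I st act h) k := rfl

lemma gram_posDef (hlam : 0 < I.lam) (k h : ℕ) : (gram I st act k h).PosDef :=
  seqGram_posDef hlam _ _

variable [Nonempty A] [Finite A]

lemma vFun_mem_Icc (k h : ℕ) (s : S) (w : W) :
    vFun M I st act ξ k h s w ∈ Set.Icc (0 : ℝ) M.H := by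
  refine ⟨le_min (Real.iSup_nonneg fun a => ?_) (Nat.cast_nonneg _), min_le_right _ _⟩
  unfold qFun
  split_ifs
  · exact le_max_right _ _
  · exact le_rfl

lemma vFun_succ_horizon (k : ℕ) (s : S) (w : W) : vFun M I st act ξ k (M.H + 1) s w = 0 := by
  simp [vFun, qFun]

/-- The reward is linear in `ψ`, so its parameter is absorbed into `ν`; this puts the planned value
functions, including the zero function at step `H + 1`, within reach of completeness. -/
lemma vFun_eq_classFun (hb : IsBoundedLinearMDP M I.φ I.ψ) (hlam : 0 < I.lam) (k : ℕ) {h : ℕ}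
    (hh : h ∈ Finset.Icc 1 (M.H + 1)) :
    ∃ (ν : EuclideanSpace ℝ (Fin d × Fin m)) (Λ : Matrix (Fin d) (Fin d) ℝ) (b : ℝ), Λ.PosDef ∧
      ∀ s w, vFun M I st act ξ k h s w = classFun M.H I.φ I.ψ ν Λ b s w := by
  rw [Finset.mem_Icc] at hh
  rcases hh.2.lt_or_eq with hlt | rfl
  · obtain ⟨η, -, -, -, hr, -, -⟩ := hb.2.2 h (Finset.mem_Icc.2 (by omega))
    refine ⟨η + ξ k h, gram I st act k h, 2 * I.L * I.β, gram_posDef hlam k h, fun s w => ?_⟩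
    simp only [vFun, classFun, qFun, if_pos (Nat.lt_succ_iff.1 hlt), hr, inner_add_left]
  · refine ⟨0, 1, 0, Matrix.PosDef.one, fun s w => ?_⟩
    rw [vFun_succ_horizon]
    simp [classFun]

lemma abs_inv_gram_apply_le (hlam : I.lam = 1) (k h : ℕ) (i j : Fin d) :
    |(gram I st act k h)⁻¹ i j| ≤ 1 := by
  have hlam0 : 0 < I.lam := by rw [hlam]; exact one_pos
  have hpd := gram_posDef (st := st) (act := act) hlam0 k h
  have h1 := dotProduct_mulVec_sq_le hpd.inv.posSemidef (Pi.single i 1) (Pi.single j 1)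
  have h2 : ∀ i : Fin d, Pi.single i 1 ⬝ᵥ (gram I st act k h)⁻¹ *ᵥ Pi.single i 1 ≤ 1 := by
    intro i
    have := dotProduct_inv_seqGram_le_div (v := visited I st act h) hlam0 k (Pi.single i 1)
    rw [gram_eq_seqGram]
    refine this.trans ?_
    simp [hlam]
  have h3 := dotProduct_inv_mulVec_nonneg hpd (Pi.single j 1)
  rw [← sq_le_one_iff_abs_le_one]
  have h4 : Pi.single i 1 ⬝ᵥ (gram I st act k h)⁻¹ *ᵥ Pi.single j 1
      = (gram I st act k h)⁻¹ i j := by simp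
  rw [h4] at h1
  exact h1.trans (mul_le_one₀ (h2 i) h3 (h2 j))

/-- Placing the whole bonus under one square root turns it into the entries `(2Lβ)² Λ⁻¹`. These are
bounded because `Λ ≥ 1` bounds the entries of the inverse by 1, so all parameters lie in a box that
a grid can cover. -/
lemma vFun_eq_quadFun (hb : IsBoundedLinearMDP M I.φ I.ψ) (hlam : I.lam = 1)
    (hL : 0 ≤ I.L) (hβ : 0 ≤ I.β) (k : ℕ) {h : ℕ} (hh : h ∈ Finset.Icc 1 (M.H + 1))
    (hξ : h ≤ M.H → ‖ξ k h‖ ≤ M.H * √(m * d)) :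
    ∃ (ν : Fin d × Fin m → ℝ) (X : Fin d × Fin d → ℝ),
      (∀ p, |ν p| ≤ (M.H + 1) * √(m * d)) ∧ (∀ q, |X q| ≤ (2 * I.L * I.β) ^ 2) ∧
      ∀ s w, vFun M I st act ξ k h s w = quadFun M.H I.φ I.ψ w ν X s := by
  rw [Finset.mem_Icc] at hh
  rcases hh.2.lt_or_eq with hlt | rfl
  · obtain ⟨η, -, -, -, hr, -, hη⟩ := hb.2.2 h (Finset.mem_Icc.2 (by omega))
    refine ⟨(η + ξ k h).ofLp, fun q => (2 * I.L * I.β) ^ 2 * (gram I st act k h)⁻¹ q.1 q.2,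
      fun p => ?_, fun q => ?_, fun s w => ?_⟩
    · refine (PiLp.norm_apply_le (η + ξ k h) p).trans ((norm_add_le _ _).trans ?_)
      have h1 := hξ (by omega)
      have h2 : √((Fintype.card (Fin d × Fin m) : ℕ) : ℝ) = √(m * d) := by
        simp [mul_comm]
      rw [h2] at hη
      linarith
    · rw [abs_mul, abs_of_nonneg (sq_nonneg _)]
      exact mul_le_of_le_one_right (sq_nonneg _) (abs_inv_gram_apply_le hlam _ _ _ _)
    · have hbonus : ∀ a, 2 * I.L * I.β * weightedNorm (gram I st act k h)⁻¹ (I.φ s a)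
          = √(∑ q : Fin d × Fin d, (2 * I.L * I.β) ^ 2 * (gram I st act k h)⁻¹ q.1 q.2
              * (I.φ s a q.1 * I.φ s a q.2)) := by
        intro a
        have h1 : ∑ q : Fin d × Fin d, (2 * I.L * I.β) ^ 2 * (gram I st act k h)⁻¹ q.1 q.2
              * (I.φ s a q.1 * I.φ s a q.2) = (2 * I.L * I.β) ^ 2 *
              ((I.φ s a).ofLp ⬝ᵥ (gram I st act k h)⁻¹ *ᵥ (I.φ s a).ofLp) := by
          rw [Fintype.sum_prod_type, dotProduct, Finset.mul_sum]
          refine Finset.sum_congr rfl fun i _ => ?_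
          rw [Matrix.mulVec, dotProduct, Finset.mul_sum, Finset.mul_sum]
          exact Finset.sum_congr rfl fun j _ => by ring
        rw [h1, Real.sqrt_mul (sq_nonneg _), Real.sqrt_sq (by positivity), weightedNorm]
      simp only [vFun, quadFun, qFun, if_pos (Nat.lt_succ_iff.1 hlt), hr, ← hbonus]
      congr! 6 with a
      rw [← inner_add_left, inner_eq_dotProduct, dotProduct]
  · refine ⟨0, 0, fun p => ?_, fun q => ?_, fun s w => ?_⟩
    · simp only [Pi.zero_apply, abs_zero]; positivity
    · simp only [Pi.zero_apply, abs_zero]; positivity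
    · rw [vFun_succ_horizon]
      simp [quadFun]

lemma vFun_measurable_state (hφ : Measurable fun x : S × A => I.φ x.1 x.2)
    (hψ : Measurable fun x : S × A × W => I.ψ x.1 x.2.1 x.2.2)
    [MeasurableSingletonClass A] {k h : ℕ} (hh : h ∈ Finset.Icc 1 (M.H + 1)) (w : W) :
    Measurable fun s => vFun M I st act ξ k h s w := by
  rw [Finset.mem_Icc] at hh
  rcases hh.2.lt_or_eq with hlt | rfl
  · unfold vFun qFun
    simp only [if_pos (Nat.lt_succ_iff.1 hlt)]
    have h1 : ∀ a, Measurable fun s => I.φ s a := fun a =>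
      hφ.comp (measurable_id.prodMk measurable_const)
    have h2 : ∀ a, Measurable fun s => I.ψ s a w := fun a =>
      hψ.comp (measurable_id.prodMk (measurable_const.prodMk measurable_const))
    have h3 : ∀ a, Measurable fun s => M.r h s a w := fun a =>
      (M.r_measurable h (Finset.mem_Icc.2 (by omega))).comp
        (measurable_id.prodMk (measurable_const.prodMk measurable_const))
    refine Measurable.min (Measurable.iSup fun a => ?_) measurable_const
    have h4 : Measurable fun s => weightedNorm (gram I st act k h)⁻¹ (I.φ s a) := by
      have h5 := h1 a
      unfold weightedNorm Matrix.mulVec dotProduct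
      fun_prop
    exact (((h3 a).add ((h2 a).const_inner)).add (h4.const_mul _)).max measurable_const
  · simp [vFun_succ_horizon]

/-- If the least-squares estimators are accurate at the reference contexts, then the planned
parameters estimate the backup up to the exploration bonus, for all contexts. -/
lemma abs_inner_sub_backup_le (hφ : Measurable fun x : S × A => I.φ x.1 x.2)
    (hψ : Measurable fun x : S × A × W => I.ψ x.1 x.2.1 x.2.2) [MeasurableSingletonClass A]
    (hb : IsBoundedLinearMDP M I.φ I.ψ) (hc : IsBackupComplete M I.φ I.ψ)
    {ρ : W → EuclideanSpace ℝ (Fin m)} (hmap : IsMapping I.φ I.ψ ρ I.wref I.L)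
    (hD : IsFeatureBasis I.φ I.D) (hlam : 0 < I.lam) (hβ : 0 ≤ I.β)
    {k h : ℕ} (hh : h ∈ Finset.Icc 1 M.H) (hplan : IsPlanned M I st act ξ k h)
    (hconc : ∀ j, ∀ θ : EuclideanSpace ℝ (Fin d), ‖θ‖ ≤ M.H * √d →
      (∀ s a, ∫ s', vFun M I st act ξ k (h + 1) s' (I.wref j) ∂(M.P h (s, a))
        = inner ℝ θ (I.φ s a)) →
      weightedNorm (gram I st act k h) (thetaTilde M I st act ξ k h (I.wref j) - θ) ≤ I.β)
    (s : S) (a : A) (w : W) :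
    |inner ℝ (ξ k h) (I.ψ s a w)
        - ∫ s', vFun M I st act ξ k (h + 1) s' w ∂(M.P h (s, a))|
      ≤ 2 * I.L * I.β * weightedNorm (gram I st act k h)⁻¹ (I.φ s a) := by
  have hh' := Finset.mem_Icc.1 hh
  have hh1 : h + 1 ∈ Finset.Icc 1 (M.H + 1) := Finset.mem_Icc.2 (by omega)
  have hpd := gram_posDef (st := st) (act := act) hlam k h
  obtain ⟨ν, Λ, b, hΛ, hclass⟩ :=
    vFun_eq_classFun (st := st) (act := act) (ξ := ξ) hb hlam k hh1
  obtain ⟨ξ', hξ', hback⟩ := hc ν Λ b hΛ h hh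
  simp only [← hclass] at hback
  have hθex := fun j => exists_transition_parameter hb hh
    (vFun_measurable_state (st := st) (act := act) (ξ := ξ) (k := k) hφ hψ hh1 (I.wref j))
    (fun s => vFun_mem_Icc k (h + 1) s (I.wref j))
  choose θ hθ hθP using hθex
  obtain ⟨θ', ⟨hfeas, -⟩, hmin⟩ := hplan
  have hcθ := fun j => hconc j (θ j) (hθ j) (hθP j)
  -- The exact parameters are a competitor. They satisfy the constraints by the accuracy hypothesis
  -- and by the norm bound in the completeness assumption.
  have hfeas' : (ξ', θ) ∈ planFeasible M I st act ξ k h := by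
    refine ⟨fun j => ?_, ?_⟩
    · rw [weightedNorm_sub_comm]; exact hcθ j
    · convert hξ' using 3
      simp [mul_comm]
  have hobj := hmin hfeas'
  -- At the exact parameters, both inner products equal the same expected next value.
  have hzero : planObjective I (ξ', θ) = 0 := by
    refine Finset.sum_eq_zero fun j _ => Finset.sum_eq_zero fun x _ => ?_
    simp only
    rw [← hθP, ← hback]
    simp
  have hobj0 : planObjective I (ξ k h, θ') = 0 :=
    le_antisymm (hobj.trans hzero.le)
      (Finset.sum_nonneg fun j _ => Finset.sum_nonneg fun x _ => sq_nonneg _)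
  have hDeq : ∀ j, ∀ x ∈ I.D, inner ℝ (θ' j) (I.φ x.1 x.2)
      = inner ℝ (ξ k h) (I.ψ x.1 x.2 (I.wref j)) := by
    intro j x hx
    have h1 := (Finset.sum_eq_zero_iff_of_nonneg
      (fun j _ => Finset.sum_nonneg fun x _ => sq_nonneg _)).1 hobj0 j (Finset.mem_univ j)
    have h2 := (Finset.sum_eq_zero_iff_of_nonneg (fun x _ => sq_nonneg _)).1 h1 x hx
    exact sub_eq_zero.1 (pow_eq_zero_iff two_ne_zero |>.1 h2)
  -- Both sides are linear in the feature `φ s a`, thanks to the tensor form of `ψ`, so equality on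
  -- `D` propagates to the span.
  have hall : ∀ j s a, inner ℝ (θ' j) (I.φ s a) = inner ℝ (ξ k h) (I.ψ s a (I.wref j)) := by
    intro j s a
    have hspan : ∀ x ∈ Submodule.span ℝ ((fun x : S × A => I.φ x.1 x.2) '' (I.D : Set (S × A))),
        inner ℝ (θ' j) x = inner ℝ (ξ k h) (kron x (ρ (I.wref j))) := by
      intro x hx
      induction hx using Submodule.span_induction with
      | mem x hx =>
        obtain ⟨y, hy, rfl⟩ := hx
        rw [hDeq j y hy, hmap.1]
      | zero => simp [inner_kron]
      | add x y _ _ hx hy =>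
        rw [inner_add_right, hx, hy, inner_kron, inner_kron, inner_kron,
          ← Finset.sum_add_distrib]
        exact Finset.sum_congr rfl fun i _ => by simp only [PiLp.add_apply]; ring
      | smul c x _ hx =>
        rw [inner_smul_right, hx, inner_kron, inner_kron, Finset.mul_sum]
        exact Finset.sum_congr rfl fun i _ => by
          simp only [PiLp.smul_apply, smul_eq_mul]; ring
    rw [hspan _ (hD.2 s a), hmap.1]
  obtain ⟨c, hcρ, hcL⟩ := hmap.2.2 w
  have hψw : I.ψ s a w = ∑ j, c j • I.ψ s a (I.wref j) := by
    rw [hmap.1, hcρ, kron_sum]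
    simp only [hmap.1]
  have hdiff : inner ℝ (ξ k h) (I.ψ s a w)
      - ∫ s', vFun M I st act ξ k (h + 1) s' w ∂(M.P h (s, a))
      = ∑ j, c j * inner ℝ (θ' j - θ j) (I.φ s a) := by
    rw [hback, hψw, inner_sum, inner_sum, ← Finset.sum_sub_distrib]
    refine Finset.sum_congr rfl fun j _ => ?_
    rw [inner_smul_right, inner_smul_right, inner_sub_left, hall, ← hback s a (I.wref j), hθP]
    ring
  -- One `β` comes from the constraint on the planned `θ' j`, the other from the accuracy of the
  -- ridge estimator.
  have hj : ∀ j, |inner ℝ (θ' j - θ j) (I.φ s a)|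
      ≤ 2 * I.β * weightedNorm (gram I st act k h)⁻¹ (I.φ s a) := by
    intro j
    rw [← sub_add_sub_cancel (θ' j) (thetaTilde M I st act ξ k h (I.wref j)) (θ j),
      inner_add_left]
    have hw := weightedNorm_nonneg (gram I st act k h)⁻¹ (I.φ s a)
    have h1 := (abs_inner_le_weightedNorm_mul hpd
      (θ' j - thetaTilde M I st act ξ k h (I.wref j)) (I.φ s a)).trans
      (mul_le_mul_of_nonneg_right (hfeas j) hw)
    have h2 := (abs_inner_le_weightedNorm_mul hpd
      (thetaTilde M I st act ξ k h (I.wref j) - θ j) (I.φ s a)).trans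
      (mul_le_mul_of_nonneg_right (hcθ j) hw)
    exact (abs_add_le _ _).trans (by linarith)
  rw [hdiff]
  refine (Finset.abs_sum_le_sum_abs _ _).trans ?_
  have hw := weightedNorm_nonneg (gram I st act k h)⁻¹ (I.φ s a)
  calc ∑ j, |c j * inner ℝ (θ' j - θ j) (I.φ s a)|
      ≤ ∑ j, |c j| * (2 * I.β * weightedNorm (gram I st act k h)⁻¹ (I.φ s a)) :=
        Finset.sum_le_sum fun j _ => by
          rw [abs_mul]; exact mul_le_mul_of_nonneg_left (hj j) (abs_nonneg _)
    _ = (∑ j, |c j|) * (2 * I.β * weightedNorm (gram I st act k h)⁻¹ (I.φ s a)) := by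
        rw [Finset.sum_mul]
    _ ≤ I.L * (2 * I.β * weightedNorm (gram I st act k h)⁻¹ (I.φ s a)) :=
        mul_le_mul_of_nonneg_right hcL (by positivity)
    _ = _ := by ring

end Estimation

/-! ### Optimism and the one-step recursion for the gap -/

section Regret

variable {S A W : Type*} [MeasurableSpace S] [MeasurableSpace A] [MeasurableSpace W]
  {d m n : ℕ} {M : ContextualMDP S A W} {I : Params S A W d m n}
  {st : ℕ → ℕ → S} {act : ℕ → ℕ → A} {ξ : ℕ → ℕ → EuclideanSpace ℝ (Fin d × Fin m)}
  [Nonempty A] [Finite A] [MeasurableSingletonClass A]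

lemma vFun_sub_value_mem_Icc (π : Policy S A W) (k : ℕ) {h : ℕ} (hh : 1 ≤ h) (s : S) (w : W) :
    vFun M I st act ξ k h s w - M.value π h s w ∈ Set.Icc (-(M.H : ℝ)) M.H := by
  have h1 := vFun_mem_Icc (M := M) (I := I) (st := st) (act := act) (ξ := ξ) k h s w
  have h2 := value_mem M π hh s w
  exact ⟨by linarith [h1.1, h2.2], by linarith [h1.2, h2.1]⟩

lemma qFun_le_iSup (k h : ℕ) (s : S) (a : A) (w : W) :
    qFun M I st act ξ k h s a w ≤ ⨆ a : A, qFun M I st act ξ k h s a w :=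
  le_ciSup (f := fun a => qFun M I st act ξ k h s a w) (Set.finite_range _).bddAbove a

/-- The planned parameters at step `h` estimate the backup of the planned value function up to half
the exploration bonus. -/
def IsAccurate (M : ContextualMDP S A W) (I : Params S A W d m n) (st : ℕ → ℕ → S)
    (act : ℕ → ℕ → A) (ξ : ℕ → ℕ → EuclideanSpace ℝ (Fin d × Fin m)) (k h : ℕ) : Prop :=
  ∀ s a w, |inner ℝ (ξ k h) (I.ψ s a w)
      - ∫ s', vFun M I st act ξ k (h + 1) s' w ∂(M.P h (s, a))|
    ≤ 2 * I.L * I.β * weightedNorm (gram I st act k h)⁻¹ (I.φ s a)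

lemma integrable_value (π : Policy S A W) {h : ℕ} (hh : h ∈ Finset.Icc 1 (M.H + 1)) (w : W)
    (ν : Measure S) [IsFiniteMeasure ν] : Integrable (fun s => M.value π h s w) ν :=
  integrable_of_abs_le (C := M.H) (value_measurable_state M π w hh) fun s => by
    have := value_mem M π (Finset.mem_Icc.1 hh).1 s w
    exact abs_le.2 ⟨by linarith [this.1, this.2], this.2⟩

lemma integrable_vFun (hφ : Measurable fun x : S × A => I.φ x.1 x.2)
    (hψ : Measurable fun x : S × A × W => I.ψ x.1 x.2.1 x.2.2) {k h : ℕ}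
    (hh : h ∈ Finset.Icc 1 (M.H + 1)) (w : W) (ν : Measure S) [IsFiniteMeasure ν] :
    Integrable (fun s => vFun M I st act ξ k h s w) ν :=
  integrable_of_abs_le (C := M.H) (vFun_measurable_state hφ hψ hh w) fun s => by
    have := vFun_mem_Icc (M := M) (I := I) (st := st) (act := act) (ξ := ξ) k h s w
    exact abs_le.2 ⟨by linarith [this.1, this.2], this.2⟩

/-- Optimism: the planned value functions dominate the values of all policies. -/
lemma value_le_vFun (hφ : Measurable fun x : S × A => I.φ x.1 x.2)
    (hψ : Measurable fun x : S × A × W => I.ψ x.1 x.2.1 x.2.2) {k : ℕ}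
    (hacc : ∀ h ∈ Finset.Icc 1 M.H, IsAccurate M I st act ξ k h) (π : Policy S A W) {h : ℕ}
    (hh : h ∈ Finset.Icc 1 (M.H + 1)) (s : S) (w : W) :
    M.value π h s w ≤ vFun M I st act ξ k h s w := by
  rw [Finset.mem_Icc] at hh
  obtain ⟨h1, h2⟩ := hh
  induction h2 using Nat.decreasingInduction generalizing s with
  | self => rw [value_eq_zero, vFun_succ_horizon]
  | of_succ h hle ih =>
    have hmem : h ∈ Finset.Icc 1 M.H := Finset.mem_Icc.2 ⟨h1, by omega⟩
    have hmem' : h + 1 ∈ Finset.Icc 1 (M.H + 1) := Finset.mem_Icc.2 (by omega)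
    refine le_min ?_ (value_mem M π h1 s w).2
    refine le_trans ?_ (qFun_le_iSup k h s (π.act h s w) w)
    rw [qFun, if_pos (by omega), value_eq M π hmem]
    refine le_trans ?_ (le_max_left _ _)
    have h3 := integral_mono (integrable_value π hmem' w (M.P h (s, π.act h s w)))
      (integrable_vFun (st := st) (act := act) (ξ := ξ) (k := k) hφ hψ hmem' w
        (M.P h (s, π.act h s w))) fun s' => ih s' (by omega)
    -- The bonus in `qFun` is exactly the admissible error in `IsAccurate`, so it compensates an
    -- underestimated backup.
    have h4 := abs_le.1 (hacc h hmem s (π.act h s w) w)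
    linarith [h4.1]

/-- The bonus `2Lβ` and an estimation error of the same size add up to `4Lβ`. The truncation of
`qFun` at 0 is harmless because the upper bound for `qFun` is nonnegative. -/
lemma vFun_sub_value_le (hφ : Measurable fun x : S × A => I.φ x.1 x.2)
    (hψ : Measurable fun x : S × A × W => I.ψ x.1 x.2.1 x.2.2) {k : ℕ} (hLβ : 0 ≤ I.L * I.β)
    {h : ℕ} (hh : h ∈ Finset.Icc 1 M.H) (hacc : IsAccurate M I st act ξ k h)
    (π : Policy S A W) (s : S) (w : W)
    (hgreedy : ∀ a, qFun M I st act ξ k h s a w ≤ qFun M I st act ξ k h s (π.act h s w) w) :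
    vFun M I st act ξ k h s w - M.value π h s w
      ≤ 4 * (I.L * I.β) * weightedNorm (gram I st act k h)⁻¹ (I.φ s (π.act h s w))
        + ∫ s', (vFun M I st act ξ k (h + 1) s' w - M.value π (h + 1) s' w)
            ∂(M.P h (s, π.act h s w)) := by
  have hh' := Finset.mem_Icc.1 hh
  have hmem' : h + 1 ∈ Finset.Icc 1 (M.H + 1) := Finset.mem_Icc.2 (by omega)
  rw [integral_sub (integrable_vFun hφ hψ hmem' w _) (integrable_value π hmem' w _),
    value_eq M π hh]
  have h1 : vFun M I st act ξ k h s w ≤ qFun M I st act ξ k h s (π.act h s w) w :=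
    (min_le_left _ _).trans (ciSup_le hgreedy)
  have h2 := abs_le.1 (hacc s (π.act h s w) w)
  have h3 := (M.r_mem h hh s (π.act h s w) w).1
  have h4 := (integral_mem_Icc (μ := M.P h (s, π.act h s w))
    (vFun_measurable_state (st := st) (act := act) (ξ := ξ) (k := k) hφ hψ hmem' w)
    fun s' => vFun_mem_Icc k (h + 1) s' w).1
  have h5 := mul_nonneg hLβ
    (weightedNorm_nonneg (gram I st act k h)⁻¹ (I.φ s (π.act h s w)))
  have h6 : qFun M I st act ξ k h s (π.act h s w) w ≤ M.r h s (π.act h s w) w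
      + ∫ s', vFun M I st act ξ k (h + 1) s' w ∂(M.P h (s, π.act h s w))
      + 4 * (I.L * I.β) * weightedNorm (gram I st act k h)⁻¹ (I.φ s (π.act h s w)) := by
    rw [qFun, if_pos hh'.2]
    refine max_le ?_ ?_
    · linarith [h2.2]
    · linarith
  linarith

/-- Along a trajectory, the gap between the planned value and the value of the greedy policy is
bounded by the sum of the bonuses plus centred terms. -/
lemma vFun_sub_value_le_sum (hφ : Measurable fun x : S × A => I.φ x.1 x.2)
    (hψ : Measurable fun x : S × A × W => I.ψ x.1 x.2.1 x.2.2) {k : ℕ} (hLβ : 0 ≤ I.L * I.β)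
    (hacc : ∀ h ∈ Finset.Icc 1 M.H, IsAccurate M I st act ξ k h)
    (π : Policy S A W) (w : W)
    (hgreedy : ∀ h ∈ Finset.Icc 1 M.H, ∀ s a,
      qFun M I st act ξ k h s a w ≤ qFun M I st act ξ k h s (π.act h s w) w)
    (x : ℕ → S) {h : ℕ} (hh : h ≤ M.H) :
    vFun M I st act ξ k 1 (x 1) w - M.value π 1 (x 1) w
      ≤ vFun M I st act ξ k (h + 1) (x (h + 1)) w - M.value π (h + 1) (x (h + 1)) w +
        ∑ i ∈ Finset.Icc 1 h,
        (4 * (I.L * I.β) * weightedNorm (gram I st act k i)⁻¹ (I.φ (x i) (π.act i (x i) w))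
        + (∫ s', (vFun M I st act ξ k (i + 1) s' w - M.value π (i + 1) s' w)
            ∂(M.P i (x i, π.act i (x i) w))
          - (vFun M I st act ξ k (i + 1) (x (i + 1)) w
              - M.value π (i + 1) (x (i + 1)) w))) := by
  induction h with
  | zero => simp
  | succ h ih =>
    have hmem : h + 1 ∈ Finset.Icc 1 M.H := Finset.mem_Icc.2 (by omega)
    have h1 := vFun_sub_value_le hφ hψ hLβ hmem (hacc _ hmem) π (x (h + 1)) w
      (hgreedy _ hmem (x (h + 1)))
    rw [Finset.sum_Icc_succ_top (by omega)]
    have := ih (by omega)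
    linarith

end Regret

/-! ### The replanning rule and the number of planning calls -/

section Replanning

variable {S A W : Type*} [MeasurableSpace S] [MeasurableSpace A] [MeasurableSpace W]
  {d m n : ℕ} {M : ContextualMDP S A W} {I : Params S A W d m n}
  {st : ℕ → ℕ → S} {act : ℕ → ℕ → A}

lemma visited_dotProduct_le (hφ : ∀ s a, ‖I.φ s a‖ ≤ 1) (h τ : ℕ) :
    visited I st act h τ ⬝ᵥ visited I st act h τ ≤ 1 := by
  rw [visited, ← inner_eq_dotProduct, real_inner_self_eq_norm_sq]
  exact pow_le_one₀ (norm_nonneg _) (hφ _ _)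

lemma kTilde_mem (k : ℕ) : 1 ≤ kTilde M I st act k ∧ kTilde M I st act k ≤ max k 1 := by
  induction k with
  | zero => simp [kTilde]
  | succ k ih =>
    rw [kTilde]
    split_ifs
    · omega
    · omega

lemma kTilde_mem_Icc {k : ℕ} (hk : 1 ≤ k) : kTilde M I st act k ∈ Finset.Icc 1 k := by
  have := kTilde_mem (M := M) (I := I) (st := st) (act := act) k
  rw [Finset.mem_Icc]
  omega

lemma not_replan_kTilde (k : ℕ) (hk : 1 ≤ k) :
    ¬ Replan M I st act k (kTilde M I st act k) := by
  obtain ⟨k, rfl⟩ := Nat.exists_eq_add_of_le' hk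
  rw [kTilde]
  split_ifs with hr
  · simp [Replan]
  · exact hr

/-- No replanning is due after the update of `k̃`, so the log-determinants differ by at most 1, and
the inverse forms by a factor of at most `e`. -/
lemma weightedNorm_sq_kTilde_le (hlam : 0 < I.lam) {k : ℕ} (hk : 1 ≤ k) {h : ℕ}
    (hh : h ∈ Finset.Icc 1 M.H) (x : EuclideanSpace ℝ (Fin d)) :
    weightedNorm (gram I st act (kTilde M I st act k) h)⁻¹ x ^ 2
      ≤ Real.exp 1 * weightedNorm (gram I st act k h)⁻¹ x ^ 2 := by
  have h1 := not_replan_kTilde (M := M) (I := I) (st := st) (act := act) k hk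
  have h2 : Real.log (gram I st act k h).det
      - Real.log (gram I st act (kTilde M I st act k) h).det ≤ 1 := by
    by_contra! hcon
    exact h1 ⟨h, hh, hcon⟩
  have hmem := Finset.mem_Icc.1 (kTilde_mem_Icc (M := M) (I := I) (st := st) (act := act) hk)
  have h3 := dotProduct_inv_seqGram_le (v := visited I st act h) hlam hmem.1 hmem.2 x.ofLp
  have h4 := dotProduct_inv_mulVec_nonneg (gram_posDef (st := st) (act := act) hlam k h) x.ofLp
  rw [weightedNorm, weightedNorm, Real.sq_sqrt h4,
    Real.sq_sqrt (dotProduct_inv_mulVec_nonneg (gram_posDef hlam _ h) x.ofLp)]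
  refine h3.trans (mul_le_mul_of_nonneg_right (Real.exp_le_exp.2 h2) h4)

/-- The right side is a potential evaluated at the latest planning episode. It changes only at
planning calls, where one step contributes more than 1 and the others at least 0. -/
lemma planningCalls_le_sum (hlam : 0 < I.lam) (K : ℕ) :
    (planningCalls M I st act K : ℝ) ≤ ∑ h ∈ Finset.Icc 1 M.H,
      (Real.log (gram I st act (kTilde M I st act K) h).det
        - Real.log (gram I st act 1 h).det) := by
  classical
  induction K with
  | zero => simp [planningCalls, kTilde]
  | succ K ih =>
    have hmem := kTilde_mem (M := M) (I := I) (st := st) (act := act) K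
    rw [planningCalls, ← Finset.insert_Icc_right_eq_Icc_add_one (by omega), Finset.filter_insert,
      add_tsub_cancel_right]
    rw [planningCalls] at ih
    by_cases hr : Replan M I st act (K + 1) (kTilde M I st act K)
    · have hk : kTilde M I st act (K + 1) = K + 1 := by rw [kTilde, if_pos hr]
      rw [if_pos hr, hk]
      have hcard := Finset.card_insert_le (K + 1)
        ((Finset.Icc 1 K).filter fun k => Replan M I st act k (kTilde M I st act (k - 1)))
      have hstep : (1 : ℝ) ≤ ∑ h ∈ Finset.Icc 1 M.H, (Real.log (gram I st act (K + 1) h).det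
          - Real.log (gram I st act (kTilde M I st act K) h).det) := by
        obtain ⟨h, hh, hlt⟩ := hr
        refine hlt.le.trans (Finset.single_le_sum (f := fun h =>
          Real.log (gram I st act (K + 1) h).det
          - Real.log (gram I st act (kTilde M I st act K) h).det) (fun i _ => ?_) hh)
        exact sub_nonneg.2 (log_det_seqGram_mono hlam hmem.1 (by omega))
      have hsum := add_le_add ih hstep
      rw [← Finset.sum_add_distrib] at hsum
      refine le_trans (by exact_mod_cast hcard) (hsum.trans (le_of_eq ?_))
      exact Finset.sum_congr rfl fun h _ => by ring
    · have hk : kTilde M I st act (K + 1) = kTilde M I st act K := by rw [kTilde, if_neg hr]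
      rw [if_neg hr, hk]
      exact ih

lemma log_det_gram_sub_le (hφ : ∀ s a, ‖I.φ s a‖ ≤ 1) (hlam : 0 < I.lam) {K k : ℕ}
    (h1 : 1 ≤ k) (hk : k ≤ K + 1) (h : ℕ) :
    Real.log (gram I st act k h).det - Real.log (gram I st act 1 h).det
      ≤ d * Real.log (1 + K / (d * I.lam)) := by
  rcases Nat.eq_zero_or_pos d with rfl | hd
  · simp
  · have : Nonempty (Fin d) := ⟨⟨0, hd⟩⟩
    obtain ⟨k, rfl⟩ := Nat.exists_eq_add_of_le' h1
    have hmono := log_det_seqGram_mono (v := visited I st act h) hlam h1 hk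
    have := log_det_seqGram_le hlam (visited_dotProduct_le (st := st) (act := act) hφ h) K
    simp only [Fintype.card_fin] at this
    rw [gram_eq_seqGram, gram_eq_seqGram]
    linarith

lemma planningCalls_le (hφ : ∀ s a, ‖I.φ s a‖ ≤ 1) (hlam : 0 < I.lam) (K : ℕ) :
    (planningCalls M I st act K : ℝ) ≤ d * M.H * Real.log (1 + K / (d * I.lam)) := by
  have hmem := kTilde_mem (M := M) (I := I) (st := st) (act := act) K
  refine (planningCalls_le_sum hlam K).trans ((Finset.sum_le_sum fun h _ =>
    log_det_gram_sub_le hφ hlam hmem.1 (by omega : _ ≤ K + 1) h).trans (le_of_eq ?_))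
  simp only [Finset.sum_const, Nat.card_Icc, nsmul_eq_mul, add_tsub_cancel_right]
  ring

end Replanning

/-! ### Measurability of determinants, inverses and random indices -/

section MatrixMeasurability

variable {Ω : Type*} [MeasurableSpace Ω] {ι : Type*} [Fintype ι] [DecidableEq ι]

lemma measurable_det {A : Ω → Matrix ι ι ℝ} (hA : ∀ i j, Measurable fun ω => A ω i j) :
    Measurable fun ω => (A ω).det := by
  simp only [Matrix.det_apply]
  refine Finset.measurable_sum _ fun σ _ => ?_
  refine Measurable.const_smul (Finset.measurable_prod _ fun i _ => hA _ _) _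

lemma measurable_inv_apply {A : Ω → Matrix ι ι ℝ} (hA : ∀ i j, Measurable fun ω => A ω i j)
    (i j : ι) : Measurable fun ω => (A ω)⁻¹ i j := by
  simp only [Matrix.inv_def, Matrix.smul_apply, smul_eq_mul, Ring.inverse_eq_inv',
    Matrix.adjugate_apply]
  refine (measurable_det hA).inv.mul (measurable_det fun a b => ?_)
  simp only [Matrix.updateRow_apply]
  split_ifs
  · exact measurable_const
  · exact hA a b

lemma measurable_comp_nat {β : Type*} [MeasurableSpace β] {N : Ω → ℕ} (hN : Measurable N)
    (s : Finset ℕ) (hs : ∀ ω, N ω ∈ s) {g : ℕ → Ω → β} (hg : ∀ n ∈ s, Measurable (g n)) :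
    Measurable fun ω => g (N ω) ω := by
  intro B hB
  have : (fun ω => g (N ω) ω) ⁻¹' B = ⋃ n ∈ s, N ⁻¹' {n} ∩ g n ⁻¹' B := by
    ext ω
    simp only [Set.mem_preimage, Set.mem_iUnion, Set.mem_inter_iff, Set.mem_singleton_iff,
      exists_prop]
    exact ⟨fun h => ⟨N ω, hs ω, rfl, h⟩, by rintro ⟨n, -, rfl, h⟩; exact h⟩
  rw [this]
  exact Finset.measurableSet_biUnion s fun n hn =>
    (hN (measurableSet_singleton n)).inter (hg n hn hB)

end MatrixMeasurability

/-! ### Measurability of the planned quantities in terms of past data -/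

section DataMeasurability

variable {S A W : Type*} [MeasurableSpace S] [MeasurableSpace A] [MeasurableSpace W]
  {d m n : ℕ} {M : ContextualMDP S A W} {I : Params S A W d m n}
  {Ω : Type*} [MeasurableSpace Ω] {st : ℕ → ℕ → Ω → S} {act : ℕ → ℕ → Ω → A} {k : ℕ}

lemma gram_apply_measurable
    (hdata : ∀ τ ∈ Finset.Ico 1 k, ∀ h ∈ Finset.Icc 1 M.H,
      Measurable fun ω => I.φ (st τ h ω) (act τ h ω))
    {k' h : ℕ} (hk' : k' ≤ k) (hh : h ∈ Finset.Icc 1 M.H) (i j : Fin d) :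
    Measurable fun ω => gram I (fun k h => st k h ω) (fun k h => act k h ω) k' h i j := by
  simp only [gram, Matrix.add_apply, Matrix.sum_apply, Matrix.vecMulVec_apply]
  refine measurable_const.add (Finset.measurable_sum _ fun τ hτ => ?_)
  have := hdata τ (Finset.Ico_subset_Ico_right hk' hτ) h hh
  have h1 : ∀ i, Measurable fun ω => I.φ (st τ h ω) (act τ h ω) i := fun i => by fun_prop
  exact (h1 i).mul (h1 j)

lemma kTilde_measurable
    (hdata : ∀ τ ∈ Finset.Ico 1 k, ∀ h ∈ Finset.Icc 1 M.H,
      Measurable fun ω => I.φ (st τ h ω) (act τ h ω)) {j : ℕ} (hj : j ≤ k) :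
    Measurable fun ω => kTilde M I (fun k h => st k h ω) (fun k h => act k h ω) j := by
  induction j with
  | zero => simp only [kTilde]; exact measurable_const
  | succ j ih =>
    have ih := ih (by omega)
    simp only [kTilde]
    refine Measurable.ite ?_ measurable_const ih
    have hlog : ∀ k' ≤ k, ∀ h ∈ Finset.Icc 1 M.H, Measurable fun ω =>
        Real.log (gram I (fun k h => st k h ω) (fun k h => act k h ω) k' h).det :=
      fun k' hk' h hh => Real.measurable_log.comp
        (measurable_det (gram_apply_measurable hdata hk' hh))
    have hset : {ω | Replan M I (fun k h => st k h ω) (fun k h => act k h ω) (j + 1)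
          (kTilde M I (fun k h => st k h ω) (fun k h => act k h ω) j)}
        = ⋃ h ∈ Finset.Icc 1 M.H, {ω | 1 <
            Real.log (gram I (fun k h => st k h ω) (fun k h => act k h ω) (j + 1) h).det
            - Real.log (gram I (fun k h => st k h ω) (fun k h => act k h ω)
              (kTilde M I (fun k h => st k h ω) (fun k h => act k h ω) j) h).det} := by
      ext ω
      simp [Replan]
    rw [hset]
    refine Finset.measurableSet_biUnion _ fun h hh => ?_
    refine measurableSet_lt measurable_const ((hlog _ hj h hh).sub ?_)
    refine measurable_comp_nat ih (Finset.range (k + 1)) (fun ω => ?_)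
      (g := fun k' ω =>
        Real.log (gram I (fun k h => st k h ω) (fun k h => act k h ω) k' h).det)
      fun k' hk' => hlog k' (by simpa [Nat.lt_succ_iff] using hk') h hh
    have := (kTilde_mem (M := M) (I := I) (st := fun k h => st k h ω)
      (act := fun k h => act k h ω) j).2
    simp only [Finset.mem_range]
    omega

lemma vFun_measurable [Nonempty A] [Finite A] [MeasurableSingletonClass A]
    (hφ : Measurable fun x : S × A => I.φ x.1 x.2)
    (hψ : Measurable fun x : S × A × W => I.ψ x.1 x.2.1 x.2.2)
    (hdata : ∀ τ ∈ Finset.Ico 1 k, ∀ h ∈ Finset.Icc 1 M.H,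
      Measurable fun ω => I.φ (st τ h ω) (act τ h ω))
    {ξ : ℕ → ℕ → Ω → EuclideanSpace ℝ (Fin d × Fin m)}
    (hξ : ∀ k' ∈ Finset.Icc 1 k, ∀ h ∈ Finset.Icc 1 M.H, Measurable (ξ k' h))
    {ctx : Ω → W} (hctx : Measurable ctx) {k' h : ℕ} (hk' : k' ∈ Finset.Icc 1 k)
    (hh : h ∈ Finset.Icc 1 (M.H + 1)) :
    Measurable fun x : Ω × S => vFun M I (fun k h => st k h x.1) (fun k h => act k h x.1)
      (fun k h => ξ k h x.1) k' h x.2 (ctx x.1) := by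
  rw [Finset.mem_Icc] at hh
  rcases hh.2.lt_or_eq with hlt | rfl
  · have hmem : h ∈ Finset.Icc 1 M.H := Finset.mem_Icc.2 (by omega)
    unfold vFun qFun
    simp only [if_pos (Nat.lt_succ_iff.1 hlt)]
    have h1 : ∀ a, Measurable fun x : Ω × S => I.φ x.2 a := fun a =>
      hφ.comp (measurable_snd.prodMk measurable_const)
    have h2 : ∀ a, Measurable fun x : Ω × S => I.ψ x.2 a (ctx x.1) := fun a =>
      hψ.comp (measurable_snd.prodMk (measurable_const.prodMk (hctx.comp measurable_fst)))
    have h3 : ∀ a, Measurable fun x : Ω × S => M.r h x.2 a (ctx x.1) := fun a =>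
      (M.r_measurable h hmem).comp
        (measurable_snd.prodMk (measurable_const.prodMk (hctx.comp measurable_fst)))
    have h4 := (hξ k' hk' h hmem).comp (measurable_fst : Measurable (Prod.fst : Ω × S → Ω))
    have h5 : ∀ i j, Measurable fun x : Ω × S =>
        (gram I (fun k h => st k h x.1) (fun k h => act k h x.1) k' h)⁻¹ i j := fun i j =>
      (measurable_inv_apply (gram_apply_measurable hdata (Finset.mem_Icc.1 hk').2 hmem) i j).comp
        measurable_fst
    refine Measurable.min (Measurable.iSup fun a => ?_) measurable_const
    have h6 : Measurable fun x : Ω × S => weightedNorm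
        (gram I (fun k h => st k h x.1) (fun k h => act k h x.1) k' h)⁻¹ (I.φ x.2 a) := by
      have h7 : ∀ i, Measurable fun x : Ω × S => I.φ x.2 a i := fun i => by
        have := h1 a; fun_prop
      unfold weightedNorm Matrix.mulVec dotProduct
      refine Measurable.sqrt (Finset.measurable_sum _ fun i _ => (h7 i).mul ?_)
      exact Finset.measurable_sum _ fun j _ => (h5 i j).mul (h7 j)
    exact (((h3 a).add (h4.inner (h2 a))).add (h6.const_mul _)).max measurable_const
  · simp [vFun_succ_horizon]

lemma vFun_kTilde_sub_value_measurable [Nonempty A] [Finite A] [MeasurableSingletonClass A]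
    (hφ : Measurable fun x : S × A => I.φ x.1 x.2)
    (hψ : Measurable fun x : S × A × W => I.ψ x.1 x.2.1 x.2.2) (hk : 1 ≤ k)
    (hdata : ∀ τ ∈ Finset.Ico 1 k, ∀ h ∈ Finset.Icc 1 M.H,
      Measurable fun ω => I.φ (st τ h ω) (act τ h ω))
    {ξ : ℕ → ℕ → Ω → EuclideanSpace ℝ (Fin d × Fin m)}
    (hξ : ∀ k' ∈ Finset.Icc 1 k, ∀ h ∈ Finset.Icc 1 M.H, Measurable (ξ k' h))
    {ctx : Ω → W} (hctx : Measurable ctx) {pol : Ω → Policy S A W}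
    (hpol : ∀ h ∈ Finset.Icc 1 M.H,
      Measurable fun x : Ω × S × W => (pol x.1).act h x.2.1 x.2.2)
    {h : ℕ} (hh : h ∈ Finset.Icc 1 (M.H + 1)) :
    Measurable fun x : Ω × S => vFun M I (fun k h => st k h x.1) (fun k h => act k h x.1)
        (fun k h => ξ k h x.1) (kTilde M I (fun k h => st k h x.1) (fun k h => act k h x.1) k)
        h x.2 (ctx x.1)
      - M.value (pol x.1) h x.2 (ctx x.1) := by
  refine Measurable.sub ?_ (value_measurable M hctx hpol hh)
  exact measurable_comp_nat ((kTilde_measurable hdata le_rfl).comp measurable_fst)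
    (Finset.Icc 1 k) (fun x => kTilde_mem_Icc hk)
    (g := fun k' (x : Ω × S) => vFun M I (fun k h => st k h x.1) (fun k h => act k h x.1)
      (fun k h => ξ k h x.1) k' h x.2 (ctx x.1))
    fun k' hk' => vFun_measurable hφ hψ hdata hξ hctx hk' hh

end DataMeasurability

/-! ### The sampling noise of the regret -/

section Martingale

variable {S A W : Type*} [MeasurableSpace S] [MeasurableSpace A] [MeasurableSpace W]
  [Nonempty A] [Finite A] [MeasurableSingletonClass A]
  {d m n : ℕ} {M : ContextualMDP S A W} {I : Params S A W d m n} {K : ℕ}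
  {Ω : Type*} [mΩ : MeasurableSpace Ω] {μ : Measure Ω} (R : Run M I K μ)

/-- The episode whose plan is in force in episode `k`. -/
noncomputable def Run.planEpisode (k : ℕ) (ω : Ω) : ℕ :=
  kTilde M I (fun k h => R.st k h ω) (fun k h => R.act k h ω) k

/-- The value function of the plan in force in episode `k`, at the context of the episode. -/
noncomputable def Run.planValue (k h : ℕ) (ω : Ω) (s : S) : ℝ :=
  vFun M I (fun k h => R.st k h ω) (fun k h => R.act k h ω) (fun k h => R.ξ k h ω)
    (R.planEpisode k ω) h s (R.ctx k ω)

/-- The gap between the planned value and the value of the policy of episode `k`. -/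
noncomputable def Run.gap (k h : ℕ) (ω : Ω) (s : S) : ℝ :=
  R.planValue k h ω s - M.value (R.pol k ω) h s (R.ctx k ω)

/-- At the start of episode `k` the plan, the context and the policy are all determined, so for
every step the gap is a known function of the state. This is the predictability that the martingale
bound requires. -/
lemma Run.gap_measurable (hφ : Measurable fun x : S × A => I.φ x.1 x.2)
    (hψ : Measurable fun x : S × A × W => I.ψ x.1 x.2.1 x.2.2)
    {k h : ℕ} (hk : k ∈ Finset.Icc 1 K) (hh : h ∈ Finset.Icc 1 (M.H + 1)) :
    Measurable[(R.ℱ (toLex (k, 1))).prod inferInstance]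
      fun x : Ω × S => R.gap k h x.1 x.2 := by
  have hk' := Finset.mem_Icc.1 hk
  have hdata : ∀ τ ∈ Finset.Ico 1 k, ∀ h ∈ Finset.Icc 1 M.H,
      Measurable[R.ℱ (toLex (k, 1))] fun ω => I.φ (R.st τ h ω) (R.act τ h ω) := by
    intro τ hτ h hh
    rw [Finset.mem_Ico] at hτ
    exact hφ.comp ((R.stateAction_measurable (Finset.mem_Icc.2 (by omega)) hh).mono
      (R.ℱ.mono (Prod.Lex.toLex_le_toLex.2 (Or.inl hτ.2))) le_rfl)
  have hξ : ∀ k' ∈ Finset.Icc 1 k, ∀ h ∈ Finset.Icc 1 M.H,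
      Measurable[R.ℱ (toLex (k, 1))] (R.ξ k' h) := by
    intro k' hk'' h hh
    rw [Finset.mem_Icc] at hk''
    refine (R.ξ_measurable k' (Finset.mem_Icc.2 (by omega)) h hh).mono
      (R.ℱ.mono (Prod.Lex.toLex_le_toLex.2 ?_)) le_rfl
    rcases hk''.2.lt_or_eq with h1 | h1
    · exact Or.inl h1
    · exact Or.inr ⟨h1, le_rfl⟩
  exact @vFun_kTilde_sub_value_measurable _ _ _ _ _ _ _ _ _ M I Ω (R.ℱ (toLex (k, 1))) R.st R.act
    k _ _ _ hφ hψ hk'.1 hdata R.ξ hξ (R.ctx k)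
    (R.ctx_measurable k hk) (R.pol k)
    (R.pol_measurable k hk) h hh

/-- An Azuma–Hoeffding bound for the sampling noise in the regret. -/
lemma Run.measure_gap_noise_ge_le [IsProbabilityMeasure μ]
    (hφ : Measurable fun x : S × A => I.φ x.1 x.2)
    (hψ : Measurable fun x : S × A × W => I.ψ x.1 x.2.1 x.2.2) (t r : ℝ) :
    μ {ω | r ≤ ∑ k ∈ Finset.Icc 1 K, ∑ h ∈ Finset.Icc 1 M.H,
        (t * (∫ s', R.gap k (h + 1) ω s' ∂(M.P h (R.st k h ω, R.act k h ω))
          - R.gap k (h + 1) ω (R.st k (h + 1) ω)) - t ^ 2 * (M.H : ℝ) ^ 2 / 2)}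
      ≤ ENNReal.ofReal (Real.exp (-r)) := by
  let s : Finset (ℕ ×ₗ ℕ) := (Finset.Icc 1 K ×ˢ Finset.Icc 1 M.H).map toLex.toEmbedding
  have hs : ∀ i ∈ s, (ofLex i).1 ∈ Finset.Icc 1 K ∧ (ofLex i).2 ∈ Finset.Icc 1 M.H := by
    intro i hi
    obtain ⟨p, hp, rfl⟩ := Finset.mem_map.1 hi
    exact Finset.mem_product.1 hp
  have hs1 : ∀ i ∈ s, (ofLex i).2 + 1 ∈ Finset.Icc 1 (M.H + 1) := by
    intro i hi
    have := Finset.mem_Icc.1 (hs i hi).2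
    exact Finset.mem_Icc.2 (by omega)
  have hstm : ∀ i ∈ s, Measurable[R.ℱ (toLex ((ofLex i).1, (ofLex i).2 + 1))]
      (R.st (ofLex i).1 ((ofLex i).2 + 1)) := fun i hi =>
    R.st_measurable _ (hs i hi).1 _ (hs1 i hi)
  have key := measure_sum_transition_ge_le (μ := μ) R.ℱ s
    (X := fun i => R.st (ofLex i).1 ((ofLex i).2 + 1))
    (fun i hi => (hstm i hi).mono (R.ℱ.le _) le_rfl)
    (fun i hi j hj hij => (hstm i hi).mono (R.ℱ.mono ?_) le_rfl)
    (q := fun i ω => (R.st (ofLex i).1 (ofLex i).2 ω, R.act (ofLex i).1 (ofLex i).2 ω))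
    (fun i hi => R.stateAction_measurable (hs i hi).1 (hs i hi).2)
    (P := fun i => M.P (ofLex i).2) (fun _ => M.markov _)
    (fun i hi B hB => R.transition _ (hs i hi).1 _ (hs i hi).2 B hB)
    (f := fun i ω x => R.gap (ofLex i).1 ((ofLex i).2 + 1) ω x)
    (fun i hi => ?_)
    -- The range has length `2H`, so `(hi - lo)² / 8` is `H² / 2`. The coefficient below is `-t`
    -- because the noise is expectation minus sample.
    (lo := -(M.H : ℝ)) (hi := M.H)
    (fun i hi ω x => vFun_sub_value_mem_Icc _ _ (by omega) _ _)
    (a := fun i ω => -t) (fun i hi => measurable_const) r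
  · convert key using 5 with ω
    rw [Finset.sum_map, Finset.sum_product]
    refine Finset.sum_congr rfl fun k _ => Finset.sum_congr rfl fun h _ => ?_
    simp only [Equiv.coe_toEmbedding, ofLex_toLex]
    ring
  · rw [show j = toLex ((ofLex j).1, (ofLex j).2) from rfl, Prod.Lex.toLex_le_toLex]
    rw [Prod.Lex.lt_iff] at hij
    omega
  · have h1 := R.gap_measurable hφ hψ (hs i hi).1 (hs1 i hi)
    have hle : R.ℱ (toLex ((ofLex i).1, 1)) ≤ R.ℱ i :=
      R.ℱ.mono (Prod.Lex.toLex_le_toLex.2 (Or.inr ⟨rfl, (Finset.mem_Icc.1 (hs i hi).2).1⟩))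
    refine h1.mono ?_ le_rfl
    exact sup_le_sup (MeasurableSpace.comap_mono hle) le_rfl

end Martingale

/-! ### Uniform concentration over the grid -/

section ConcentrationEvent

variable {S A W : Type*} [MeasurableSpace S] [MeasurableSpace A] [MeasurableSpace W]
  [Nonempty A] [Finite A] [MeasurableSingletonClass A]
  {d m n : ℕ} {M : ContextualMDP S A W} {I : Params S A W d m n} {K : ℕ}
  {Ω : Type*} [mΩ : MeasurableSpace Ω] {μ : Measure Ω} (R : Run M I K μ)

/-- The coordinates of a direction together with the parameters of a value function. -/
abbrev NetIndex (d m : ℕ) : Type := Fin d ⊕ (Fin d × Fin m) ⊕ (Fin d × Fin d)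

/-- The logarithmic weight for the direction and the value function encoded by `y`. -/
noncomputable def Run.netWeight (k h : ℕ) (j : Fin n) (y : NetIndex d m → ℝ) (ω : Ω) : ℝ :=
  R.logWeight k h (WithLp.toLp 2 fun i => y (Sum.inl i))
    (quadFun M.H I.φ I.ψ (I.wref j) (fun p => y (Sum.inr (Sum.inl p)))
      fun q => y (Sum.inr (Sum.inr q))) ω

/-- Some logarithmic weight of the net is at least `r`. -/
def Run.netExceeds (N : ℕ) (r : ℝ) (ω : Ω) : Prop :=
  ∃ k ∈ Finset.Icc 1 K, ∃ h ∈ Finset.Icc 1 M.H, ∃ j, ∃ y ∈ grid (NetIndex d m) N,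
    r ≤ R.netWeight k h j y ω

lemma Run.measure_netExceeds_le [IsProbabilityMeasure μ]
    (hφ : Measurable fun x : S × A => I.φ x.1 x.2)
    (hψ : Measurable fun x : S × A × W => I.ψ x.1 x.2.1 x.2.2) (N : ℕ) (r : ℝ) :
    μ {ω | R.netExceeds N r ω} ≤ ENNReal.ofReal
      ((K * M.H * n * (2 * N ^ 2 + 1) ^ (d + d * m + d ^ 2) : ℕ) * Real.exp (-r)) := by
  let s := Finset.Icc 1 K ×ˢ Finset.Icc 1 M.H ×ˢ (Finset.univ : Finset (Fin n)) ×ˢ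
    grid (NetIndex d m) N
  have hsub : {ω | R.netExceeds N r ω}
      ⊆ ⋃ x ∈ s, {ω | r ≤ R.netWeight x.1 x.2.1 x.2.2.1 x.2.2.2 ω} := by
    rintro ω ⟨k, hk, h, hh, j, y, hy, hr⟩
    simp only [Set.mem_iUnion]
    exact ⟨(k, h, j, y), Finset.mem_product.2 ⟨hk, Finset.mem_product.2 ⟨hh,
      Finset.mem_product.2 ⟨Finset.mem_univ _, hy⟩⟩⟩, hr⟩
  have hcard : s.card ≤ K * M.H * n * (2 * N ^ 2 + 1) ^ (d + d * m + d ^ 2) := by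
    have h1 := card_grid_le (κ := NetIndex d m) N
    have h2 : Fintype.card (NetIndex d m) = d + d * m + d ^ 2 := by
      simp only [Fintype.card_sum, Fintype.card_prod, Fintype.card_fin]
      ring
    rw [h2] at h1
    simp only [s, Finset.card_product, Nat.card_Icc, add_tsub_cancel_right, Finset.card_univ,
      Fintype.card_fin]
    rw [mul_assoc, mul_assoc]
    gcongr
  refine (measure_mono hsub).trans ((measure_biUnion_finset_le _ _).trans ?_)
  refine (Finset.sum_le_sum (g := fun _ => ENNReal.ofReal (Real.exp (-r))) fun x hx => ?_).trans ?_
  · obtain ⟨hk, hx⟩ := Finset.mem_product.1 hx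
    obtain ⟨hh, -⟩ := Finset.mem_product.1 hx
    exact R.measure_logWeight_ge_le hφ hk hh _ (quadFun_measurable hφ hψ _ _ _)
      (quadFun_mem_Icc _ _ _) r
  · rw [Finset.sum_const, nsmul_eq_mul, ENNReal.ofReal_mul (Nat.cast_nonneg _),
      ENNReal.ofReal_natCast]
    gcongr

/-- Outside of the exceptional event, the least-squares estimators are accurate. -/
lemma Run.weightedNorm_thetaTilde_sub_le (hφ : Measurable fun x : S × A => I.φ x.1 x.2)
    (hψ : Measurable fun x : S × A × W => I.ψ x.1 x.2.1 x.2.2)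
    (hb : IsBoundedLinearMDP M I.φ I.ψ) (hlam : I.lam = 1) (hL : 0 ≤ I.L) (hβ : 0 ≤ I.β)
    {N : ℕ} {r B ε b : ℝ} (hN : 0 < N) (hB : B = 4 * (K + d)) (hε : ε = 1 / N)
    (hb' : b = d * m * ε + √(d ^ 2 * ε)) (hBN : B ≤ N) (hνN : (M.H + 1) * √(m * d) ≤ N)
    (hXN : (2 * I.L * I.β) ^ 2 ≤ N)
    (herr : K * (B * (2 * b) + d * ε * M.H
      + (M.H : ℝ) ^ 2 / 8 * (d * ε * (2 * B + d * ε))) ≤ 1)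
    (hβr : 4 * (M.H : ℝ) ^ 2 * d + (M.H : ℝ) ^ 2 * (r + 1) ≤ I.β ^ 2)
    {ω : Ω} (hω : ¬ R.netExceeds N r ω) {k h : ℕ} (hk : k ∈ Finset.Icc 1 K)
    (hh : h ∈ Finset.Icc 1 M.H)
    (hξ : ∀ h ∈ Finset.Icc 1 M.H, ‖R.ξ k h ω‖ ≤ M.H * √(m * d))
    (j : Fin n) {θ : EuclideanSpace ℝ (Fin d)} (hθ : ‖θ‖ ≤ M.H * √d)
    (hθP : ∀ s a, ∫ s', vFun M I (fun k h => R.st k h ω) (fun k h => R.act k h ω)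
        (fun k h => R.ξ k h ω) k (h + 1) s' (I.wref j) ∂(M.P h (s, a)) = inner ℝ θ (I.φ s a)) :
    weightedNorm (gram I (fun k h => R.st k h ω) (fun k h => R.act k h ω) k h)
      (thetaTilde M I (fun k h => R.st k h ω) (fun k h => R.act k h ω)
        (fun k h => R.ξ k h ω) k h (I.wref j) - θ) ≤ I.β := by
  have hk' := Finset.mem_Icc.1 hk
  have hh' := Finset.mem_Icc.1 hh
  have hh1 : h + 1 ∈ Finset.Icc 1 (M.H + 1) := Finset.mem_Icc.2 (by omega)
  have hH1 : (1 : ℝ) ≤ M.H := by exact_mod_cast hh'.1.trans hh'.2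
  have hH0 : (0 : ℝ) < M.H := by linarith
  have hN' : (0 : ℝ) < N := by exact_mod_cast hN
  set st := fun k h => R.st k h ω with hst
  set act := fun k h => R.act k h ω with hact
  set ξ := fun k h => R.ξ k h ω with hξdef
  set V : S → ℝ := fun s => vFun M I st act ξ k (h + 1) s (I.wref j) with hV
  have hVm : Measurable V := vFun_measurable_state hφ hψ hh1 _
  have hVb : ∀ s, V s ∈ Set.Icc (0 : ℝ) M.H := fun s => vFun_mem_Icc _ _ _ _
  obtain ⟨ν, X, hν, hX, hVq⟩ := vFun_eq_quadFun (st := st) (act := act) (ξ := ξ) hb hlam hL hβ k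
    hh1 (fun hle => hξ _ (Finset.mem_Icc.2 ⟨by omega, hle⟩))
  set u := thetaTilde M I st act ξ k h (I.wref j) - θ with hu
  have hgram : gram I st act k h
      = seqGram 1 (fun τ => (I.φ (st τ h) (act τ h)).ofLp) k := by
    rw [gram_eq_seqGram, hlam]; rfl
  have huLp : u.ofLp = (seqGram 1 (fun τ => (I.φ (st τ h) (act τ h)).ofLp) k)⁻¹ *ᵥ
      (∑ τ ∈ Finset.Ico 1 k, V (st τ (h + 1)) • (I.φ (st τ h) (act τ h)).ofLp) - θ.ofLp := by
    rw [hu, thetaTilde, hgram, WithLp.ofLp_sub, WithLp.ofLp_sum]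
    rfl
  have hφ1 := hb.1
  have hpred : ∀ τ, inner ℝ θ (I.φ (st τ h) (act τ h)) ∈ Set.Icc (0 : ℝ) M.H := fun τ => by
    rw [← hθP]
    exact integral_mem_Icc hVm hVb
  have hunorm := ridge_error_norm_le (v := fun τ => I.φ (st τ h) (act τ h))
    (fun τ => hφ1 _ _) hθ huLp (fun τ _ => by
      have h1 := hpred τ
      have h2 := hVb (st τ (h + 1))
      exact abs_le.2 ⟨by linarith [h1.2, h2.1], by linarith [h1.1, h2.2]⟩)
  -- The direction is proportional to the random error itself; the deterministic norm bound places
  -- it in the box that the grid covers.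
  have hx : ‖(4 / (M.H : ℝ) ^ 2) • u‖ ≤ B := by
    have h1 : ((k - 1 : ℕ) : ℝ) ≤ K := by exact_mod_cast (by omega : k - 1 ≤ K)
    have h2 : √(d : ℝ) ≤ d := by
      rw [Real.sqrt_le_left (Nat.cast_nonneg d)]
      exact_mod_cast Nat.le_self_pow two_ne_zero d
    rw [norm_smul, Real.norm_of_nonneg (by positivity)]
    calc 4 / (M.H : ℝ) ^ 2 * ‖u‖ ≤ 4 / (M.H : ℝ) ^ 2 * ((M.H : ℝ) * ((K : ℝ) + d)) := by
          gcongr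
          refine hunorm.trans ?_
          rw [← mul_add]
          gcongr
      _ = 4 * ((K : ℝ) + d) / M.H := by field_simp
      _ ≤ 4 * ((K : ℝ) + d) := div_le_self (by positivity) hH1
      _ = B := hB.symm
  obtain ⟨y, hy, hyd⟩ := exists_mem_grid (κ := NetIndex d m) hN
    (v := Sum.elim ((4 / (M.H : ℝ) ^ 2) • u).ofLp (Sum.elim ν X)) (by
      rintro (i | p | q)
      · exact (PiLp.norm_apply_le _ i).trans (hx.trans hBN)
      · exact (hν p).trans hνN
      · exact (hX q).trans hXN)
  rw [← hε] at hyd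
  have hweight := R.logWeight_le_add (f := V)
    (f' := quadFun M.H I.φ I.ψ (I.wref j) (fun p => y (Sum.inr (Sum.inl p)))
      fun q => y (Sum.inr (Sum.inr q)))
    (x := (4 / (M.H : ℝ) ^ 2) • u) (g := WithLp.toLp 2 fun i => y (Sum.inl i))
    (h := h) hφ1 (by omega : k ≤ K + 1) hVm (quadFun_measurable hφ hψ _ _ _) hVb
    (quadFun_mem_Icc _ _ _) hx (fun i => hyd (Sum.inl i)) (b := b) (fun s => by
      have h1 := abs_quadFun_sub_le (H := M.H) hφ1 hb.2.1 (I.wref j) (ν := ν)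
        (ν' := fun p => y (Sum.inr (Sum.inl p))) (X := X)
        (X' := fun q => y (Sum.inr (Sum.inr q)))
        (fun p => hyd (Sum.inr (Sum.inl p))) (fun q => hyd (Sum.inr (Sum.inr q))) s
      rw [hb', hV]
      simp only [hVq]
      simpa using h1) ω
  have hnet : R.netWeight k h j y ω < r := by
    by_contra! hcon
    exact hω ⟨k, hk, h, hh, j, y, hy, hcon⟩
  -- The threshold is `r` at the grid point, and the discretization error, at most 1 by `herr`, is
  -- added.
  have hw : R.logWeight k h ((4 / (M.H : ℝ) ^ 2) • u) V ω ≤ r + 1 := by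
    rw [Run.netWeight] at hnet
    linarith
  have hfin := ridge_error_le (v := fun τ => I.φ (st τ h) (act τ h))
    (y := fun τ => V (st τ (h + 1))) (r := r + 1) hH0 hθ huLp (by
      refine le_trans (le_of_eq ?_) hw
      rw [Run.logWeight]
      refine Finset.sum_congr rfl fun τ _ => ?_
      rw [← hθP])
  rw [hgram]
  exact abs_le_of_sq_le_sq' (hfin.trans hβr) hβ |>.2

end ConcentrationEvent

/-! ### The regret of a run in terms of widths and noise -/

section RunRegret

variable {S A W : Type*} [MeasurableSpace S] [MeasurableSpace A] [MeasurableSpace W]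
  [Nonempty A] [Finite A] [MeasurableSingletonClass A]
  {d m n : ℕ} {M : ContextualMDP S A W} {I : Params S A W d m n} {K : ℕ}
  {Ω : Type*} [mΩ : MeasurableSpace Ω] {μ : Measure Ω} (R : Run M I K μ)

/-- The exploration width at step `h` of episode `k`, for the plan in force. -/
noncomputable def Run.width (k h : ℕ) (ω : Ω) : ℝ :=
  weightedNorm (gram I (fun k h => R.st k h ω) (fun k h => R.act k h ω)
    (R.planEpisode k ω) h)⁻¹ (I.φ (R.st k h ω) (R.act k h ω))

/-- The sampling noise of the regret at step `h` of episode `k`. -/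
noncomputable def Run.noise (k h : ℕ) (ω : Ω) : ℝ :=
  ∫ s', R.gap k (h + 1) ω s' ∂(M.P h (R.st k h ω, R.act k h ω))
    - R.gap k (h + 1) ω (R.st k (h + 1) ω)

/-- Optimism replaces the optimal value by the planned one; the remaining gap is followed along the
observed trajectory, on which the actions are those of the greedy policy, and vanishes at step `H +
1`. -/
lemma Run.regret_le_width_add_noise (hφ : Measurable fun x : S × A => I.φ x.1 x.2)
    (hψ : Measurable fun x : S × A × W => I.ψ x.1 x.2.1 x.2.2) (hLβ : 0 ≤ I.L * I.β) {ω : Ω}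
    (hacc : ∀ k ∈ Finset.Icc 1 K, ∀ h ∈ Finset.Icc 1 M.H,
      IsAccurate M I (fun k h => R.st k h ω) (fun k h => R.act k h ω) (fun k h => R.ξ k h ω)
        (R.planEpisode k ω) h) :
    R.regret ω ≤ 4 * (I.L * I.β) * ∑ k ∈ Finset.Icc 1 K, ∑ h ∈ Finset.Icc 1 M.H, R.width k h ω
      + ∑ k ∈ Finset.Icc 1 K, ∑ h ∈ Finset.Icc 1 M.H, R.noise k h ω := by
  rw [Run.regret, Finset.mul_sum, ← Finset.sum_add_distrib]
  refine Finset.sum_le_sum fun k hk => ?_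
  have hopt : M.optValue 1 (R.st k 1 ω) (R.ctx k ω) ≤ R.planValue k 1 ω (R.st k 1 ω) :=
    ciSup_le fun π => value_le_vFun hφ hψ (hacc k hk) π (Finset.mem_Icc.2 ⟨le_rfl, by omega⟩) _ _
  have hgap := vFun_sub_value_le_sum hφ hψ hLβ (hacc k hk) (R.pol k ω) (R.ctx k ω)
    (fun h hh s a => R.greedy k hk h hh ω s (R.ctx k ω) a) (fun h => R.st k h ω) (le_refl M.H)
  rw [vFun_succ_horizon, value_eq_zero, sub_zero, zero_add, Finset.sum_add_distrib,
    ← Finset.mul_sum] at hgap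
  refine (sub_le_sub_right hopt _).trans (hgap.trans (le_of_eq ?_))
  congr 1
  · congr 1
    refine Finset.sum_congr rfl fun h hh => ?_
    rw [Run.width, R.act_eq k hk h hh]
  · refine Finset.sum_congr rfl fun h hh => ?_
    rw [Run.noise, R.act_eq k hk h hh]
    rfl

/-- Cauchy–Schwarz over the episodes, then the factor `e` for the outdated plan, then the elliptical
potential. -/
lemma Run.sum_width_le (hφ : ∀ s a, ‖I.φ s a‖ ≤ 1) (hlam : I.lam = 1) {h : ℕ}
    (hh : h ∈ Finset.Icc 1 M.H) (ω : Ω) :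
    ∑ k ∈ Finset.Icc 1 K, R.width k h ω
      ≤ √(K * (Real.exp 1 * (2 * (d * Real.log (1 + K / d))))) := by
  have hlam0 : 0 < I.lam := by rw [hlam]; exact one_pos
  refine Real.le_sqrt_of_sq_le ?_
  refine sq_sum_le_card_mul_sum_sq.trans ?_
  rw [Nat.card_Icc, add_tsub_cancel_right]
  refine mul_le_mul_of_nonneg_left ?_ (Nat.cast_nonneg _)
  have h1 : ∀ k ∈ Finset.Icc 1 K, R.width k h ω ^ 2 ≤ Real.exp 1 *
      (visited I (fun k h => R.st k h ω) (fun k h => R.act k h ω) h k ⬝ᵥ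
        (seqGram I.lam (visited I (fun k h => R.st k h ω) (fun k h => R.act k h ω) h) k)⁻¹ *ᵥ
        visited I (fun k h => R.st k h ω) (fun k h => R.act k h ω) h k) := by
    intro k hk
    have h2 := weightedNorm_sq_kTilde_le (M := M) (I := I) (st := fun k h => R.st k h ω)
      (act := fun k h => R.act k h ω) hlam0 (Finset.mem_Icc.1 hk).1 hh
      (I.φ (R.st k h ω) (R.act k h ω))
    refine h2.trans (le_of_eq ?_)
    rw [weightedNorm, Real.sq_sqrt (dotProduct_inv_mulVec_nonneg (gram_posDef hlam0 _ _) _)]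
    rfl
  refine (Finset.sum_le_sum h1).trans ?_
  rw [← Finset.mul_sum]
  refine mul_le_mul_of_nonneg_left ?_ (Real.exp_pos _).le
  refine (sum_dotProduct_inv_seqGram_le (by rw [hlam])
    (visited_dotProduct_le hφ h) K).trans (mul_le_mul_of_nonneg_left ?_ two_pos.le)
  have h3 := log_det_gram_sub_le (K := K) (k := K + 1) (I := I) (st := fun k h => R.st k h ω)
    (act := fun k h => R.act k h ω) hφ hlam0 (by omega) le_rfl h
  rw [hlam, mul_one] at h3
  rw [hlam]
  rw [gram_eq_seqGram, gram_eq_seqGram, hlam] at h3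
  exact h3

lemma Run.norm_planned_le (k h : ℕ) (hk : k ∈ Finset.Icc 1 K) (hh : h ∈ Finset.Icc 1 M.H) (ω : Ω) :
    ‖R.ξ (R.planEpisode k ω) h ω‖ ≤ M.H * √(m * d) := by
  obtain ⟨θ, ⟨-, h1⟩, -⟩ := R.planned k hk h hh ω
  exact h1

lemma Run.planEpisode_mem {k : ℕ} (hk : k ∈ Finset.Icc 1 K) (ω : Ω) :
    R.planEpisode k ω ∈ Finset.Icc 1 K := by
  have h1 := Finset.mem_Icc.1 hk
  have h2 := Finset.mem_Icc.1 (kTilde_mem_Icc (M := M) (I := I) (st := fun k h => R.st k h ω)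
    (act := fun k h => R.act k h ω) h1.1)
  exact Finset.mem_Icc.2 ⟨h2.1, h2.2.trans h1.2⟩

lemma Run.regret_le_horizon (ω : Ω) : R.regret ω ≤ K * M.H := by
  refine (Finset.sum_le_sum (g := fun _ => (M.H : ℝ)) fun k _ => ?_).trans (by simp)
  have h1 := optValue_mem M le_rfl (R.st k 1 ω) (R.ctx k ω)
  have h2 := value_mem M (R.pol k ω) le_rfl (R.st k 1 ω) (R.ctx k ω)
  linarith [h1.2, h2.1]

lemma Run.regret_eq_zero_of_reward_eq_zero (hr : ∀ h ∈ Finset.Icc 1 M.H, ∀ s a w, M.r h s a w = 0)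
    (ω : Ω) : R.regret ω = 0 := by
  have hv : ∀ π s w, M.value π 1 s w = 0 := by
    intro π s w
    refine Finset.sum_eq_zero fun i hi => ?_
    have hmem : 1 + i ∈ Finset.Icc 1 M.H := by
      simp only [Finset.mem_range, Finset.mem_Icc] at hi ⊢; omega
    simp [hr _ hmem]
  refine Finset.sum_eq_zero fun k _ => ?_
  simp [ContextualMDP.optValue, hv]

lemma Run.planningCalls_le (hφ : ∀ s a, ‖I.φ s a‖ ≤ 1) (hlam : 0 < I.lam) (ω : Ω) :
    (R.planningCalls ω : ℝ) ≤ d * M.H * Real.log (1 + K / (d * I.lam)) :=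
  LifelongRL.planningCalls_le hφ hlam K

end RunRegret

/-! ### Degenerate parameters -/

section Degenerate

variable {S A W : Type*} [MeasurableSpace S] [MeasurableSpace A] [MeasurableSpace W]
  {d m n : ℕ} {M : ContextualMDP S A W}
  {φ : S → A → EuclideanSpace ℝ (Fin d)} {ψ : S → A → W → EuclideanSpace ℝ (Fin d × Fin m)}
  {ρ : W → EuclideanSpace ℝ (Fin m)} {wref : Fin n → W} {L : ℝ}

lemma nonneg_of_isMapping [Nonempty W] (hmap : IsMapping φ ψ ρ wref L) : 0 ≤ L := by
  obtain ⟨c, -, hc⟩ := hmap.2.2 (Classical.arbitrary W)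
  exact (Finset.sum_nonneg fun _ _ => abs_nonneg _).trans hc

/-- Take a reference context for which `‖ρ‖` is largest. Expanding its `ρ` in the reference contexts
bounds this norm by `L` times itself, so it is zero when `L < 1`. -/
lemma eq_zero_of_isMapping_of_lt_one (hmap : IsMapping φ ψ ρ wref L) (hL : L < 1) (w : W) :
    ρ w = 0 := by
  have href : ∀ j, ρ (wref j) = 0 := by
    intro j₀
    have : Nonempty (Fin n) := ⟨j₀⟩
    obtain ⟨j, -, hj⟩ := Finset.exists_max_image Finset.univ (fun j => ‖ρ (wref j)‖)
      Finset.univ_nonempty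
    obtain ⟨c, hc, hcL⟩ := hmap.2.2 (wref j)
    have h1 : ‖ρ (wref j)‖ ≤ L * ‖ρ (wref j)‖ := by
      calc ‖ρ (wref j)‖ = ‖∑ i, c i • ρ (wref i)‖ := by rw [← hc]
        _ ≤ ∑ i, ‖c i • ρ (wref i)‖ := norm_sum_le _ _
        _ ≤ ∑ i, |c i| * ‖ρ (wref j)‖ := Finset.sum_le_sum fun i _ => by
            rw [norm_smul, Real.norm_eq_abs]
            exact mul_le_mul_of_nonneg_left (hj i (Finset.mem_univ i)) (abs_nonneg _)
        _ = (∑ i, |c i|) * ‖ρ (wref j)‖ := by rw [Finset.sum_mul]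
        _ ≤ L * ‖ρ (wref j)‖ := mul_le_mul_of_nonneg_right hcL (norm_nonneg _)
    have h2 : ‖ρ (wref j)‖ = 0 := by
      have := norm_nonneg (ρ (wref j))
      by_contra h0
      have : 0 < ‖ρ (wref j)‖ := lt_of_le_of_ne this (Ne.symm h0)
      nlinarith
    exact norm_le_zero_iff.1 ((hj j₀ (Finset.mem_univ j₀)).trans h2.le)
  obtain ⟨c, hc, -⟩ := hmap.2.2 w
  rw [hc]
  exact Finset.sum_eq_zero fun j _ => by rw [href j, smul_zero]

lemma reward_eq_zero_of_isMapping (hb : IsBoundedLinearMDP M φ ψ)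
    (hmap : IsMapping φ ψ ρ wref L) (hL : L < 1) {h : ℕ} (hh : h ∈ Finset.Icc 1 M.H) (s : S)
    (a : A) (w : W) : M.r h s a w = 0 := by
  obtain ⟨η, -, -, -, hr, -, -⟩ := hb.2.2 h hh
  rw [hr, hmap.1, eq_zero_of_isMapping_of_lt_one hmap hL, inner_kron]
  simp

/-- With `d = 0` the linear formula would give the transition law total mass 0. -/
lemma dim_pos_of_isBoundedLinearMDP [Nonempty S] [Nonempty A] (hb : IsBoundedLinearMDP M φ ψ)
    (hH : 0 < M.H) : 0 < d := by
  rcases Nat.eq_zero_or_pos d with rfl | hd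
  · obtain ⟨η, μ, -, hP, -⟩ := hb.2.2 1 (Finset.mem_Icc.2 (by omega))
    have h1 := hP (Classical.arbitrary S) (Classical.arbitrary A) Set.univ MeasurableSet.univ
    simp at h1
  · exact hd

end Degenerate

/-! ### Numerical choices: grid size, confidence radius and constants -/

section Numerics

/-- The exponent 44 comes from `N ≤ 2 Z ^ 20`, which gives `2 N² + 1 ≤ 16 Z ^ 40`, and from `16 ≤ Z
^ 4`. The extra 1 beside `44 * D` pays for the number `a` of episodes, steps and reference contexts.
-/
lemma net_card_mul_exp_le {Z δ a : ℝ} {N D : ℕ} (hZ : 2 ≤ Z) (hN : N = ⌈Z ^ 20⌉₊)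
    (ha : a ≤ δ * Z) (ha0 : 0 ≤ a) :
    a * (2 * (N : ℝ) ^ 2 + 1) ^ D * Real.exp (-((44 * D + 1) * Real.log Z)) ≤ δ := by
  have hZ0 : 0 < Z := by linarith
  have hZ20 : 1 ≤ Z ^ 20 := one_le_pow₀ (by linarith)
  have hNle : (N : ℝ) ≤ 2 * Z ^ 20 := by
    rw [hN]
    have := (Nat.ceil_lt_add_one (show 0 ≤ Z ^ 20 by positivity)).le
    linarith
  have h4 : 2 ^ 4 ≤ Z ^ 4 := pow_le_pow_left₀ (by norm_num) hZ 4
  have h1 : 2 * (N : ℝ) ^ 2 + 1 ≤ Z ^ 44 := by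
    have h2 : (N : ℝ) ^ 2 ≤ (2 * Z ^ 20) ^ 2 := pow_le_pow_left₀ (Nat.cast_nonneg _) hNle 2
    have h3 : (1 : ℝ) ≤ (Z ^ 20) ^ 2 := one_le_pow₀ hZ20
    calc 2 * (N : ℝ) ^ 2 + 1 ≤ 16 * (Z ^ 20) ^ 2 := by nlinarith
      _ ≤ Z ^ 4 * (Z ^ 20) ^ 2 := by gcongr; linarith
      _ = Z ^ 44 := by ring
  have h2 : Real.exp (-((44 * D + 1) * Real.log Z)) = (Z ^ (44 * D + 1))⁻¹ := by
    rw [Real.exp_neg, ← Real.rpow_natCast, Real.rpow_def_of_pos hZ0, mul_comm]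
    push_cast
    rfl
  rw [h2, ← div_eq_mul_inv, div_le_iff₀ (by positivity)]
  calc a * (2 * (N : ℝ) ^ 2 + 1) ^ D ≤ a * (Z ^ 44) ^ D := by gcongr
    _ ≤ δ * Z * (Z ^ 44) ^ D := by gcongr
    _ = δ * Z ^ (44 * D + 1) := by ring

lemma net_error_le {Z K d m H ε b B : ℝ} {N : ℕ} (hZ : 2 ≤ Z) (hN : N = ⌈Z ^ 20⌉₊)
    (hK : 1 ≤ K) (hd : 1 ≤ d) (hm : 1 ≤ m) (hH : 1 ≤ H) (hKd : K * H * (m * d) ≤ Z)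
    (hB : B = 4 * (K + d)) (hε : ε = 1 / N) (hb : b = d * m * ε + √(d ^ 2 * ε)) :
    K * (B * (2 * b) + d * ε * H + H ^ 2 / 8 * (d * ε * (2 * B + d * ε))) ≤ 1 := by
  have hZ0 : 0 < Z := by linarith
  have hmd : 1 ≤ m * d := one_le_mul_of_one_le_of_one_le hm hd
  have hKH : 1 ≤ K * H := one_le_mul_of_one_le_of_one_le hK hH
  have hKHZ : K * H ≤ Z := (le_mul_of_one_le_right (by linarith) hmd).trans hKd
  have hmdZ : m * d ≤ Z := (le_mul_of_one_le_left (by linarith) hKH).trans hKd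
  have hKZ : K ≤ Z := (le_mul_of_one_le_right (by linarith) hH).trans hKHZ
  have hHZ : H ≤ Z := (le_mul_of_one_le_left (by linarith) hK).trans hKHZ
  have hdZ : d ≤ Z := (le_mul_of_one_le_left (by linarith) hm).trans hmdZ
  -- Every parameter is at most a multiple of `Z`, while `ε ≤ t ^ 20`. The tightest term carries
  -- `√(d² ε) ≤ t ^ 9` against two powers of `Z`, and `t ≤ 1/2` then gives `32 t ^ 7 ≤ 1/4`.
  set t := 1 / Z with ht
  have ht0 : 0 < t := by positivity
  have htZ : Z * t = 1 := by rw [ht]; field_simp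
  have ht2 : t ≤ 1 / 2 := one_div_le_one_div_of_le two_pos hZ
  have hεt : ε ≤ t ^ 20 := by
    rw [hε, ht, one_div_pow]
    exact one_div_le_one_div_of_le (by positivity) (hN ▸ Nat.le_ceil _)
  have hε0 : 0 ≤ ε := by rw [hε]; positivity
  have hdε : d * ε ≤ t ^ 19 := by
    calc d * ε ≤ Z * t ^ 20 := by gcongr
      _ = (Z * t) * t ^ 19 := by ring
      _ = t ^ 19 := by rw [htZ, one_mul]
  have hbt : b ≤ 2 * t ^ 9 := by
    have h1 : d * m * ε ≤ t ^ 9 := by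
      calc d * m * ε ≤ Z * t ^ 20 := by rw [mul_comm d m]; gcongr
        _ = (Z * t) * t ^ 19 := by ring
        _ = t ^ 19 := by rw [htZ, one_mul]
        _ ≤ t ^ 9 := pow_le_pow_of_le_one ht0.le (by linarith) (by norm_num)
    have h2 : √(d ^ 2 * ε) ≤ t ^ 9 := by
      rw [Real.sqrt_le_left (by positivity)]
      calc d ^ 2 * ε ≤ Z ^ 2 * t ^ 20 := by gcongr
        _ = (Z * t) ^ 2 * t ^ 18 := by ring
        _ = (t ^ 9) ^ 2 := by rw [htZ]; ring
    rw [hb]; linarith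
  have hb0 : 0 ≤ b := by rw [hb]; positivity
  have hB0 : 0 ≤ B := by rw [hB]; positivity
  have hBZ : B ≤ 8 * Z := by rw [hB]; linarith
  have hpow : ∀ j : ℕ, t ^ j ≤ (1 / 2) ^ j := fun j => pow_le_pow_left₀ ht0.le ht2 j
  have e1 : K * (B * (2 * b)) ≤ 1 / 4 := by
    calc K * (B * (2 * b)) ≤ Z * ((8 * Z) * (2 * (2 * t ^ 9))) := by gcongr
      _ = 32 * (Z * t) ^ 2 * t ^ 7 := by ring
      _ ≤ 32 * 1 ^ 2 * (1 / 2) ^ 7 := by rw [htZ]; gcongr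
      _ = 1 / 4 := by norm_num
  have e2 : K * (d * ε * H) ≤ 1 / 4 := by
    calc K * (d * ε * H) ≤ Z * (t ^ 19 * Z) := by gcongr
      _ = (Z * t) ^ 2 * t ^ 17 := by ring
      _ ≤ 1 ^ 2 * (1 / 2) ^ 17 := by rw [htZ]; gcongr
      _ ≤ 1 / 4 := by norm_num
  have e3 : K * (H ^ 2 / 8 * (d * ε * (2 * B + d * ε))) ≤ 1 / 4 := by
    have h1 : d * ε ≤ Z := hdε.trans ((pow_le_one₀ ht0.le (by linarith)).trans (by linarith))
    calc K * (H ^ 2 / 8 * (d * ε * (2 * B + d * ε)))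
        ≤ Z * (Z ^ 2 / 8 * (t ^ 19 * (2 * (8 * Z) + Z))) := by gcongr
      _ = 17 / 8 * (Z * t) ^ 4 * t ^ 15 := by ring
      _ ≤ 17 / 8 * 1 ^ 4 * (1 / 2) ^ 15 := by rw [htZ]; gcongr
      _ ≤ 1 / 4 := by norm_num
  linarith

/-- The hypothesis `L ≤ K` bounds the squared bonus coefficient by a power of `Z`, which does not
otherwise involve `L`. -/
lemma net_range_le {Z K d m H L β : ℝ} {N : ℕ} (hZ : 2 ≤ Z) (hN : N = ⌈Z ^ 20⌉₊)
    (hK : 1 ≤ K) (hd : 1 ≤ d) (hm : 1 ≤ m) (hH : 1 ≤ H) (hKd : K * H * (m * d) ≤ Z)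
    (hL0 : 0 ≤ L) (hLK : L ≤ K)
    (hβ : β = 16 * H * (d + √(m * d)) * √(Real.log Z)) :
    4 * (K + d) ≤ N ∧ (H + 1) * √(m * d) ≤ N ∧ (2 * L * β) ^ 2 ≤ N := by
  have hZ0 : 0 < Z := by linarith
  have hmd : 1 ≤ m * d := one_le_mul_of_one_le_of_one_le hm hd
  have hKH : 1 ≤ K * H := one_le_mul_of_one_le_of_one_le hK hH
  have hKHZ : K * H ≤ Z := (le_mul_of_one_le_right (by linarith) hmd).trans hKd
  have hmdZ : m * d ≤ Z := (le_mul_of_one_le_left (by linarith) hKH).trans hKd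
  have hKZ : K ≤ Z := (le_mul_of_one_le_right (by linarith) hH).trans hKHZ
  have hdmd : d ≤ m * d := le_mul_of_one_le_left (by linarith) hm
  have hdZ : d ≤ Z := hdmd.trans hmdZ
  have hNZ : Z ^ 20 ≤ N := hN ▸ Nat.le_ceil _
  have hsq : √(m * d) ≤ m * d := by
    rw [Real.sqrt_le_left (by linarith)]
    nlinarith
  have hpow : ∀ j : ℕ, (2 : ℝ) ^ j ≤ Z ^ j := fun j => pow_le_pow_left₀ two_pos.le hZ j
  have h16 : 16 * Z ≤ Z ^ 20 := by
    calc 16 * Z ≤ Z ^ 19 * Z := by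
          gcongr
          calc (16 : ℝ) ≤ 2 ^ 19 := by norm_num
            _ ≤ Z ^ 19 := hpow 19
      _ = Z ^ 20 := by ring
  refine ⟨by linarith, ?_, ?_⟩
  · have h1 : H * (m * d) ≤ Z := by
      refine le_trans ?_ hKd
      rw [mul_assoc]
      exact le_mul_of_one_le_left (by positivity) hK
    calc (H + 1) * √(m * d) ≤ (H + H) * (m * d) := by gcongr
      _ = 2 * (H * (m * d)) := by ring
      _ ≤ N := by linarith
  · have hlog : Real.log Z ≤ Z := (Real.log_le_sub_one_of_pos hZ0).trans (by linarith)
    have hlog0 : 0 ≤ Real.log Z := Real.log_nonneg (by linarith)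
    calc (2 * L * β) ^ 2
        = 1024 * (L * H * (d + √(m * d))) ^ 2 * √(Real.log Z) ^ 2 := by rw [hβ]; ring
      _ ≤ 1024 * (K * H * (m * d + m * d)) ^ 2 * Z := by
          rw [Real.sq_sqrt hlog0]
          gcongr
      _ = 4096 * (K * H * (m * d)) ^ 2 * Z := by ring
      _ ≤ 4096 * Z ^ 2 * Z := by gcongr
      _ = 2 ^ 12 * Z ^ 3 := by ring
      _ ≤ Z ^ 12 * Z ^ 3 := by gcongr
      _ = Z ^ 15 := by ring
      _ ≤ Z ^ 20 := pow_le_pow_right₀ (by linarith) (by norm_num)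
      _ ≤ N := hNZ

lemma half_le_log_two : (1 / 2 : ℝ) ≤ Real.log 2 := by
  linarith [Real.log_two_gt_d9]

/-- `(d + √(md))²` dominates `d² + md`, the order of the number of grid coordinates; the factor `16²
= 256` leaves room for 44 per coordinate and for the lower-order terms. -/
lemma confidence_radius_ge {Z d m H β : ℝ} (hZ : 2 ≤ Z) (hd : 1 ≤ d) (hm : 1 ≤ m)
    (hβ : β = 16 * H * (d + √(m * d)) * √(Real.log Z)) :
    4 * H ^ 2 * d + H ^ 2 * ((44 * (d + d * m + d ^ 2) + 1) * Real.log Z + 1) ≤ β ^ 2 := by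
  have hlog : 1 / 2 ≤ Real.log Z :=
    half_le_log_two.trans (Real.log_le_log two_pos hZ)
  set ℓ := Real.log Z
  have hmd : 0 ≤ m * d := by positivity
  have hs := Real.sqrt_nonneg (m * d)
  have h1 : d ^ 2 + m * d ≤ (d + √(m * d)) ^ 2 := by
    nlinarith [Real.sq_sqrt hmd]
  have h2 : β ^ 2 = 256 * H ^ 2 * (d + √(m * d)) ^ 2 * ℓ := by
    rw [hβ]
    have := Real.sq_sqrt (show 0 ≤ ℓ by linarith)
    calc (16 * H * (d + √(m * d)) * √ℓ) ^ 2
        = 256 * H ^ 2 * (d + √(m * d)) ^ 2 * √ℓ ^ 2 := by ring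
      _ = _ := by rw [this]
  have hdd : d ≤ d ^ 2 := by nlinarith
  have h1d : 1 ≤ d ^ 2 := by nlinarith
  have hmd0 : 0 ≤ d * m := by positivity
  have h3 : 4 * d + ((44 * (d + d * m + d ^ 2) + 1) * ℓ + 1)
      ≤ 256 * (d ^ 2 + m * d) * ℓ := by
    have h4 : 4 * d + 1 ≤ 10 * d ^ 2 * ℓ := by
      nlinarith [mul_le_mul_of_nonneg_left hlog (show 0 ≤ 10 * d ^ 2 by positivity)]
    have h5 : (44 * (d + d * m + d ^ 2) + 1) * ℓ ≤ (89 * d ^ 2 + 44 * (d * m)) * ℓ := by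
      refine mul_le_mul_of_nonneg_right ?_ (by linarith)
      linarith
    have h6 : 0 ≤ d * m * ℓ := by positivity
    have h7 : 0 ≤ d ^ 2 * ℓ := by positivity
    nlinarith
  calc _ = H ^ 2 * (4 * d + ((44 * (d + d * m + d ^ 2) + 1) * ℓ + 1)) := by ring
    _ ≤ H ^ 2 * (256 * (d ^ 2 + m * d) * ℓ) := by gcongr
    _ ≤ H ^ 2 * (256 * (d + √(m * d)) ^ 2 * ℓ) := by gcongr
    _ = β ^ 2 := by rw [h2]; ring

/-- For `K ≥ 3`, `1 + K / d ≤ 4 K / 3` and `log K ≥ 1` give `log (1 + K / d) ≤ (4/3) log K`; with `e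
≤ 3` the constants combine to exactly 8. -/
lemma elliptical_sqrt_le {K d : ℝ} (hK : 3 ≤ K) (hd : 1 ≤ d) :
    √(K * (Real.exp 1 * (2 * (d * Real.log (1 + K / d))))) ≤ 2 * √(2 * d * K * Real.log K) := by
  have hlogK : 1 ≤ Real.log K := by
    rw [Real.le_log_iff_exp_le (by linarith)]
    linarith [Real.exp_one_lt_d9]
  have h1 : Real.log (1 + K / d) ≤ 4 / 3 * Real.log K := by
    have h2 : 1 + K / d ≤ K * (4 / 3) := by
      have := div_le_self (show 0 ≤ K by linarith) hd
      linarith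
    have h3 := Real.log_le_log (by positivity) h2
    rw [Real.log_mul (by linarith) (by norm_num)] at h3
    have h4 := Real.log_le_sub_one_of_pos (show (0 : ℝ) < 4 / 3 by norm_num)
    linarith
  rw [show (2 : ℝ) = √4 by rw [show (4 : ℝ) = 2 ^ 2 by norm_num]; simp]
  rw [← Real.sqrt_mul (by norm_num)]
  refine Real.sqrt_le_sqrt ?_
  rw [show √4 = (2 : ℝ) by rw [show (4 : ℝ) = 2 ^ 2 by norm_num]; simp]
  have he : Real.exp 1 ≤ 3 := by linarith [Real.exp_one_lt_d9]
  have hl0 : 0 ≤ Real.log (1 + K / d) := Real.log_nonneg (by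
    have : 0 ≤ K / d := by positivity
    linarith)
  calc K * (Real.exp 1 * (2 * (d * Real.log (1 + K / d))))
      ≤ K * (3 * (2 * (d * (4 / 3 * Real.log K)))) := by gcongr
    _ = _ := by ring

lemma bound_le_bound {K d m H L δ T β Z : ℝ} (hK : 1 ≤ K) (hd : 1 ≤ d) (hm : 1 ≤ m) (hH : 1 ≤ H)
    (hL : 1 ≤ L) (hδ0 : 0 < δ) (hδ : δ < 1 / 2) (hT : T = K * H) (hZ : Z = m * d * T / δ)
    (hβ : β = 16 * H * (d + √(m * d)) * √(Real.log Z)) :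
    2 * H * √(T * Real.log (d * T / δ)) + 8 * H * L * β * √(2 * d * K * Real.log K)
      ≤ 260 * L * √((d ^ 3 + m * d ^ 2) * H ^ 3 * T) * Real.log Z := by
  have hT1 : 1 ≤ T := by rw [hT]; exact one_le_mul_of_one_le_of_one_le hK hH
  have hdT : 1 ≤ d * T := one_le_mul_of_one_le_of_one_le hd hT1
  have h2 : 2 ≤ d * T / δ := by rw [le_div_iff₀ hδ0]; linarith
  have hdTZ : d * T / δ ≤ Z := by
    rw [hZ]
    gcongr
    exact le_mul_of_one_le_left (by positivity) hm
  have hKZ : K ≤ Z := by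
    refine le_trans ?_ hdTZ
    rw [le_div_iff₀ hδ0]
    have h3 : K ≤ d * T := by
      rw [hT]
      calc K ≤ K * H := le_mul_of_one_le_right (by linarith) hH
        _ ≤ d * (K * H) := le_mul_of_one_le_left (by positivity) hd
    nlinarith
  have hl1 : 1 / 2 ≤ Real.log (d * T / δ) := half_le_log_two.trans (Real.log_le_log two_pos h2)
  have hl2 : Real.log (d * T / δ) ≤ Real.log Z := Real.log_le_log (by linarith) hdTZ
  have hlK : Real.log K ≤ Real.log Z := Real.log_le_log (by linarith) hKZ
  have hlK0 : 0 ≤ Real.log K := Real.log_nonneg hK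
  set ℓ := Real.log Z
  have hℓ : 0 < ℓ := by linarith
  set X := √((d ^ 3 + m * d ^ 2) * H ^ 3 * T) with hX
  have hX2 : X ^ 2 = (d ^ 3 + m * d ^ 2) * H ^ 4 * K := by
    rw [hX, Real.sq_sqrt (by positivity), hT]; ring
  have hX0 : 0 ≤ X := Real.sqrt_nonneg _
  have hd3 : 1 ≤ d ^ 3 := one_le_pow₀ hd
  have e1 : H * √(T * Real.log (d * T / δ)) ≤ X * (2 * ℓ) := by
    refine (abs_le_of_sq_le_sq' ?_ (by positivity)).2
    rw [mul_pow, Real.sq_sqrt (by positivity), mul_pow, hX2, hT]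
    have h3 : Real.log (d * (K * H) / δ) ≤ (2 * ℓ) ^ 2 := by rw [← hT]; nlinarith
    have h4 : 0 ≤ Real.log (d * (K * H) / δ) := by rw [← hT]; linarith
    calc H ^ 2 * (K * H * Real.log (d * (K * H) / δ))
        = H ^ 3 * K * Real.log (d * (K * H) / δ) := by ring
      _ ≤ H ^ 4 * K * (2 * ℓ) ^ 2 := by
          gcongr
          norm_num
      _ ≤ (d ^ 3 + m * d ^ 2) * (H ^ 4 * K * (2 * ℓ) ^ 2) :=
          le_mul_of_one_le_left (by positivity)
            (by linarith [show 0 ≤ m * d ^ 2 by positivity])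
      _ = _ := by ring
  have e2 : H ^ 2 * (d + √(m * d)) * √ℓ * √(2 * d * K * Real.log K) ≤ 2 * (X * ℓ) := by
    refine (abs_le_of_sq_le_sq' ?_ (by positivity)).2
    have hs := Real.sq_sqrt (show 0 ≤ m * d by positivity)
    have h3 : (d + √(m * d)) ^ 2 ≤ 2 * (d ^ 2 + m * d) := by
      nlinarith [sq_nonneg (d - √(m * d))]
    calc (H ^ 2 * (d + √(m * d)) * √ℓ * √(2 * d * K * Real.log K)) ^ 2
        = H ^ 4 * (d + √(m * d)) ^ 2 * √ℓ ^ 2 * √(2 * d * K * Real.log K) ^ 2 := by ring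
      _ = H ^ 4 * (d + √(m * d)) ^ 2 * ℓ * (2 * d * K * Real.log K) := by
          rw [Real.sq_sqrt hℓ.le, Real.sq_sqrt (by positivity)]
      _ ≤ H ^ 4 * (2 * (d ^ 2 + m * d)) * ℓ * (2 * d * K * ℓ) := by gcongr
      _ = (2 * ℓ) ^ 2 * ((d ^ 3 + m * d ^ 2) * H ^ 4 * K) := by ring
      _ = (2 * (X * ℓ)) ^ 2 := by rw [← hX2]; ring
  have hXl : X * ℓ ≤ L * (X * ℓ) := le_mul_of_one_le_left (by positivity) hL
  -- The constant 260 is `4 + 256`: `2 · 2` from the noise term and `128 · 2` from the exploration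
  -- term, where `128 = 8 · 16`.
  calc 2 * H * √(T * Real.log (d * T / δ)) + 8 * H * L * β * √(2 * d * K * Real.log K)
      = 2 * (H * √(T * Real.log (d * T / δ)))
        + 128 * L * (H ^ 2 * (d + √(m * d)) * √ℓ * √(2 * d * K * Real.log K)) := by rw [hβ]; ring
    _ ≤ 2 * (X * (2 * ℓ)) + 128 * L * (2 * (X * ℓ)) := by gcongr
    _ ≤ 260 * L * X * ℓ := by linarith

/-- For `K = 1` the factor `log K` kills the exploration term, so for small `K` the noise term alone
has to exceed the trivial bound. -/
lemma horizon_le_bound_of_le_two {K H l : ℝ} (hK0 : 0 ≤ K) (hK : K ≤ 2) (hH : 1 ≤ H)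
    (hl : 1 / 2 ≤ l) : K * H ≤ 2 * H * √(K * H * l) := by
  have h1 : K ≤ 2 * √(K * H * l) := by
    rw [← Real.sqrt_sq hK0, show (2 : ℝ) = √4 by
      rw [show (4 : ℝ) = 2 ^ 2 by norm_num]; simp, ← Real.sqrt_mul (by norm_num)]
    refine Real.sqrt_le_sqrt ?_
    rw [Real.sqrt_sq hK0]
    have h2 : 1 / 2 ≤ H * l := by nlinarith
    nlinarith
  nlinarith

/-- When `K ≤ L` the exploration term already exceeds `KH`, its other factors being at least 1.
Disposing of this case is what permits the assumption `L ≤ K` in the choice of the grid. -/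
lemma horizon_le_bound_of_le {K d m H L Z β : ℝ} (hK : 3 ≤ K) (hd : 1 ≤ d) (hH : 1 ≤ H)
    (hLK : K ≤ L) (hZ : 2 ≤ Z)
    (hβ : β = 16 * H * (d + √(m * d)) * √(Real.log Z)) :
    K * H ≤ 8 * H * L * β * √(2 * d * K * Real.log K) := by
  have hlog : 1 / 2 ≤ Real.log Z := half_le_log_two.trans (Real.log_le_log two_pos hZ)
  have hsl : 1 / 2 ≤ √(Real.log Z) := Real.le_sqrt_of_sq_le (by linarith)
  have hlogK : 1 ≤ Real.log K := by
    rw [Real.le_log_iff_exp_le (by linarith)]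
    linarith [Real.exp_one_lt_d9]
  have h1 : 1 ≤ √(2 * d * K * Real.log K) := by
    rw [Real.one_le_sqrt]
    have : 1 ≤ d * K := by nlinarith
    nlinarith
  have hb : 1 ≤ β := by
    rw [hβ]
    have h2 : 1 ≤ d + √(m * d) := by linarith [Real.sqrt_nonneg (m * d)]
    have h3 : 1 ≤ H * (d + √(m * d)) := one_le_mul_of_one_le_of_one_le hH h2
    nlinarith
  have h2 : 1 ≤ β * √(2 * d * K * Real.log K) := one_le_mul_of_one_le_of_one_le hb h1
  have h3 : K * H ≤ H * L := by nlinarith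
  have h4 : 0 ≤ H * L := by nlinarith
  calc K * H ≤ H * L := h3
    _ ≤ (8 * (H * L)) * 1 := by linarith
    _ ≤ (8 * (H * L)) * (β * √(2 * d * K * Real.log K)) := by gcongr
    _ = _ := by ring

end Numerics

/-! ### The high-probability regret bound -/

section HighProbability

variable {S A W : Type*} [MeasurableSpace S] [MeasurableSpace A] [MeasurableSpace W]
  [Nonempty A] [Finite A] [MeasurableSingletonClass A]
  {d m n : ℕ} {M : ContextualMDP S A W} {I : Params S A W d m n} {K : ℕ}
  {Ω : Type*} [mΩ : MeasurableSpace Ω] {μ : Measure Ω} (R : Run M I K μ)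

lemma one_sub_le_measureReal_of_compl [IsProbabilityMeasure μ] {s t u : Set Ω} {δ : ℝ}
    (hδ : 0 ≤ δ) (hs : μ s ≤ ENNReal.ofReal δ) (ht : μ t ≤ ENNReal.ofReal δ)
    (hu : ∀ ω, ω ∉ s → ω ∉ t → ω ∈ u) : 1 - 2 * δ ≤ μ.real u := by
  have h1 : Set.univ ⊆ u ∪ (s ∪ t) := fun ω _ => by
    by_cases h : ω ∈ s
    · exact Or.inr (Or.inl h)
    by_cases h' : ω ∈ t
    · exact Or.inr (Or.inr h')
    exact Or.inl (hu ω h h')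
  have h2 := (measureReal_mono (μ := μ) h1).trans
    ((measureReal_union_le _ _).trans (add_le_add le_rfl (measureReal_union_le _ _)))
  have h3 : μ.real s ≤ δ := ENNReal.toReal_le_of_le_ofReal hδ hs
  have h4 : μ.real t ≤ δ := ENNReal.toReal_le_of_le_ofReal hδ ht
  rw [probReal_univ] at h2
  linarith

lemma Run.measure_noise_gt_le [IsProbabilityMeasure μ]
    (hφ : Measurable fun x : S × A => I.φ x.1 x.2)
    (hψ : Measurable fun x : S × A × W => I.ψ x.1 x.2.1 x.2.2) (hK : 0 < K) (hH : 0 < M.H)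
    {l : ℝ} (hl : 0 < l) :
    μ {ω | 2 * M.H * √(K * M.H * l)
        < ∑ k ∈ Finset.Icc 1 K, ∑ h ∈ Finset.Icc 1 M.H, R.noise k h ω}
      ≤ ENNReal.ofReal (Real.exp (-l)) := by
  have hK' : (0 : ℝ) < K := by exact_mod_cast hK
  have hH' : (0 : ℝ) < M.H := by exact_mod_cast hH
  set T : ℝ := K * M.H with hT
  have hT0 : 0 < T := by positivity
  -- With this `t` the compensator is `l / 2`, and on the event the linear term is at least `2l`,
  -- which leaves more than the required `l`.
  set t := √(l / T) / M.H with ht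
  have ht0 : 0 < t := by positivity
  refine (measure_mono fun ω hω => ?_).trans (R.measure_gap_noise_ge_le hφ hψ t l)
  rw [Set.mem_ofPred_eq] at hω ⊢
  have hsum : ∑ k ∈ Finset.Icc 1 K, ∑ h ∈ Finset.Icc 1 M.H,
      (t * (∫ s', R.gap k (h + 1) ω s' ∂(M.P h (R.st k h ω, R.act k h ω))
        - R.gap k (h + 1) ω (R.st k (h + 1) ω)) - t ^ 2 * (M.H : ℝ) ^ 2 / 2)
      = t * (∑ k ∈ Finset.Icc 1 K, ∑ h ∈ Finset.Icc 1 M.H, R.noise k h ω)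
        - T * (t ^ 2 * (M.H : ℝ) ^ 2 / 2) := by
    change ∑ k ∈ Finset.Icc 1 K, ∑ h ∈ Finset.Icc 1 M.H,
      (t * R.noise k h ω - t ^ 2 * (M.H : ℝ) ^ 2 / 2) = _
    simp only [Finset.sum_sub_distrib, ← Finset.mul_sum, Finset.sum_const, Nat.card_Icc,
      nsmul_eq_mul, add_tsub_cancel_right]
    rw [hT]
    ring
  rw [hsum]
  have h1 : t ^ 2 * (M.H : ℝ) ^ 2 = l / T := by
    rw [ht, div_pow, Real.sq_sqrt (by positivity)]
    field_simp
  have h2 : t * (2 * M.H * √(T * l)) = 2 * l := by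
    have h3 : √(l / T) * √(T * l) = l := by
      rw [← Real.sqrt_mul (by positivity), show l / T * (T * l) = l ^ 2 by field_simp,
        Real.sqrt_sq hl.le]
    calc t * (2 * M.H * √(T * l)) = 2 * (√(l / T) * √(T * l)) := by rw [ht]; field_simp
      _ = 2 * l := by rw [h3]
  have h3 := mul_le_mul_of_nonneg_left hω.le ht0.le
  have h4 : T * (l / T / 2) = l / 2 := by field_simp
  rw [h1, h4]
  linarith

lemma Run.isAccurate_of_not_netExceeds (hφ : Measurable fun x : S × A => I.φ x.1 x.2)
    (hψ : Measurable fun x : S × A × W => I.ψ x.1 x.2.1 x.2.2)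
    (hb : IsBoundedLinearMDP M I.φ I.ψ) (hc : IsBackupComplete M I.φ I.ψ)
    {ρ : W → EuclideanSpace ℝ (Fin m)} (hmap : IsMapping I.φ I.ψ ρ I.wref I.L)
    (hD : IsFeatureBasis I.φ I.D) (hlam : I.lam = 1) (hL : 0 ≤ I.L) (hLK : I.L ≤ K)
    {Z : ℝ} (hZ : 2 ≤ Z) (hK : 0 < K) (hd : 0 < d) (hm : 0 < m) (hH : 0 < M.H)
    (hKZ : (K : ℝ) * M.H * (m * d) ≤ Z)
    (hβ : I.β = 16 * M.H * (d + √(m * d)) * √(Real.log Z)) {ω : Ω}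
    (hω : ¬ R.netExceeds ⌈Z ^ 20⌉₊ ((44 * (d + d * m + d ^ 2 : ℕ) + 1) * Real.log Z) ω)
    {k h : ℕ} (hk : k ∈ Finset.Icc 1 K) (hh : h ∈ Finset.Icc 1 M.H) :
    IsAccurate M I (fun k h => R.st k h ω) (fun k h => R.act k h ω) (fun k h => R.ξ k h ω)
      (R.planEpisode k ω) h := by
  have hK1 : (1 : ℝ) ≤ K := by exact_mod_cast hK
  have hd1 : (1 : ℝ) ≤ d := by exact_mod_cast hd
  have hm1 : (1 : ℝ) ≤ m := by exact_mod_cast hm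
  have hH1 : (1 : ℝ) ≤ M.H := by exact_mod_cast hH
  have hβ0 : 0 ≤ I.β := by rw [hβ]; positivity
  obtain ⟨hr1, hr2, hr3⟩ := net_range_le hZ rfl hK1 hd1 hm1 hH1 hKZ hL hLK hβ
  have hN : 0 < ⌈Z ^ 20⌉₊ := Nat.ceil_pos.2 (by positivity)
  have hrad := confidence_radius_ge hZ hd1 hm1 hβ
  intro s a w
  refine abs_inner_sub_backup_le hφ hψ hb hc hmap hD (by rw [hlam]; exact one_pos) hβ0 hh
    (R.planned k hk h hh ω) (fun j θ hθ hθP => ?_) s a w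
  refine R.weightedNorm_thetaTilde_sub_le hφ hψ hb hlam hL hβ0 hN rfl rfl rfl hr1 hr2 hr3
    (net_error_le hZ rfl hK1 hd1 hm1 hH1 hKZ rfl rfl rfl) ?_ hω (R.planEpisode_mem hk ω) hh
    (fun h hh => R.norm_planned_le k h hk hh ω) j hθ hθP
  push_cast
  exact hrad

lemma Run.one_sub_le_measureReal_regret_le [IsProbabilityMeasure μ]
    (hφ : Measurable fun x : S × A => I.φ x.1 x.2)
    (hψ : Measurable fun x : S × A × W => I.ψ x.1 x.2.1 x.2.2)
    (hb : IsBoundedLinearMDP M I.φ I.ψ) (hc : IsBackupComplete M I.φ I.ψ)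
    {ρ : W → EuclideanSpace ℝ (Fin m)} (hmap : IsMapping I.φ I.ψ ρ I.wref I.L)
    (hD : IsFeatureBasis I.φ I.D) (hlam : I.lam = 1) (hL : 0 ≤ I.L) {δ T Z : ℝ} (hδ0 : 0 < δ)
    (hδ : δ < 1 / 2) (hK : 0 < K) (hd : 0 < d) (hm : 0 < m) (hH : 0 < M.H) (hT : T = K * M.H)
    (hZ : Z = m * d * T / δ) (hβ : I.β = 16 * M.H * (d + √(m * d)) * √(Real.log Z)) :
    1 - 2 * δ ≤ μ.real {ω | R.regret ω ≤ 2 * M.H * √(T * Real.log (d * T / δ))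
      + 8 * M.H * I.L * I.β * √(2 * d * K * Real.log K)} := by
  have hK1 : (1 : ℝ) ≤ K := by exact_mod_cast hK
  have hd1 : (1 : ℝ) ≤ d := by exact_mod_cast hd
  have hm1 : (1 : ℝ) ≤ m := by exact_mod_cast hm
  have hH1 : (1 : ℝ) ≤ M.H := by exact_mod_cast hH
  have hT1 : 1 ≤ T := by rw [hT]; exact one_le_mul_of_one_le_of_one_le hK1 hH1
  have hdT : 1 ≤ d * T := one_le_mul_of_one_le_of_one_le hd1 hT1
  have h2 : 2 ≤ d * T / δ := by rw [le_div_iff₀ hδ0]; linarith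
  have hδZ : δ * Z = m * (d * T) := by rw [hZ]; field_simp
  have hmdT : 1 ≤ m * (d * T) := one_le_mul_of_one_le_of_one_le hm1 hdT
  have hZ2 : 2 ≤ Z := by
    rw [hZ, le_div_iff₀ hδ0, mul_assoc (m : ℝ)]
    linarith
  have hl : 1 / 2 ≤ Real.log (d * T / δ) := half_le_log_two.trans (Real.log_le_log two_pos h2)
  have hβ0 : 0 ≤ I.β := by rw [hβ]; positivity
  have htriv : (K : ℝ) * M.H ≤ 2 * M.H * √(T * Real.log (d * T / δ))
      + 8 * M.H * I.L * I.β * √(2 * d * K * Real.log K) →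
      1 - 2 * δ ≤ μ.real {ω | R.regret ω ≤ 2 * M.H * √(T * Real.log (d * T / δ))
      + 8 * M.H * I.L * I.β * √(2 * d * K * Real.log K)} := fun h =>
    one_sub_le_measureReal_of_compl (s := ∅) (t := ∅) hδ0.le (by simp) (by simp)
      fun ω _ _ => (R.regret_le_horizon ω).trans h
  have hfirst : 0 ≤ 2 * M.H * √(T * Real.log (d * T / δ)) := by positivity
  have hsecond : 0 ≤ 8 * M.H * I.L * I.β * √(2 * d * K * Real.log K) := by positivity
  rcases le_or_gt K 2 with hK2 | hK3
  · refine htriv ((horizon_le_bound_of_le_two (Nat.cast_nonneg K) (by exact_mod_cast hK2) hH1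
      hl).trans ?_)
    rw [← hT]
    linarith
  have hK3' : (3 : ℝ) ≤ K := by exact_mod_cast hK3
  rcases le_or_gt (K : ℝ) I.L with hLK | hLK
  · refine htriv ((horizon_le_bound_of_le hK3' hd1 hH1 hLK hZ2 hβ).trans ?_)
    linarith
  have hKZ : (K : ℝ) * M.H * (m * d) ≤ Z := by
    rw [← hT, hZ, le_div_iff₀ hδ0]
    nlinarith
  set r := (44 * (d + d * m + d ^ 2 : ℕ) + 1) * Real.log Z with hr
  refine one_sub_le_measureReal_of_compl (s := {ω | R.netExceeds ⌈Z ^ 20⌉₊ r ω})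
    (t := {ω | 2 * M.H * √(K * M.H * Real.log (d * T / δ))
        < ∑ k ∈ Finset.Icc 1 K, ∑ h ∈ Finset.Icc 1 M.H, R.noise k h ω}) hδ0.le ?_ ?_ ?_
  · refine (R.measure_netExceeds_le hφ hψ _ _).trans (ENNReal.ofReal_le_ofReal ?_)
    have hn : (n : ℝ) ≤ m := by exact_mod_cast hmap.2.1
    -- The number of triples `(k, h, j)` is `T n ≤ m d T = δ Z`, using `n ≤ m`.
    have := net_card_mul_exp_le (a := K * M.H * n) (δ := δ) (D := d + d * m + d ^ 2) hZ2 rfl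
      (by
        rw [hδZ, ← hT]
        calc T * n ≤ T * m := by gcongr
          _ = m * T := mul_comm _ _
          _ ≤ m * (d * T) := by gcongr; exact le_mul_of_one_le_left (by linarith) hd1)
      (by positivity)
    push_cast at this ⊢
    rw [hr]
    push_cast
    exact this
  · refine (R.measure_noise_gt_le hφ hψ hK hH (by linarith)).trans (ENNReal.ofReal_le_ofReal ?_)
    -- The noise event has probability at most `δ / (dT)`, more than is needed.
    rw [Real.exp_neg, Real.exp_log (by positivity), inv_div]
    exact div_le_self hδ0.le hdT
  · intro ω hω1 hω2
    rw [Set.mem_ofPred_eq] at hω1 hω2 ⊢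
    rw [not_lt, ← hT] at hω2
    have hreg := R.regret_le_width_add_noise hφ hψ (mul_nonneg hL hβ0) fun k hk h hh =>
      R.isAccurate_of_not_netExceeds hφ hψ hb hc hmap hD hlam hL hLK.le hZ2 hK hd hm hH hKZ hβ
        hω1 hk hh
    have hw : ∑ k ∈ Finset.Icc 1 K, ∑ h ∈ Finset.Icc 1 M.H, R.width k h ω
        ≤ M.H * (2 * √(2 * d * K * Real.log K)) := by
      rw [Finset.sum_comm]
      refine (Finset.sum_le_sum fun h hh => (R.sum_width_le hb.1 hlam hh ω).trans
        (elliptical_sqrt_le hK3' hd1)).trans (le_of_eq ?_)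
      simp
    have h3 := mul_le_mul_of_nonneg_left hw (show 0 ≤ 4 * (I.L * I.β) by positivity)
    calc R.regret ω ≤ _ := hreg
      _ ≤ 4 * (I.L * I.β) * (M.H * (2 * √(2 * d * K * Real.log K)))
          + 2 * M.H * √(T * Real.log (d * T / δ)) := add_le_add h3 hω2
      _ = _ := by ring

end HighProbability

end LifelongRL

/-! ### The theorem -/

open LifelongRL

theorem theorem2 :
    ∃ c C : ℝ, 0 < c ∧ 0 < C ∧
      ∀ (S A W : Type*) [MeasurableSpace S] [MeasurableSpace A] [MeasurableSpace W]
        [Finite A] [Nonempty A] [DiscreteMeasurableSpace A] (d m n : ℕ)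
        (M : ContextualMDP S A W)
        (φ : S → A → EuclideanSpace ℝ (Fin d))
        (ψ : S → A → W → EuclideanSpace ℝ (Fin d × Fin m))
        (ρ : W → EuclideanSpace ℝ (Fin m)) (wref : Fin n → W) (L : ℝ) (D : Finset (S × A)),
        0 < m →
        (Measurable fun x : S × A => φ x.1 x.2) →
        (Measurable fun x : S × A × W => ψ x.1 x.2.1 x.2.2) →
        IsBoundedLinearMDP M φ ψ →
        IsBackupComplete M φ ψ →
        IsMapping φ ψ ρ wref L →
        IsFeatureBasis φ D →
        -- the number of planning calls
        (∀ (K : ℕ) (lam β : ℝ), 0 < lam →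
          ∀ (Ω : Type*) [MeasurableSpace Ω] (μ : Measure Ω) [IsProbabilityMeasure μ]
            (R : Run M ⟨φ, ψ, wref, D, L, lam, β⟩ K μ) (ω : Ω),
            (R.planningCalls ω : ℝ) ≤ d * M.H * Real.log (1 + K / (d * lam))) ∧
        -- the regret
        (∀ (K : ℕ) (δ T β B E : ℝ), 0 < δ → δ < 1 / 2 →
          T = K * M.H →
          β = c * M.H * (d + Real.sqrt (m * d)) * Real.sqrt (Real.log (m * d * T / δ)) →
          B = 2 * M.H * Real.sqrt (T * Real.log (d * T / δ))
            + 8 * M.H * L * β * Real.sqrt (2 * d * K * Real.log K) →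
          E = C * L * Real.sqrt ((d ^ 3 + m * d ^ 2) * M.H ^ 3 * T)
            * Real.log (m * d * T / δ) →
          (1 ≤ L → B ≤ E) ∧
          ∀ (Ω : Type*) [MeasurableSpace Ω] (μ : Measure Ω) [IsProbabilityMeasure μ]
            (R : Run M ⟨φ, ψ, wref, D, L, 1, β⟩ K μ),
            1 - 2 * δ ≤ μ.real {ω | R.regret ω ≤ B ∧ R.regret ω ≤ E}) := by
  refine ⟨16, 260, by norm_num, by norm_num, ?_⟩
  intro S A W _ _ _ _ _ _ d m n M φ ψ ρ wref L D hm hφ hψ hb hc hmap hD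
  refine ⟨fun K lam β hlam Ω _ μ _ R ω => R.planningCalls_le hb.1 hlam ω, ?_⟩
  intro K δ T β B E hδ0 hδ hT hβ hB hE
  have hm1 : (1 : ℝ) ≤ m := by exact_mod_cast hm
  have hβ0 : 0 ≤ β := by rw [hβ]; positivity
  have hBE : 1 ≤ L → B ≤ E := by
    intro hL
    rw [hB, hE]
    rcases Nat.eq_zero_or_pos K with rfl | hK
    · simp [hT]
    rcases Nat.eq_zero_or_pos M.H with hH | hH
    · simp [hT, hH]
    rcases Nat.eq_zero_or_pos d with rfl | hd
    · simp
    exact bound_le_bound (by exact_mod_cast hK) (by exact_mod_cast hd) hm1 (by exact_mod_cast hH)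
      hL hδ0 hδ hT rfl hβ
  refine ⟨hBE, fun Ω _ μ _ R => ?_⟩
  obtain ⟨ω₀⟩ : Nonempty Ω := nonempty_of_isProbabilityMeasure μ
  have : Nonempty S := ⟨R.st 0 0 ω₀⟩
  have : Nonempty W := ⟨R.ctx 0 ω₀⟩
  have hL0 : 0 ≤ L := nonneg_of_isMapping hmap
  -- The comparison of `B` with `E` needs `1 ≤ L`. Below 1 all rewards vanish, so the regret is 0
  -- and only the signs of `B` and `E` matter.
  rcases lt_or_ge L 1 with hL | hL
  · have hreg := R.regret_eq_zero_of_reward_eq_zero fun h hh s a w =>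
      reward_eq_zero_of_isMapping hb hmap hL hh s a w
    have hB0 : 0 ≤ B := by rw [hB]; positivity
    have hE0 : 0 ≤ E := by
      rw [hE]
      refine mul_nonneg (by positivity) ?_
      rcases Nat.eq_zero_or_pos K with rfl | hK
      · simp [hT]
      rcases Nat.eq_zero_or_pos M.H with hH | hH
      · simp [hT, hH]
      rcases Nat.eq_zero_or_pos d with rfl | hd
      · simp
      refine Real.log_nonneg ?_
      rw [hT, le_div_iff₀ hδ0]
      have : (1 : ℝ) ≤ m * d * (K * M.H) := by
        exact_mod_cast Nat.succ_le_of_lt (by positivity : 0 < m * d * (K * M.H))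
      linarith
    exact one_sub_le_measureReal_of_compl (s := ∅) (t := ∅) hδ0.le (by simp) (by simp)
      fun ω _ _ => ⟨(hreg ω).le.trans hB0, (hreg ω).le.trans hE0⟩
  have hset : {ω | R.regret ω ≤ B ∧ R.regret ω ≤ E} = {ω | R.regret ω ≤ B} :=
    Set.ext fun ω => ⟨fun h => h.1, fun h => ⟨h, h.trans (hBE hL)⟩⟩
  rw [hset]
  rcases Nat.eq_zero_or_pos (K * M.H) with hKH | hKH
  · have hB0 : (K : ℝ) * M.H ≤ B := by
      have h0 : (K : ℝ) * M.H = 0 := by exact_mod_cast hKH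
      rw [h0, hB]
      positivity
    exact one_sub_le_measureReal_of_compl (s := ∅) (t := ∅) hδ0.le (by simp) (by simp)
      fun ω _ _ => (R.regret_le_horizon ω).trans hB0
  have hK : 0 < K := Nat.pos_of_mul_pos_right hKH
  have hH : 0 < M.H := Nat.pos_of_mul_pos_left hKH
  rw [hB]
  exact R.one_sub_le_measureReal_regret_le hφ hψ hb hc hmap hD rfl hL0 hδ0 hδ hK
    (dim_pos_of_isBoundedLinearMDP hb hH) hm hH hT rfl hβ
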